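/- **Setting.** Let $\Gamma_h\subset\mathbb R^3$ be a closed (compact, without boundary) oriented surface triangulated by a finite simplicial complex $\mathcal T$, with sets $\mathcal T^r$ of $r$-simplices ($r=0,1,2$), each simplex carrying an arbitrary orientation, and incidence numbers $D^r_{st}\in\{-1,0,1\}$ ($s\in\mathcal T^r$, $t\in\mathcal T^{r+1}$). Let $\widetilde{\mathcal T}$ be the barycentric refinement, with incidence numbers $\widetilde D_{wz}$ and Whitney basis forms $\tilde\lambda^q_w$, $w\in\widetilde{\mathcal T}^q$. For $r+q=2$ the barycentric dual cell of $t\in\mathcal T^r$ is the chain $\star t=\sum_{w\in\widetilde{\mathcal T}^q}c_{\star t,w}\,w$, $c_{\star t,w}\in\{-1,0,1\}$, oriented so that $(\star t,t)$ is in the orientation of $\Gamma_h$. Put $n_{\star t}=\sum_w|c_{\star t,w}|$. Let $U_{\star t}$ be the closed dual face $\overline{\star t}$ if $t$ is a vertex, and otherwise the union of the $U_{\star s}$ over the facets $s$ of $t$. The Buffa–Christiansen basis forms are $\mu^q_{\star t}=\sum_w R^q_{\star t,w}\tilde\lambda^q_w$, with real coefficients determined by the following conditions. 1. $R^q_{\star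 t,w}=0$ if $w\not\subset U_{\star t}$ or $w\subset\partial U_{\star t}$. 2. $R^q_{\star t,w}=c_{\star t,w}/n_{\star t}$ if $c_{\star t,w}\neq0$. 3. For $t\in\mathcal T^1$: $R^1_{\star t,w}=0$ for every $w\in\widetilde{\mathcal T}^1$ contained in $t$. 4. For $t\in\mathcal T^1$ and every $z\in\widetilde{\mathcal T}^2$ with $z\subset U_{\star t}$: $\sum_{w\subset\partial z}R^1_{\star t,w}\widetilde D_{wz}=\sum_{s\in\mathcal T^0}D^0_{st}R^2_{\star s,z}$. 5. For $t\in\mathcal T^2$ and every $z\in\widetilde{\mathcal T}^1$ with $z\subset t$: $\sum_{w\subset\partial z}R^0_{\star t,w}\widetilde D_{wz}=-\sum_{s\in\mathcal T^1}D^1_{st}R^1_{\star s,z}$. Let $\mathcal B^q=\mathrm{span}\{\mu^q_{\star t}: t\in\mathcal T^{2-q}\}$ and $$\Pi\beta=\sum_{t\in\mathcal T^{r}}\Big(\int_{\star t}\beta\Big)\,\mu^q_{\star t},\qquad r+q=2 .$$ A $k$-form $\beta$ on $\Gamma_h$, given piecewise on the closed cells of $\widetilde{\mathcal T}$, is called *regular*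 if its (tangential) traces on the cells of $\widetilde{\mathcal T}$ are single-valued, its trace on every closed cell is continuous and is differentiable in the open cell, and $\mathrm d\beta$ is integrable over every $(k+1)$-cell of $\widetilde{\mathcal T}$. So the de Rham maps (integrals over dual cells) of $\beta$ and $\mathrm d\beta$ exist. **Proposition (commuting projectors onto B-C spaces).** Conditions 1–5 have exactly one solution $R$, and for it: * for $q=0,1,2$, $\Pi$ maps $q$-forms into $\mathcal B^q$, every $b\in\mathcal B^q$ is regular, and $\Pi b=b$; * for $q=1,2$ and every regular $(q-1)$-form $\beta$ on $\Gamma_h$, $$\Pi\,\mathrm d\beta=\mathrm d\,\Pi\beta .$$ -/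

import Mathlib

open MeasureTheory

noncomputable section

/-! ## Reference simplices -/

/-- The closed reference `m`-simplex, with vertices `0, e₀, …, e_{m-1}`. -/
def refSimplex (m : ℕ) : Set (Fin m → ℝ) := {x | (∀ i, 0 ≤ x i) ∧ ∑ i, x i ≤ 1}

/-- The vertices of the reference simplex. -/
def refVertex {m : ℕ} (j : Fin (m + 1)) : Fin m → ℝ :=
  Fin.cases 0 (fun i => Pi.single i 1) j

/-- The barycentric coordinates on the reference simplex. -/
def refBary {m : ℕ} (j : Fin (m + 1)) (x : Fin m → ℝ) : ℝ :=
  Fin.cases (1 - ∑ i, x i) (fun i => x i) j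

/-- The (constant) differentials of the barycentric coordinates. -/
def refBaryDeriv {m : ℕ} (j : Fin (m + 1)) : (Fin m → ℝ) →L[ℝ] ℝ :=
  Fin.cases (-∑ i, ContinuousLinearMap.proj i) (fun i => ContinuousLinearMap.proj i) j

/-- The affine map of reference simplices that sends vertex `i` to vertex `ι i`. -/
def refFaceMap {l m : ℕ} (ι : Fin (l + 1) → Fin (m + 1)) (x : Fin l → ℝ) : Fin m → ℝ :=
  ∑ i, refBary i x • refVertex (ι i)

/-- The linear part of `refFaceMap ι`. -/
def refFaceDeriv {l m : ℕ} (ι : Fin (l + 1) → Fin (m + 1)) :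
    (Fin l → ℝ) →L[ℝ] (Fin m → ℝ) :=
  ∑ i, (refBaryDeriv i).smulRight (refVertex (ι i))

/-- The determinant as a continuous alternating form. -/
def detForm (k : ℕ) : (Fin k → ℝ) [⋀^Fin k]→L[ℝ] ℝ :=
  { (Matrix.detRowAlternating : (Fin k → ℝ) [⋀^Fin k]→ₗ[ℝ] ℝ) with
    cont := (continuous_id (X := Matrix (Fin k) (Fin k) ℝ)).matrix_det }

/-- The exterior product `ℓ₀ ∧ ⋯ ∧ ℓ_{k-1}` of `k` covectors,
`(v₀, …, v_{k-1}) ↦ det (ℓ_j (v_i))`. -/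
def wedgeCovectors {m k : ℕ} (ℓ : Fin k → ((Fin m → ℝ) →L[ℝ] ℝ)) :
    (Fin m → ℝ) [⋀^Fin k]→L[ℝ] ℝ :=
  (detForm k).compContinuousLinearMap (ContinuousLinearMap.pi ℓ)

/-! ## Closed oriented triangulated surfaces in three-space -/

/-- Three-space. -/
abbrev Space3 : Type := EuclideanSpace ℝ (Fin 3)

/-- `x` lists the vertices of the simplex `s`, without repetition. -/
def Enumerates {n : ℕ} (x : Fin n → Space3) (s : Finset Space3) : Prop :=
  Function.Injective x ∧ Set.range x = (s : Set Space3)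

/-- A finite simplicial complex in `ℝ³` whose underlying space is a closed (compact, without
boundary) oriented surface, together with a choice of an orientation for each of its simplices. -/
structure ClosedSurfaceMesh where
  /-- the simplicial complex -/
  K : Geometry.SimplicialComplex ℝ Space3
  finite_faces : K.faces.Finite
  /-- every simplex is a face of a triangle -/
  pure : ∀ s ∈ K.faces, ∃ t ∈ K.faces, s ⊆ t ∧ t.card = 3
  card_le : ∀ s ∈ K.faces, s.card ≤ 3
  /-- there is no boundary: every edge lies in exactly two triangles -/
  closed : ∀ e ∈ K.faces, e.card = 2 → {t | t ∈ K.faces ∧ t.card = 3 ∧ e ⊆ t}.ncard = 2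
  /-- the surface is a manifold at each vertex `a`: the triangles at `a` form one cycle, i.e. any
  two are joined by a chain of triangles at `a` in which consecutive ones share an edge at `a` -/
  star_connected : ∀ (a : Space3) (t t' : Finset Space3),
    t ∈ K.faces → t.card = 3 → a ∈ t → t' ∈ K.faces → t'.card = 3 → a ∈ t' →
    Relation.ReflTransGen
      (fun u u' => u' ∈ K.faces ∧ u'.card = 3 ∧ ∃ e ∈ K.faces, e.card = 2 ∧ a ∈ e ∧ e ⊆ u ∧ e ⊆ u')
      t t'
  /-- orientation of the surface: the sign of an ordered triangle -/
  surfaceSign : (Fin 3 → Space3) → ℤˣ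
  surfaceSign_perm : ∀ x, ∀ t ∈ K.faces, Enumerates x t → ∀ π : Equiv.Perm (Fin 3),
    surfaceSign (x ∘ π) = Equiv.Perm.sign π * surfaceSign x
  /-- adjacent triangles are coherently oriented -/
  surfaceSign_coherent : ∀ x y, ∀ t ∈ K.faces, ∀ t' ∈ K.faces, Enumerates x t → Enumerates y t' →
    t ≠ t' → x 0 = y 0 → x 1 = y 1 → surfaceSign x = -surfaceSign y
  /-- orientation of the individual simplices: the sign of an ordered simplex -/
  cellSign : ∀ {r : ℕ}, (Fin (r + 1) → Space3) → ℤˣ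
  cellSign_perm : ∀ {r : ℕ} (x : Fin (r + 1) → Space3), ∀ s ∈ K.faces, Enumerates x s →
    ∀ π : Equiv.Perm (Fin (r + 1)), cellSign (x ∘ π) = Equiv.Perm.sign π * cellSign x

namespace ClosedSurfaceMesh

variable (M : ClosedSurfaceMesh)

/-- The `r`-dimensional cells of the primal mesh. The barycentric dual cell of `t : M.Cell r`, of
dimension `2 - r`, is indexed by `t`. -/
def Cell (r : ℕ) : Type := {t : Finset Space3 // t ∈ M.K.faces ∧ t.card = r + 1}

/-- The `q`-dimensional cells of the barycentric refinement: the simplex spanned by the barycenters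
of `w₀ ⊂ w₁ ⊂ ⋯ ⊂ w_q`, oriented by this order of its vertices. -/
def Flag (q : ℕ) : Type :=
  {w : Fin (q + 1) → Finset Space3 // (∀ i, w i ∈ M.K.faces) ∧ StrictMono w}

instance (r : ℕ) : Finite (M.Cell r) :=
  (M.finite_faces.subset (fun _ h => h.1) :
    {t : Finset Space3 | t ∈ M.K.faces ∧ t.card = r + 1}.Finite).to_subtype

instance (q : ℕ) : Finite (M.Flag q) :=
  ((Set.Finite.pi' (fun _ : Fin (q + 1) => M.finite_faces)).subset (fun _ h => h.1) :
    {w : Fin (q + 1) → Finset Space3 | (∀ i, w i ∈ M.K.faces) ∧ StrictMono w}.Finite).to_subtype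

instance (r : ℕ) : Fintype (M.Cell r) := Fintype.ofFinite _

instance (q : ℕ) : Fintype (M.Flag q) := Fintype.ofFinite _

variable {M}

/-- The face of `w` that is spanned by the vertices with numbers `ι 0 < ι 1 < ⋯`. -/
def Flag.sub {l m : ℕ} (w : M.Flag m) (ι : Fin (l + 1) ↪o Fin (m + 1)) : M.Flag l :=
  ⟨fun i => w.1 (ι i), fun i => w.2.1 (ι i), w.2.2.comp ι.strictMono⟩

/-- The `i`-th facet of `w`; its incidence number with `w` is `(-1) ^ i`. -/
def Flag.facet {m : ℕ} (w : M.Flag (m + 1)) (i : Fin (m + 2)) : M.Flag m :=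
  w.sub (Fin.succAboveOrderEmb i)

/-- `w` is a (not necessarily proper) face of `z`. -/
def Flag.IsFace {l m : ℕ} (w : M.Flag l) (z : M.Flag m) : Prop := Set.range w.1 ⊆ Set.range z.1

/-- The affine parametrization of the closed cell `w` of the refinement by the reference simplex. -/
def Flag.chart {m : ℕ} (w : M.Flag m) (x : Fin m → ℝ) : Space3 :=
  ∑ j, refBary j x • (w.1 j).centroid ℝ id

theorem sum_refBary {m : ℕ} (x : Fin m → ℝ) : ∑ j, refBary j x = 1 := by
  simp [Fin.sum_univ_succ, refBary]

theorem refBary_refFaceMap {l m : ℕ} (ι : Fin (l + 1) → Fin (m + 1)) (x : Fin l → ℝ)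
    (j : Fin (m + 1)) : refBary j (refFaceMap ι x) = ∑ i, if ι i = j then refBary i x else 0 := by
  have hs := sum_refBary x
  have key : ∀ k, refFaceMap ι x k = ∑ i, if ι i = k.succ then refBary i x else 0 := by
    intro k
    simp only [refFaceMap, Finset.sum_apply, Pi.smul_apply, smul_eq_mul]
    refine Finset.sum_congr rfl fun i _ => ?_
    refine Fin.cases ?_ (fun a => ?_) (ι i)
    · simp [refVertex, (Fin.succ_ne_zero k).symm]
    · simp [refVertex, Pi.single_apply, eq_comm]
  refine Fin.cases ?_ (fun k => ?_) j
  · have h1 : refBary 0 (refFaceMap ι x) = 1 - ∑ k, refFaceMap ι x k := rfl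
    rw [h1, ← hs]
    simp only [key]
    rw [Finset.sum_comm, ← Finset.sum_sub_distrib]
    refine Finset.sum_congr rfl fun i _ => ?_
    refine Fin.cases ?_ (fun a => ?_) (ι i)
    · simp [(Fin.succ_ne_zero _).symm]
    · simp
  · exact key k

/-- `refFaceMap` is the change of parameters between a cell and its face. -/
theorem Flag.chart_sub {l m : ℕ} (w : M.Flag m) (ι : Fin (l + 1) ↪o Fin (m + 1))
    (x : Fin l → ℝ) : (w.sub ι).chart x = w.chart (refFaceMap ι x) := by
  simp only [Flag.chart, refBary_refFaceMap, Finset.sum_smul]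
  rw [Finset.sum_comm]
  refine Finset.sum_congr rfl fun i _ => ?_
  simp [Flag.sub]

/-! ## Incidence numbers, dual cells, supports -/

open Classical in
/-- The incidence number `D_{st}`: if `t` has the vertices `y₀, …, y_{r+1}` and `s` is the face
opposite to `y₀`, the product of the signs of `(y₀, …, y_{r+1})` and of `(y₁, …, y_{r+1})`;
zero if `s` is not a face of `t`. -/
def incidence {r : ℕ} (s : M.Cell r) (t : M.Cell (r + 1)) : ℤ :=
  if h : ∃ y : Fin (r + 2) → Space3, Enumerates y t.1 ∧ Enumerates (fun i => y i.succ) s.1 then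
    ((M.cellSign h.choose * M.cellSign (fun i => h.choose i.succ) : ℤˣ) : ℤ)
  else 0

/-- For `w₀ = t`: `y` lists first the vertices of `t = w₀`, then the new one of `w₁`, and so on. -/
def AdaptedTo {r q : ℕ} (t : M.Cell r) (w : M.Flag q) (y : Fin 3 → Space3) : Prop :=
  Function.Injective y ∧ w.1 0 = t.1 ∧
    ∀ j : Fin (q + 1), (w.1 j : Set Space3) = y '' {i | (i : ℕ) ≤ r + j}

open Classical in
/-- The coefficient `c_{vw}` of `w` in the chain of the dual cell `v = ⋆t`, for `r + q = 2`. The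
cells in `⋆t` are those with `w₀ = t`. The orientation of `⋆t` followed by that of `t` is the
orientation of the surface; the factor `(-1) ^ (r * q)` comes from the interchange of the tangent
directions of `t` (first in the list `y`) with those of `w`. -/
def dualCoeff {r q : ℕ} (h : r + q = 2) (t : M.Cell r) (w : M.Flag q) : ℤ :=
  if hy : ∃ y : Fin 3 → Space3, AdaptedTo t w y then
    (-1) ^ (r * q) * ((M.surfaceSign hy.choose *
      M.cellSign (fun i : Fin (r + 1) => hy.choose (Fin.castLE (by omega) i)) : ℤˣ) : ℤ)
  else 0

/-- The number `n_v` of cells of the refinement in the dual cell `⋆t`. -/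
def dualCount {r q : ℕ} (h : r + q = 2) (t : M.Cell r) : ℤ :=
  ∑ w : M.Flag q, |dualCoeff h t w|

/-- The support `U_{⋆t}`, as a set of small triangles: for a vertex `t`, the dual face `⋆t`; else
the union of the supports for the dual cells `⋆s` with `⋆t` in their boundary, that is, for the
facets `s` of `t`. -/
def bcSupport : (r : ℕ) → M.Cell r → Set (M.Flag 2)
  | 0, t => {z | z.1 0 = t.1}
  | r + 1, t => ⋃ s ∈ {s : M.Cell r | s.1 ⊆ t.1}, bcSupport r s

/-- `w` is contained in the union of the closed small triangles in `U`. -/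
def Flag.InRegion {q : ℕ} (w : M.Flag q) (U : Set (M.Flag 2)) : Prop := ∃ z ∈ U, w.IsFace z

/-- `w` is contained in the boundary (relative to the surface) of the union of the closed small
triangles in `U`. -/
def Flag.InRegionBoundary {q : ℕ} (w : M.Flag q) (U : Set (M.Flag 2)) : Prop :=
  w.InRegion U ∧ w.InRegion Uᶜ

/-- The cell `w` of the refinement is contained in the closed primal cell `t`. -/
def Flag.InCell {q r : ℕ} (w : M.Flag q) (t : M.Cell r) : Prop := w.1 (Fin.last q) ⊆ t.1

/-! ## Differential forms -/

variable (M) in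
/-- A `k`-form on the surface, given piecewise: for each closed cell `w` of the barycentric
refinement, its restriction (trace) to `w`, written in the parametrization `w.chart`. Only the
values on the reference simplex matter, see `Form.Agree`. -/
abbrev Form (k : ℕ) : Type :=
  ∀ m : ℕ, M.Flag m → (Fin m → ℝ) → (Fin m → ℝ) [⋀^Fin k]→L[ℝ] ℝ

/-- Equality of forms on the surface. -/
def Form.Agree {k : ℕ} (α β : M.Form k) : Prop :=
  ∀ (m : ℕ) (w : M.Flag m), Set.EqOn (α m w) (β m w) (refSimplex m)

/-- The (tangential) traces are single valued: the restriction to a face of a cell is the pullback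
of the form on the cell. -/
def Form.IsConforming {k : ℕ} (β : M.Form k) : Prop :=
  ∀ (l m : ℕ) (w : M.Flag m) (ι : Fin (l + 1) ↪o Fin (m + 1)), ∀ x ∈ refSimplex l,
    β l (w.sub ι) x = (β m w (refFaceMap ι x)).compContinuousLinearMap (refFaceDeriv ι)

/-- The exterior derivative, cell by cell. -/
def Form.d {k : ℕ} (β : M.Form k) : M.Form (k + 1) :=
  fun m w => extDerivWithin (β m w) (refSimplex m)

/-- The integrand of a `q`-form on a `q`-cell, in the parametrization. -/
def Form.density {q : ℕ} (β : M.Form q) (w : M.Flag q) (x : Fin q → ℝ) : ℝ :=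
  β q w x (fun i => Pi.single i 1)

/-- The integral of a `q`-form over a `q`-cell of the refinement. -/
def Form.cellIntegral {q : ℕ} (β : M.Form q) (w : M.Flag q) : ℝ :=
  ∫ x in refSimplex q, β.density w x

/-- The integral of a `q`-form over the dual cell `⋆t`. -/
def Form.dualIntegral {r q : ℕ} (h : r + q = 2) (β : M.Form q) (t : M.Cell r) : ℝ :=
  ∑ w : M.Flag q, (dualCoeff h t w : ℝ) * β.cellIntegral w

/-- Sufficiently regular forms: single-valued traces, continuous on every closed cell of the
refinement, differentiable in the open cells, and with an exterior derivative that is integrable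
over the `(k+1)`-cells. So the de Rham maps of the form and of its exterior derivative exist. -/
structure Form.IsRegular {k : ℕ} (β : M.Form k) : Prop where
  conforming : β.IsConforming
  continuousOn : ∀ (m : ℕ) (w : M.Flag m), ContinuousOn (β m w) (refSimplex m)
  differentiableOn : ∀ (m : ℕ) (w : M.Flag m),
    DifferentiableOn ℝ (β m w) (interior (refSimplex m))
  integrable_d : ∀ w : M.Flag (k + 1), IntegrableOn (β.d.density w) (refSimplex (k + 1))

open Classical in
/-- The barycentric coordinate function of the refinement for the node `σ`, on the cell `u`. -/
def nodeBary {m : ℕ} (u : M.Flag m) (σ : Finset Space3) (x : Fin m → ℝ) : ℝ :=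
  ∑ j, if u.1 j = σ then refBary j x else 0

open Classical in
/-- The differential of `nodeBary`. -/
def nodeBaryDeriv {m : ℕ} (u : M.Flag m) (σ : Finset Space3) : (Fin m → ℝ) →L[ℝ] ℝ :=
  ∑ j, if u.1 j = σ then refBaryDeriv j else 0

/-- The Whitney form of the cell `w = (w₀, …, w_q)` of the refinement,
`q! ∑ᵢ (-1)ⁱ λ_{wᵢ} dλ_{w₀} ∧ ⋯ (omit i) ⋯ ∧ dλ_{w_q}`. -/
def whitney {q : ℕ} (w : M.Flag q) : M.Form q := fun _ u x =>
  (q.factorial : ℝ) • ∑ i : Fin (q + 1), ((-1) ^ (i : ℕ) * nodeBary u (w.1 i) x) •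
    wedgeCovectors (fun j : Fin q => nodeBaryDeriv u (w.1 (i.succAbove j)))

/-! ## The Buffa-Christiansen spaces -/

variable (M) in
/-- Coefficients `R_{⋆t,w}`, for `t` of dimension `r`, `w` of dimension `q`, `r + q = 2`. -/
abbrev BCCoeff : Type := ∀ r q : ℕ, r + q = 2 → M.Cell r → M.Flag q → ℝ

/-- The construction of the Buffa-Christiansen coefficients. -/
structure IsBuffaChristiansen (R : M.BCCoeff) : Prop where
  /-- local support -/
  support : ∀ r q (h : r + q = 2) (t : M.Cell r) (w : M.Flag q),
    ¬ w.InRegion (bcSupport r t) → R r q h t w = 0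
  /-- zero trace on the boundary of the support -/
  trace : ∀ r q (h : r + q = 2) (t : M.Cell r) (w : M.Flag q),
    w.InRegionBoundary (bcSupport r t) → R r q h t w = 0
  /-- the cells in the dual cell contribute with equal weight -/
  weight : ∀ r q (h : r + q = 2) (t : M.Cell r) (w : M.Flag q),
    dualCoeff h t w ≠ 0 → R r q h t w = dualCoeff h t w / dualCount h t
  /-- for `1`-forms, the small edges in the primal edge do not contribute -/
  stability : ∀ (t : M.Cell 1) (w : M.Flag 1), w.InCell t → R 1 1 rfl t w = 0
  /-- the remaining coefficients of the `1`-forms, from the small triangles in the support -/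
  oneForms : ∀ (t : M.Cell 1) (z : M.Flag 2), z ∈ bcSupport 1 t →
    ∑ i : Fin 3, (-1) ^ (i : ℕ) * R 1 1 rfl t (z.facet i) =
      ∑ s : M.Cell 0, incidence s t * R 0 2 rfl s z
  /-- the remaining coefficients of the `0`-forms, from the small edges in the primal triangle -/
  zeroForms : ∀ (t : M.Cell 2) (z : M.Flag 1), z.InCell t →
    ∑ i : Fin 2, (-1) ^ (i : ℕ) * R 2 0 rfl t (z.facet i) =
      -∑ s : M.Cell 1, incidence s t * R 1 1 rfl s z

/-- The basis form `μ_{⋆t} = ∑_w R_{⋆t,w} λ_w`. -/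
def bcForm (R : M.BCCoeff) {r q : ℕ} (h : r + q = 2) (t : M.Cell r) : M.Form q :=
  ∑ w : M.Flag q, R r q h t w • whitney w

/-- The space `B^q`, spanned by the `μ_{⋆t}`. -/
def bcSpace (R : M.BCCoeff) {r q : ℕ} (h : r + q = 2) : Submodule ℝ (M.Form q) :=
  Submodule.span ℝ (Set.range (bcForm R h))

/-- The projector `Π β = ∑_t (∫_{⋆t} β) μ_{⋆t}`. -/
def bcProj (R : M.BCCoeff) {r q : ℕ} (h : r + q = 2) (β : M.Form q) : M.Form q :=
  ∑ t : M.Cell r, β.dualIntegral h t • bcForm R h t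

end ClosedSurfaceMesh

end

noncomputable section

namespace ClosedSurfaceMesh

variable {M : ClosedSurfaceMesh}

/-! ## Flags of the refinement -/

/-! Everything reduces to finite cochain identities on the barycentric refinement. The Whitney form
with coefficients `c` has integral `c w` over each cell `w` (`cellIntegral_whitneyForm`), and its
exterior derivative is the Whitney form of the coboundary of `c` (`whitneyForm_d_zero`,
`whitneyForm_d_one`). Stokes' theorem on a small cell (`cellIntegral_d_zero`, `cellIntegral_d_one`)
says that the cell integrals of a regular form obey the same coboundary rule. Hence `Π d = d Π`
follows from two dual facts with the same incidence numbers and the same sign: the boundary of `⋆s`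
is `± ∑ D_{st} ⋆t` (`sum_dualCoeff_vertex`, `sum_dualCoeff_edge`), and the coboundary of `R_{⋆t}` is
`± ∑ D_{st} R_{⋆s}` on the whole surface (`coboundary_one`, `coboundary_zero`). The identity `Π b =
b` is the duality of the cochains `R_{⋆t}` with the chains `⋆s` (`sum_dualCoeff_mul`).

A small triangle is a flag vertex ⊂ edge ⊂ triangle, that is, an ordering of the vertices of a
primal triangle. All signs are evaluated on such orderings and followed under the flips that change
one member of the flag.

Conditions `support` and `trace` together say that `R_{⋆t,w} = 0` unless `w₀ ⊆ t` (`eq_zero`); with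
`weight` this fixes the `2`-cochains. For an edge `t` with endpoint `A`, the unknowns sit on the
small edges issuing from `A`. Consecutive ones are separated by a small triangle at `A`, so they
form a cycle. Condition `oneForms` prescribes the increments along the cycle and `stability` fixes
the constant. The increments sum to zero: the `n` triangles of weight `1/n` balance the two halves
of the dual edge, of weight `1/2` each (`exists_potential_edge`, `exists_potential`).

For a triangle `t`, the value at its center is known, and `zeroForms` on the small edges ending
there gives the values at the other nodes of `t`. The remaining small edges in `t` are consistent
because `D D = 0` makes `∑ D_{st} R_{⋆s}` closed (`coboundary_sum_incidence`). On small edges not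
contained in `t` the identity is not imposed. There its defect is shown to be constant around each
vertex of `t`, hence equal to its value inside `t`, which is zero. -/

theorem Flag.card_apply_pos {q : ℕ} (w : M.Flag q) (i : Fin (q + 1)) : 0 < (w.1 i).card :=
  Finset.card_pos.2 (M.K.nonempty_of_mem_faces (w.2.1 i))

theorem Flag.card_lt {q : ℕ} (w : M.Flag q) {i j : Fin (q + 1)} (h : i < j) :
    (w.1 i).card < (w.1 j).card :=
  Finset.card_lt_card (w.2.2 h)

/-- Three strictly increasing cardinalities between `1` and `3` leave no choice. -/
theorem Flag.card_zero (z : M.Flag 2) : (z.1 0).card = 1 := by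
  have h0 := z.card_apply_pos 0
  have h1 := z.card_lt (show (0 : Fin 3) < 1 by decide)
  have h2 := z.card_lt (show (1 : Fin 3) < 2 by decide)
  have h3 := M.card_le _ (z.2.1 2)
  omega

theorem Flag.card_one (z : M.Flag 2) : (z.1 1).card = 2 := by
  have h0 := z.card_apply_pos 0
  have h1 := z.card_lt (show (0 : Fin 3) < 1 by decide)
  have h2 := z.card_lt (show (1 : Fin 3) < 2 by decide)
  have h3 := M.card_le _ (z.2.1 2)
  omega

theorem Flag.card_two (z : M.Flag 2) : (z.1 2).card = 3 := by
  have h0 := z.card_apply_pos 0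
  have h1 := z.card_lt (show (0 : Fin 3) < 1 by decide)
  have h2 := z.card_lt (show (1 : Fin 3) < 2 by decide)
  have h3 := M.card_le _ (z.2.1 2)
  omega

/-- The vertex of a triangle of the refinement. -/
def Flag.vertexCell (z : M.Flag 2) : M.Cell 0 := ⟨z.1 0, z.2.1 0, z.card_zero⟩

/-- The primal edge of a triangle of the refinement. -/
def Flag.edgeCell (z : M.Flag 2) : M.Cell 1 := ⟨z.1 1, z.2.1 1, z.card_one⟩

/-- The primal triangle of a triangle of the refinement. -/
def Flag.triCell (z : M.Flag 2) : M.Cell 2 := ⟨z.1 2, z.2.1 2, z.card_two⟩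

theorem Flag.ext_zero {w w' : M.Flag 0} (h0 : w.1 0 = w'.1 0) : w = w' := by
  refine Subtype.ext (funext fun i => ?_)
  fin_cases i; exact h0

theorem Flag.ext_one {w w' : M.Flag 1} (h0 : w.1 0 = w'.1 0) (h1 : w.1 1 = w'.1 1) : w = w' := by
  refine Subtype.ext (funext fun i => ?_)
  fin_cases i
  exacts [h0, h1]

theorem Flag.ext_two {w w' : M.Flag 2} (h0 : w.1 0 = w'.1 0) (h1 : w.1 1 = w'.1 1)
    (h2 : w.1 2 = w'.1 2) : w = w' := by
  refine Subtype.ext (funext fun i => ?_)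
  fin_cases i
  exacts [h0, h1, h2]

@[simp] theorem Flag.facet_zero_zero (z : M.Flag 2) : (z.facet 0).1 0 = z.1 1 := rfl
@[simp] theorem Flag.facet_zero_one (z : M.Flag 2) : (z.facet 0).1 1 = z.1 2 := rfl
@[simp] theorem Flag.facet_one_zero (z : M.Flag 2) : (z.facet 1).1 0 = z.1 0 := rfl
@[simp] theorem Flag.facet_one_one (z : M.Flag 2) : (z.facet 1).1 1 = z.1 2 := rfl
@[simp] theorem Flag.facet_two_zero (z : M.Flag 2) : (z.facet 2).1 0 = z.1 0 := rfl
@[simp] theorem Flag.facet_two_one (z : M.Flag 2) : (z.facet 2).1 1 = z.1 1 := rfl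

/-- The vertices of the cells of `z`, in the order in which they appear. -/
structure Flag.Lists (z : M.Flag 2) (y : Fin 3 → Space3) : Prop where
  injective : Function.Injective y
  mem_zero : ∀ p, p ∈ z.1 0 ↔ p = y 0
  mem_one : ∀ p, p ∈ z.1 1 ↔ p = y 0 ∨ p = y 1
  mem_two : ∀ p, p ∈ z.1 2 ↔ p = y 0 ∨ p = y 1 ∨ p = y 2

theorem injective_fin_three {α : Type*} {y : Fin 3 → α} (h01 : y 0 ≠ y 1) (h02 : y 0 ≠ y 2)
    (h12 : y 1 ≠ y 2) : Function.Injective y := by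
  intro i j h
  fin_cases i <;> fin_cases j <;> simp_all

theorem Flag.Lists.ne_zero_one {z : M.Flag 2} {y : Fin 3 → Space3} (h : z.Lists y) : y 0 ≠ y 1 :=
  h.injective.ne (by decide)

theorem Flag.Lists.ne_zero_two {z : M.Flag 2} {y : Fin 3 → Space3} (h : z.Lists y) : y 0 ≠ y 2 :=
  h.injective.ne (by decide)

theorem Flag.Lists.ne_one_two {z : M.Flag 2} {y : Fin 3 → Space3} (h : z.Lists y) : y 1 ≠ y 2 :=
  h.injective.ne (by decide)

theorem Flag.exists_lists (z : M.Flag 2) : ∃ y, z.Lists y := by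
  classical
  obtain ⟨a, ha⟩ := Finset.card_eq_one.1 z.card_zero
  have h01 : z.1 0 ⊆ z.1 1 := (z.2.2 (show (0 : Fin 3) < 1 by decide)).le
  have h12 : z.1 1 ⊆ z.1 2 := (z.2.2 (show (1 : Fin 3) < 2 by decide)).le
  -- Each member of the flag has one vertex more than the previous one; these new vertices are the
  -- list.
  obtain ⟨b, hb⟩ := Finset.card_eq_one.1
    (show (z.1 1 \ z.1 0).card = 1 by
      rw [Finset.card_sdiff_of_subset h01, z.card_one, z.card_zero])
  obtain ⟨c, hc⟩ := Finset.card_eq_one.1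
    (show (z.1 2 \ z.1 1).card = 1 by
      rw [Finset.card_sdiff_of_subset h12, z.card_two, z.card_one])
  have h0 : ∀ p, p ∈ z.1 0 ↔ p = a := fun p => by rw [ha, Finset.mem_singleton]
  have h1 : ∀ p, p ∈ z.1 1 ↔ p = a ∨ p = b := fun p => by
    have := congrArg (p ∈ ·) hb
    simp only [Finset.mem_sdiff, Finset.mem_singleton, eq_iff_iff] at this
    have h' := @h01 p
    rw [h0] at this h'
    tauto
  have h2 : ∀ p, p ∈ z.1 2 ↔ p = a ∨ p = b ∨ p = c := fun p => by
    have := congrArg (p ∈ ·) hc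
    simp only [Finset.mem_sdiff, Finset.mem_singleton, eq_iff_iff] at this
    have h' := @h12 p
    rw [h1] at this h'
    tauto
  have hb' := (congrArg (b ∈ ·) hb).to_iff.2 (Finset.mem_singleton_self b)
  have hc' := (congrArg (c ∈ ·) hc).to_iff.2 (Finset.mem_singleton_self c)
  rw [Finset.mem_sdiff, h0] at hb'
  rw [Finset.mem_sdiff, h1] at hc'
  refine ⟨![a, b, c], injective_fin_three ?_ ?_ ?_, h0, h1, h2⟩
  · exact fun h => hb'.2 h.symm
  · exact fun h => hc'.2 (Or.inl h.symm)
  · exact fun h => hc'.2 (Or.inr h.symm)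

theorem Flag.Lists.unique {z z' : M.Flag 2} {y y' : Fin 3 → Space3} (h : z.Lists y)
    (h' : z'.Lists y') (h0 : z.1 0 = z'.1 0) (h1 : z.1 1 = z'.1 1) : y 0 = y' 0 ∧ y 1 = y' 1 := by
  have e0 : y 0 = y' 0 := (h'.mem_zero _).1 (h0 ▸ (h.mem_zero _).2 rfl)
  have e1 : y 1 = y' 1 := ((h'.mem_one _).1 (h1 ▸ (h.mem_one _).2 (Or.inr rfl))).resolve_left
    fun e => h.ne_zero_one (e0.trans e.symm)
  exact ⟨e0, e1⟩

theorem Flag.Lists.eq {z : M.Flag 2} {y y' : Fin 3 → Space3} (h : z.Lists y)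
    (h' : z.Lists y') : y = y' := by
  obtain ⟨e0, e1⟩ := h.unique h' rfl rfl
  have e2 : y 2 = y' 2 := by
    rcases (h'.mem_two _).1 ((h.mem_two _).2 (Or.inr (Or.inr rfl))) with e | e | e
    · exact absurd (e0.trans e.symm) h.ne_zero_two
    · exact absurd (e1.trans e.symm) h.ne_one_two
    · exact e
  funext i
  fin_cases i
  exacts [e0, e1, e2]

/-- The vertices of a triangle of the refinement. -/
def Flag.vert (z : M.Flag 2) : Fin 3 → Space3 := z.exists_lists.choose

theorem Flag.lists_vert (z : M.Flag 2) : z.Lists z.vert := z.exists_lists.choose_spec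

theorem Flag.Lists.enumerates {z : M.Flag 2} {y : Fin 3 → Space3} (h : z.Lists y) :
    Enumerates y (z.1 2) := by
  refine ⟨h.injective, Set.ext fun p => ?_⟩
  rw [Finset.mem_coe, h.mem_two, Set.mem_range, Fin.exists_fin_succ, Fin.exists_fin_two]
  simp only [eq_comm (b := p)]; rfl

/-- Initial segments of an ordering form a flag. Together with `Flag.exists_lists` this identifies
small triangles with ordered primal triangles, which is how permutation rules for signs become rules
for flags. -/
theorem exists_flag_lists {T : Finset Space3} (hT : T ∈ M.K.faces) {y : Fin 3 → Space3}
    (hy : Enumerates y T) : ∃ z : M.Flag 2, z.1 2 = T ∧ z.Lists y := by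
  classical
  have h01 : y 0 ≠ y 1 := hy.1.ne (by decide)
  have h02 : y 0 ≠ y 2 := hy.1.ne (by decide)
  have h12 : y 1 ≠ y 2 := hy.1.ne (by decide)
  have hm : ∀ p, p ∈ T ↔ p = y 0 ∨ p = y 1 ∨ p = y 2 := fun p => by
    rw [← Finset.mem_coe, ← hy.2, Set.mem_range, Fin.exists_fin_succ, Fin.exists_fin_two]
    simp only [eq_comm (b := p)]; rfl
  have s1 : ({y 0} : Finset Space3) ⊂ {y 0, y 1} := by
    refine Finset.ssubset_iff_subset_ne.2 ⟨by simp, fun h => ?_⟩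
    have : y 1 ∈ ({y 0} : Finset Space3) := by rw [h]; simp
    exact h01 (Finset.mem_singleton.1 this).symm
  have s2 : ({y 0, y 1} : Finset Space3) ⊂ T := by
    refine Finset.ssubset_iff_subset_ne.2 ⟨fun p => ?_, fun h => ?_⟩
    · rw [hm]; simp only [Finset.mem_insert, Finset.mem_singleton]; tauto
    · have : y 2 ∈ ({y 0, y 1} : Finset Space3) := by rw [h, hm]; simp
      simp only [Finset.mem_insert, Finset.mem_singleton] at this
      rcases this with e | e
      exacts [h02 e.symm, h12 e.symm]
  refine ⟨⟨![{y 0}, {y 0, y 1}, T], fun i => ?_, ?_⟩, rfl, hy.1, fun p => ?_, fun p => ?_, hm⟩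
  · fin_cases i
    · exact M.K.down_closed hT (s1.le.trans s2.le) (by simp)
    · exact M.K.down_closed hT s2.le (by simp)
    · exact hT
  · refine Fin.strictMono_iff_lt_succ.2 fun i => ?_
    fin_cases i
    exacts [s1, s2]
  · exact Finset.mem_singleton
  · change p ∈ ({y 0, y 1} : Finset Space3) ↔ _
    simp

theorem exists_enumerates_of_card {T : Finset Space3} {n : ℕ} (h : T.card = n) :
    ∃ y : Fin n → Space3, Enumerates y T := by
  let e := (T.equivFinOfCardEq h).symm
  exact ⟨fun i => e i, Subtype.val_injective.comp e.injective, by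
    rw [← Function.comp_def, Set.range_comp, e.surjective.range_eq]; simp⟩

theorem _root_.Enumerates.comp {n : ℕ} {y : Fin n → Space3} {T : Finset Space3} (h : Enumerates y T)
    (π : Equiv.Perm (Fin n)) : Enumerates (y ∘ π) T :=
  ⟨h.1.comp π.injective, by rw [Set.range_comp, π.surjective.range_eq, Set.image_univ, h.2]⟩

theorem _root_.Enumerates.exists_perm {n : ℕ} {y y' : Fin n → Space3} {T : Finset Space3}
    (h : Enumerates y T) (h' : Enumerates y' T) : ∃ π : Equiv.Perm (Fin n), y' = y ∘ π := by
  have hr : Set.range y' = Set.range y := by rw [h.2, h'.2]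
  let e : Equiv.Perm (Fin n) := ((Equiv.ofInjective y' h'.1).trans (Equiv.setCongr hr)).trans
    (Equiv.ofInjective y h.1).symm
  refine ⟨e, funext fun i => ?_⟩
  have := Equiv.apply_ofInjective_symm h.1 ((Equiv.setCongr hr) (Equiv.ofInjective y' h'.1 i))
  exact this.symm

/-- With edge and triangle fixed, only the choice of the endpoint of the edge is left. -/
theorem Flag.Lists.swap_zero_one {z z' : M.Flag 2} {y y' : Fin 3 → Space3} (h : z.Lists y)
    (h' : z'.Lists y') (h1 : z'.1 1 = z.1 1) (h2 : z'.1 2 = z.1 2) (hne : z' ≠ z) :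
    y' = y ∘ Equiv.swap 0 1 := by
  have m0 : y' 0 = y 0 ∨ y' 0 = y 1 := (h.mem_one _).1 (h1 ▸ (h'.mem_one _).2 (Or.inl rfl))
  have m1 : y' 1 = y 0 ∨ y' 1 = y 1 := (h.mem_one _).1 (h1 ▸ (h'.mem_one _).2 (Or.inr rfl))
  have m2 := (h.mem_two _).1 (h2 ▸ (h'.mem_two _).2 (Or.inr (Or.inr rfl)))
  have n0 : y' 0 ≠ y 0 := fun e => hne (Flag.ext_two
    (Finset.ext fun p => by rw [h.mem_zero, h'.mem_zero, e]) h1 h2)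
  have a01 := h'.ne_zero_one
  have a02 := h'.ne_zero_two
  have a12 := h'.ne_one_two
  funext i
  fin_cases i
  · change y' 0 = y 1
    grind
  · change y' 1 = y 0
    grind
  · change y' 2 = y 2
    grind

/-- With vertex and triangle fixed, only the order of the other two vertices is left. -/
theorem Flag.Lists.swap_one_two {z z' : M.Flag 2} {y y' : Fin 3 → Space3} (h : z.Lists y)
    (h' : z'.Lists y') (h1 : z'.1 0 = z.1 0) (h2 : z'.1 2 = z.1 2) (hne : z' ≠ z) :
    y' = y ∘ Equiv.swap 1 2 := by
  have m0 : y' 0 = y 0 := (h.mem_zero _).1 (h1 ▸ (h'.mem_zero _).2 rfl)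
  have m1 := (h.mem_two _).1 (h2 ▸ (h'.mem_two _).2 (Or.inr (Or.inl rfl)))
  have m2 := (h.mem_two _).1 (h2 ▸ (h'.mem_two _).2 (Or.inr (Or.inr rfl)))
  have n0 : y' 1 ≠ y 1 := fun e => hne (Flag.ext_two h1
    (Finset.ext fun p => by rw [h.mem_one, h'.mem_one, e, m0]) h2)
  have a01 := h'.ne_zero_one
  have a02 := h'.ne_zero_two
  have a12 := h'.ne_one_two
  funext i
  fin_cases i
  · exact m0
  · change y' 1 = y 2
    grind
  · change y' 2 = y 1
    grind

theorem Flag.Lists.swap_one_two_lists {z : M.Flag 2} {y : Fin 3 → Space3} (h : z.Lists y) :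
    ∃ z' : M.Flag 2, z' ≠ z ∧ z'.1 0 = z.1 0 ∧ z'.1 2 = z.1 2 := by
  obtain ⟨z', h2, hz'⟩ := exists_flag_lists (z.2.1 2) (h.enumerates.comp (Equiv.swap 1 2))
  refine ⟨z', fun e => ?_, Finset.ext fun p => ?_, h2⟩
  · subst e
    exact h.ne_one_two (congrFun (h.eq hz') 1)
  · rw [hz'.mem_zero, h.mem_zero]
    rfl

/-- The flag with another edge. -/
theorem Flag.exists_flip_one (z : M.Flag 2) : ∃ z' : M.Flag 2, z' ≠ z ∧
    ∀ z'' : M.Flag 2, (z''.1 0 = z.1 0 ∧ z''.1 2 = z.1 2) ↔ z'' = z ∨ z'' = z' := by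
  obtain ⟨z', hne, h1, h2⟩ := z.lists_vert.swap_one_two_lists
  refine ⟨z', hne, fun z'' => ⟨fun h => ?_, ?_⟩⟩
  · by_contra! hc
    have e1 := z.lists_vert.swap_one_two z'.lists_vert h1 h2 hne
    have e2 := z.lists_vert.swap_one_two z''.lists_vert h.1 h.2 hc.1
    refine hc.2 (Flag.ext_two (h.1.trans h1.symm) (Finset.ext fun p => ?_) (h.2.trans h2.symm))
    rw [z''.lists_vert.mem_one, z'.lists_vert.mem_one, e1, e2]
  · rintro (rfl | rfl)
    exacts [⟨rfl, rfl⟩, ⟨h1, h2⟩]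

/-- A flag from a chain of three faces. -/
theorem exists_flag_two {A B C : Finset Space3} (hA : A ∈ M.K.faces) (hB : B ∈ M.K.faces)
    (hC : C ∈ M.K.faces) (hAB : A ⊂ B) (hBC : B ⊂ C) :
    ∃ z : M.Flag 2, z.1 0 = A ∧ z.1 1 = B ∧ z.1 2 = C := by
  refine ⟨⟨![A, B, C], fun i => ?_, Fin.strictMono_iff_lt_succ.2 fun i => ?_⟩, rfl, rfl, rfl⟩
  · fin_cases i
    exacts [hA, hB, hC]
  · fin_cases i
    exacts [hAB, hBC]

theorem ssubset_of_card {A B : Finset Space3} (h : A ⊆ B) (hc : A.card < B.card) : A ⊂ B :=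
  Finset.ssubset_iff_subset_ne.2 ⟨h, fun e => by rw [e] at hc; exact lt_irrefl _ hc⟩

/-- The flag with another triangle. -/
theorem Flag.exists_flip_two (z : M.Flag 2) : ∃ z' : M.Flag 2, z' ≠ z ∧
    ∀ z'' : M.Flag 2, (z''.1 0 = z.1 0 ∧ z''.1 1 = z.1 1) ↔ z'' = z ∨ z'' = z' := by
  -- Absence of boundary enters here: the edge lies in exactly two triangles, one of which is that
  -- of `z`.
  obtain ⟨T, T', hne, hT⟩ := Set.ncard_eq_two.1 (M.closed _ (z.2.1 1) z.card_one)
  have hm : ∀ t, (t ∈ M.K.faces ∧ t.card = 3 ∧ z.1 1 ⊆ t) ↔ t = T ∨ t = T' := fun t => by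
    rw [← Set.mem_ofPred_eq (p := fun t => t ∈ M.K.faces ∧ t.card = 3 ∧ z.1 1 ⊆ t), hT]; simp
  have hs : ∀ z'' : M.Flag 2, z''.1 1 ⊆ z''.1 2 := fun z'' =>
    (z''.2.2 (show (1 : Fin 3) < 2 by decide)).le
  have hz := (hm (z.1 2)).1 ⟨z.2.1 2, z.card_two, hs z⟩
  have key : ∃ S, S ≠ z.1 2 ∧ ∀ t, (t ∈ M.K.faces ∧ t.card = 3 ∧ z.1 1 ⊆ t) ↔ t = z.1 2 ∨ t = S := by
    rcases hz with e | e
    · exact ⟨T', by rw [e]; exact hne.symm, by rw [e]; exact hm⟩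
    · exact ⟨T, by rw [e]; exact hne, by rw [e]; exact fun t => (hm t).trans or_comm⟩
  obtain ⟨S, hSne, hS⟩ := key
  obtain ⟨hS1, hS2, hS3⟩ := (hS S).2 (Or.inr rfl)
  obtain ⟨z', h0, h1, h2⟩ := exists_flag_two (z.2.1 0) (z.2.1 1) hS1
    (z.2.2 (show (0 : Fin 3) < 1 by decide))
    (ssubset_of_card hS3 (by rw [z.card_one, hS2]; norm_num))
  refine ⟨z', fun e => hSne (by rw [← h2, e]), fun z'' => ⟨fun h => ?_, ?_⟩⟩
  · have := (hS (z''.1 2)).1 ⟨z''.2.1 2, z''.card_two, h.2 ▸ hs z''⟩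
    rcases this with e | e
    · exact Or.inl (Flag.ext_two h.1 h.2 e)
    · exact Or.inr (Flag.ext_two (h.1.trans h0.symm) (h.2.trans h1.symm) (e.trans h2.symm))
  · rintro (rfl | rfl)
    exacts [⟨rfl, rfl⟩, ⟨h0, h1⟩]

/-! ## Signs -/

/-- The sign of the listing of the vertices of `z` in the oriented surface. -/
def Flag.orient (z : M.Flag 2) : ℤˣ := M.surfaceSign z.vert

/-- The sign of the listing of the vertices of the `r`-dimensional cell of `z`. -/
def Flag.eps (z : M.Flag 2) (r : ℕ) (hr : r + 1 ≤ 3) : ℤˣ :=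
  M.cellSign (fun i : Fin (r + 1) => z.vert (Fin.castLE hr i))

theorem Flag.eps_congr {z z' : M.Flag 2} {r : ℕ} (hr : r + 1 ≤ 3)
    (h : ∀ i : Fin 3, (i : ℕ) ≤ r → z.vert i = z'.vert i) : z.eps r hr = z'.eps r hr := by
  unfold Flag.eps
  congr 1
  funext i
  exact h _ (Nat.lt_succ_iff.1 i.2)

theorem Flag.enumerates_edge (z : M.Flag 2) (hr : 1 + 1 ≤ 3) :
    Enumerates (fun i : Fin 2 => z.vert (Fin.castLE hr i)) (z.1 1) := by
  refine ⟨z.lists_vert.injective.comp (Fin.castLE_injective hr), Set.ext fun p => ?_⟩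
  rw [Finset.mem_coe, z.lists_vert.mem_one, Set.mem_range, Fin.exists_fin_two]
  simp only [eq_comm (b := p)]; rfl

theorem Flag.eps_two (z : M.Flag 2) (hr : 2 + 1 ≤ 3) : z.eps 2 hr = M.cellSign z.vert := rfl

/-- The flip is a transposition of the first two vertices, odd both on the edge and on the triangle.
-/
theorem neg_of_flip_zero {z z' : M.Flag 2} (hne : z' ≠ z) (h1 : z'.1 1 = z.1 1)
    (h2 : z'.1 2 = z.1 2) : z'.orient = -z.orient ∧ z'.eps 1 (by norm_num) = -z.eps 1 (by norm_num) ∧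
      z'.eps 2 le_rfl = -z.eps 2 le_rfl := by
  have e := z.lists_vert.swap_zero_one z'.lists_vert h1 h2 hne
  refine ⟨?_, ?_, ?_⟩
  · rw [Flag.orient, e, M.surfaceSign_perm _ _ (z.2.1 2) z.lists_vert.enumerates,
      Equiv.Perm.sign_swap (by decide), neg_one_mul]
    rfl
  · have : (fun i : Fin 2 => z'.vert (Fin.castLE (by norm_num : 1 + 1 ≤ 3) i)) =
        (fun i : Fin 2 => z.vert (Fin.castLE (by norm_num : 1 + 1 ≤ 3) i)) ∘ Equiv.swap 0 1 := by
      rw [e]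
      funext i
      fin_cases i <;> rfl
    rw [Flag.eps, this, M.cellSign_perm _ _ (z.2.1 1) (z.enumerates_edge _),
      Equiv.Perm.sign_swap (by decide), neg_one_mul]
    rfl
  · rw [Flag.eps_two, e, M.cellSign_perm _ _ (z.2.1 2) z.lists_vert.enumerates,
      Equiv.Perm.sign_swap (by decide), neg_one_mul]
    rfl

/-- The flip transposes the last two vertices. The sign of the edge is not compared, since the edge
itself changes. -/
theorem neg_of_flip_one {z z' : M.Flag 2} (hne : z' ≠ z) (h1 : z'.1 0 = z.1 0)
    (h2 : z'.1 2 = z.1 2) : z'.orient = -z.orient ∧ z'.eps 0 (by norm_num) = z.eps 0 (by norm_num) ∧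
      z'.eps 2 le_rfl = -z.eps 2 le_rfl := by
  have e := z.lists_vert.swap_one_two z'.lists_vert h1 h2 hne
  refine ⟨?_, ?_, ?_⟩
  · rw [Flag.orient, e, M.surfaceSign_perm _ _ (z.2.1 2) z.lists_vert.enumerates,
      Equiv.Perm.sign_swap (by decide), neg_one_mul]
    rfl
  · refine Flag.eps_congr _ fun i hi => ?_
    obtain rfl : i = 0 := Fin.ext (by simpa using hi)
    rw [e]; rfl
  · rw [Flag.eps_two, e, M.cellSign_perm _ _ (z.2.1 2) z.lists_vert.enumerates,
      Equiv.Perm.sign_swap (by decide), neg_one_mul]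
    rfl

theorem eps_eq_of_edge_eq {z z' : M.Flag 2} (h0 : z'.1 0 = z.1 0) (h1 : z'.1 1 = z.1 1) :
    z'.eps 0 (by norm_num) = z.eps 0 (by norm_num) ∧
      z'.eps 1 (by norm_num) = z.eps 1 (by norm_num) := by
  obtain ⟨e0, e1⟩ := z'.lists_vert.unique z.lists_vert h0 h1
  refine ⟨Flag.eps_congr _ fun i hi => ?_, Flag.eps_congr _ fun i hi => ?_⟩
  · obtain rfl : i = 0 := Fin.ext (by simpa using hi)
    exact e0
  · fin_cases i
    exacts [e0, e1, absurd hi (by norm_num)]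

theorem eps_zero_eq {z z' : M.Flag 2} (h0 : z'.1 0 = z.1 0) :
    z'.eps 0 (by norm_num) = z.eps 0 (by norm_num) := by
  refine Flag.eps_congr _ fun i hi => ?_
  obtain rfl : i = 0 := Fin.ext (by simpa using hi)
  exact (z.lists_vert.mem_zero _).1 (h0 ▸ (z'.lists_vert.mem_zero _).2 rfl)

/-- The two orderings share their first two vertices and lie in adjacent triangles, so this is
coherence of the orientation of the surface. -/
theorem neg_of_flip_two {z z' : M.Flag 2} (hne : z' ≠ z) (h0 : z'.1 0 = z.1 0)
    (h1 : z'.1 1 = z.1 1) : z'.orient = -z.orient := by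
  obtain ⟨e0, e1⟩ := z'.lists_vert.unique z.lists_vert h0 h1
  exact M.surfaceSign_coherent _ _ _ (z'.2.1 2) _ (z.2.1 2) z'.lists_vert.enumerates
    z.lists_vert.enumerates (fun e => hne (Flag.ext_two h0 h1 e)) e0 e1

/-- `w` consists of the cells of `z` of dimension at least `r`. -/
def Flag.IsTail {r q : ℕ} (h : r + q = 2) (w : M.Flag q) (z : M.Flag 2) : Prop :=
  ∀ j : Fin (q + 1), w.1 j = z.1 ⟨r + j, by omega⟩

/-- Two completions of `w` to a full flag differ by reordering the vertices of `w₀`, which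
multiplies both signs by the same factor. This makes `dualCoeff` independent of the list chosen in
its definition. -/
theorem orient_mul_eps_eq {r q : ℕ} (h : r + q = 2) {w : M.Flag q} {z z' : M.Flag 2}
    (hz : w.IsTail h z) (hz' : w.IsTail h z') :
    z'.orient * z'.eps r (by omega) = z.orient * z.eps r (by omega) := by
  have he : ∀ j : Fin (q + 1), z'.1 ⟨r + j, by omega⟩ = z.1 ⟨r + j, by omega⟩ := fun j =>
    (hz' j).symm.trans (hz j)
  obtain ⟨rfl, rfl⟩ | ⟨rfl, rfl⟩ | ⟨rfl, rfl⟩ : (r = 0 ∧ q = 2) ∨ (r = 1 ∧ q = 1) ∨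
      (r = 2 ∧ q = 0) := by omega
  · rw [Flag.ext_two (w := z') (w' := z) (he 0) (he 1) (he 2)]
  · by_cases hne : z' = z
    · rw [hne]
    · obtain ⟨e1, e2, -⟩ := neg_of_flip_zero hne (he 0) (he 1)
      rw [e1, e2, neg_mul_neg]
  · obtain ⟨π, hπ⟩ := z.lists_vert.enumerates.exists_perm (y' := z'.vert)
      (he 0 ▸ z'.lists_vert.enumerates)
    rw [Flag.eps_two, Flag.eps_two, Flag.orient, Flag.orient, hπ,
      M.surfaceSign_perm _ _ (z.2.1 2) z.lists_vert.enumerates,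
      M.cellSign_perm _ _ (z.2.1 2) z.lists_vert.enumerates, mul_mul_mul_comm, Int.units_mul_self,
      one_mul]

theorem Flag.Lists.coe_eq {z : M.Flag 2} {y : Fin 3 → Space3} (h : z.Lists y) (j : Fin 3) :
    (z.1 j : Set Space3) = y '' {i | (i : ℕ) ≤ j} := by
  ext p
  rw [Finset.mem_coe, Set.mem_image, Fin.exists_fin_succ, Fin.exists_fin_two]
  fin_cases j
  · refine (h.mem_zero p).trans ?_
    simp [eq_comm]
  · refine (h.mem_one p).trans ?_
    simp [eq_comm]
  · refine (h.mem_two p).trans ?_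
    simp [eq_comm]

theorem AdaptedTo.exists_tail {r q : ℕ} (h : r + q = 2) {t : M.Cell r} {w : M.Flag q}
    {y : Fin 3 → Space3} (hy : AdaptedTo t w y) : ∃ z : M.Flag 2, z.vert = y ∧ w.IsTail h z := by
  have hl : Enumerates y (w.1 (Fin.last q)) := by
    refine ⟨hy.1, ?_⟩
    rw [hy.2.2, ← Set.image_univ]
    congr 1
    ext i
    simp only [Set.mem_univ, Fin.val_last, Set.mem_ofPred_eq, true_iff]
    omega
  obtain ⟨z, -, hz⟩ := exists_flag_lists (w.2.1 _) hl
  refine ⟨z, z.lists_vert.eq hz, fun j => ?_⟩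
  rw [← Finset.coe_inj, hy.2.2, hz.coe_eq]

theorem Flag.IsTail.adaptedTo {r q : ℕ} {h : r + q = 2} {t : M.Cell r} {w : M.Flag q}
    {z : M.Flag 2} (hz : w.IsTail h z) (ht : w.1 0 = t.1) : AdaptedTo t w z.vert :=
  ⟨z.lists_vert.injective, ht, fun j => by rw [hz j, z.lists_vert.coe_eq]⟩

/-- The choice in the definition of `dualCoeff` is replaced by any convenient completion `z`. -/
theorem dualCoeff_of_isTail {r q : ℕ} {h : r + q = 2} {t : M.Cell r} {w : M.Flag q}
    {z : M.Flag 2} (hz : w.IsTail h z) (ht : w.1 0 = t.1) :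
    dualCoeff h t w = (-1) ^ (r * q) * ((z.orient * z.eps r (by omega) : ℤˣ) : ℤ) := by
  have hex : ∃ y, AdaptedTo t w y := ⟨_, hz.adaptedTo ht⟩
  obtain ⟨z', hv, hz'⟩ := hex.choose_spec.exists_tail h
  rw [dualCoeff, dif_pos hex, ← orient_mul_eps_eq h hz hz', ← hv]
  rfl

theorem dualCoeff_eq_zero {r q : ℕ} (h : r + q = 2) {t : M.Cell r} {w : M.Flag q}
    (ht : w.1 0 ≠ t.1) : dualCoeff h t w = 0 :=
  dif_neg fun ⟨_, hy⟩ => ht hy.2.1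

theorem Flag.exists_isTail_of_card {r q : ℕ} (h : r + q = 2) (w : M.Flag q)
    (hw : (w.1 0).card = r + 1) : ∃ z : M.Flag 2, w.IsTail h z := by
  obtain ⟨rfl, rfl⟩ | ⟨rfl, rfl⟩ | ⟨rfl, rfl⟩ : (r = 0 ∧ q = 2) ∨ (r = 1 ∧ q = 1) ∨
      (r = 2 ∧ q = 0) := by omega
  · exact ⟨w, fun j => by simp⟩
  · obtain ⟨p, hp⟩ := M.K.nonempty_of_mem_faces (w.2.1 0)
    obtain ⟨z, -, h1, h2⟩ := exists_flag_two
      (M.K.down_closed (w.2.1 0) (Finset.singleton_subset_iff.2 hp) (Finset.singleton_nonempty p))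
      (w.2.1 0) (w.2.1 1) (ssubset_of_card (Finset.singleton_subset_iff.2 hp)
        (by rw [hw, Finset.card_singleton]; norm_num)) (w.2.2 (show (0 : Fin 2) < 1 by decide))
    refine ⟨z, fun j => ?_⟩
    fin_cases j
    exacts [h1.symm, h2.symm]
  · obtain ⟨y, hy⟩ := exists_enumerates_of_card hw
    obtain ⟨z, h2, -⟩ := exists_flag_lists (w.2.1 0) hy
    refine ⟨z, fun j => ?_⟩
    fin_cases j
    exact h2.symm

theorem abs_dualCoeff {r q : ℕ} (h : r + q = 2) {t : M.Cell r} {w : M.Flag q}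
    (ht : w.1 0 = t.1) : |dualCoeff h t w| = 1 := by
  obtain ⟨z, hz⟩ := w.exists_isTail_of_card h (ht ▸ t.2.2)
  rw [dualCoeff_of_isTail hz ht, abs_mul, abs_pow, abs_neg, abs_one, one_pow, one_mul,
    Int.isUnit_iff_abs_eq.1 (Units.isUnit _)]

theorem dualCoeff_ne_zero {r q : ℕ} (h : r + q = 2) {t : M.Cell r} {w : M.Flag q} :
    dualCoeff h t w ≠ 0 ↔ w.1 0 = t.1 :=
  ⟨fun hn => by_contra fun hc => hn (dualCoeff_eq_zero h hc), fun ht hc => by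
    have := abs_dualCoeff h ht
    simp [hc] at this⟩

theorem Cell.exists_flag {r q : ℕ} (h : r + q = 2) (t : M.Cell r) :
    ∃ w : M.Flag q, w.1 0 = t.1 := by
  obtain ⟨T, hT, htT, hc⟩ := M.pure _ t.2.1
  obtain ⟨rfl, rfl⟩ | ⟨rfl, rfl⟩ | ⟨rfl, rfl⟩ : (r = 0 ∧ q = 2) ∨ (r = 1 ∧ q = 1) ∨
      (r = 2 ∧ q = 0) := by omega
  · obtain ⟨s, hs1, hs2, hs3⟩ := Finset.exists_subsuperset_card_eq (n := 2) htT
      (by rw [t.2.2]; norm_num) (by rw [hc]; norm_num)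
    obtain ⟨z, h0, -⟩ := exists_flag_two t.2.1
      (M.K.down_closed hT hs2 (Finset.card_pos.1 (by rw [hs3]; norm_num))) hT
      (ssubset_of_card hs1 (by rw [hs3, t.2.2]; norm_num))
      (ssubset_of_card hs2 (by rw [hs3, hc]; norm_num))
    exact ⟨z, h0⟩
  · refine ⟨⟨![t.1, T], fun i => ?_, Fin.strictMono_iff_lt_succ.2 fun i => ?_⟩, rfl⟩
    · fin_cases i
      exacts [t.2.1, hT]
    · have hlt : t.1 ⊂ T := ssubset_of_card htT (by rw [t.2.2, hc]; norm_num)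
      fin_cases i
      exact hlt
  · exact ⟨⟨fun _ => t.1, fun _ => t.2.1, fun i j hij => by omega⟩, rfl⟩

theorem dualCount_pos {r q : ℕ} (h : r + q = 2) (t : M.Cell r) : 0 < dualCount h t := by
  obtain ⟨w, hw⟩ := t.exists_flag h
  exact Finset.sum_pos' (fun _ _ => abs_nonneg _) ⟨w, Finset.mem_univ _, by
    rw [abs_dualCoeff h hw]; norm_num⟩

/-! ## Incidence numbers -/

theorem incidence_eq_zero {r : ℕ} {s : M.Cell r} {t : M.Cell (r + 1)} (h : ¬ s.1 ⊆ t.1) :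
    incidence s t = 0 := by
  refine dif_neg fun ⟨y, hy, hs⟩ => h fun p hp => ?_
  rw [← Finset.mem_coe, ← hs.2] at hp
  obtain ⟨i, rfl⟩ := hp
  rw [← Finset.mem_coe, ← hy.2]
  exact ⟨_, rfl⟩

/-- The incidence number lists the vertex `s` last, the flag lists it first; this transposition is
the minus sign. -/
theorem incidence_zero_one {s : M.Cell 0} {t : M.Cell 1} {z : M.Flag 2} (hs : z.1 0 = s.1)
    (ht : z.1 1 = t.1) :
    incidence s t = -((z.eps 0 (by norm_num) * z.eps 1 (by norm_num) : ℤˣ) : ℤ) := by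
  have key : ∀ y : Fin 2 → Space3, y = (fun i : Fin 2 => z.vert (Fin.castLE
      (by norm_num : 1 + 1 ≤ 3) i)) ∘ Equiv.swap 0 1 ↔
      Enumerates y t.1 ∧ Enumerates (fun i : Fin 1 => y i.succ) s.1 := by
    intro y
    constructor
    · rintro rfl
      refine ⟨ht ▸ (z.enumerates_edge _).comp _, Function.injective_of_subsingleton _,
        Set.ext fun p => ?_⟩
      rw [← hs, Finset.mem_coe, z.lists_vert.mem_zero]
      simp [eq_comm (a := p)]
    · rintro ⟨h1, h2⟩
      have m1 : y 1 ∈ s.1 := by rw [← Finset.mem_coe, ← h2.2]; exact ⟨0, rfl⟩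
      have m0 : y 0 ∈ t.1 := by rw [← Finset.mem_coe, ← h1.2]; exact ⟨0, rfl⟩
      rw [← hs, z.lists_vert.mem_zero] at m1
      rw [← ht, z.lists_vert.mem_one] at m0
      have m2 := m0.resolve_left fun e => h1.1.ne (show (0 : Fin 2) ≠ 1 by decide) (e.trans m1.symm)
      funext i
      fin_cases i
      exacts [m2, m1]
  have hex : ∃ y : Fin (0 + 2) → Space3, Enumerates y t.1 ∧ Enumerates (fun i => y i.succ) s.1 :=
    ⟨_, (key _).1 rfl⟩
  rw [incidence, dif_pos hex]
  have hc := (key _).2 hex.choose_spec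
  have h1 : M.cellSign hex.choose = -z.eps 1 (by norm_num) := by
    rw [hc, M.cellSign_perm _ _ (z.2.1 1) (z.enumerates_edge _), Equiv.Perm.sign_swap (by decide),
      neg_one_mul]
    rfl
  have h0 : M.cellSign (fun i : Fin (0 + 1) => hex.choose i.succ) = z.eps 0 (by norm_num) := by
    rw [hc, Flag.eps]
    congr 1
    funext i
    fin_cases i
    rfl
  rw [h0, h1, neg_mul, mul_comm, Units.val_neg]

/-- The vertex opposite to `s` comes first in the incidence number and last in the flag; a cyclic
rotation of three vertices is even, so no sign appears. -/
theorem incidence_one_two {s : M.Cell 1} {t : M.Cell 2} {z : M.Flag 2} (hs : z.1 1 = s.1)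
    (ht : z.1 2 = t.1) :
    incidence s t = ((z.eps 1 (by norm_num) * z.eps 2 (by norm_num) : ℤˣ) : ℤ) := by
  have hex : ∃ y : Fin (1 + 2) → Space3, Enumerates y t.1 ∧ Enumerates (fun i => y i.succ) s.1 := by
    refine ⟨z.vert ∘ (finRotate 3).symm, ht ▸ z.lists_vert.enumerates.comp _, ?_⟩
    rw [← hs]
    convert z.enumerates_edge (by norm_num) using 1
    funext i
    fin_cases i <;> rfl
  rw [incidence, dif_pos hex]
  obtain ⟨h1, h2⟩ := hex.choose_spec
  -- The chosen list may order the vertices of `s` differently from `z`. Its rotation is a flag with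
  -- the same edge and triangle, so it is `z` or its flip, and the flip changes both signs.
  obtain ⟨z', hz2, hz'⟩ := exists_flag_lists t.2.1 (h1.comp (finRotate 3))
  have hv : z'.vert = hex.choose ∘ finRotate 3 := z'.lists_vert.eq hz'
  have hz1 : z'.1 1 = z.1 1 := by
    rw [hs]
    refine Finset.ext fun p => ?_
    rw [hz'.mem_one, ← Finset.mem_coe, ← h2.2, Set.mem_range, Fin.exists_fin_two]
    simp only [eq_comm (b := p)]
    rfl
  have e2 : z'.eps 2 (by norm_num) = M.cellSign hex.choose := by
    rw [Flag.eps_two, hv, M.cellSign_perm _ _ t.2.1 h1, sign_finRotate]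
    simp
  have e1 : z'.eps 1 (by norm_num) = M.cellSign (fun i : Fin (1 + 1) => hex.choose i.succ) := by
    rw [Flag.eps, hv]
    congr 1
    funext i
    fin_cases i <;> rfl
  rw [← e1, ← e2]
  by_cases hne : z' = z
  · rw [hne, mul_comm]
  · obtain ⟨-, a, b⟩ := neg_of_flip_zero hne hz1 (hz2.trans ht.symm)
    rw [a, b, neg_mul_neg, mul_comm]

/-! ## Flips -/

/-- The flag that differs from `z` in the edge. -/
def Flag.flipOne (z : M.Flag 2) : M.Flag 2 := z.exists_flip_one.choose

/-- The flag that differs from `z` in the triangle. -/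
def Flag.flipTwo (z : M.Flag 2) : M.Flag 2 := z.exists_flip_two.choose

theorem Flag.flipOne_ne (z : M.Flag 2) : z.flipOne ≠ z := z.exists_flip_one.choose_spec.1
theorem Flag.flipTwo_ne (z : M.Flag 2) : z.flipTwo ≠ z := z.exists_flip_two.choose_spec.1

theorem Flag.flipOne_spec (z z' : M.Flag 2) :
    (z'.1 0 = z.1 0 ∧ z'.1 2 = z.1 2) ↔ z' = z ∨ z' = z.flipOne :=
  z.exists_flip_one.choose_spec.2 z'

theorem Flag.flipTwo_spec (z z' : M.Flag 2) :
    (z'.1 0 = z.1 0 ∧ z'.1 1 = z.1 1) ↔ z' = z ∨ z' = z.flipTwo :=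
  z.exists_flip_two.choose_spec.2 z'

theorem Flag.flipOne_eq (z : M.Flag 2) : z.flipOne.1 0 = z.1 0 ∧ z.flipOne.1 2 = z.1 2 :=
  (z.flipOne_spec _).2 (Or.inr rfl)

theorem Flag.flipTwo_eq (z : M.Flag 2) : z.flipTwo.1 0 = z.1 0 ∧ z.flipTwo.1 1 = z.1 1 :=
  (z.flipTwo_spec _).2 (Or.inr rfl)

theorem Flag.flipOne_flipOne (z : M.Flag 2) : z.flipOne.flipOne = z :=
  ((z.flipOne_spec _).1 ⟨z.flipOne.flipOne_eq.1.trans z.flipOne_eq.1,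
    z.flipOne.flipOne_eq.2.trans z.flipOne_eq.2⟩).resolve_right z.flipOne.flipOne_ne

theorem Flag.flipTwo_flipTwo (z : M.Flag 2) : z.flipTwo.flipTwo = z :=
  ((z.flipTwo_spec _).1 ⟨z.flipTwo.flipTwo_eq.1.trans z.flipTwo_eq.1,
    z.flipTwo.flipTwo_eq.2.trans z.flipTwo_eq.2⟩).resolve_right z.flipTwo.flipTwo_ne

theorem Flag.orient_flipOne (z : M.Flag 2) : z.flipOne.orient = -z.orient :=
  (neg_of_flip_one z.flipOne_ne z.flipOne_eq.1 z.flipOne_eq.2).1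

theorem Flag.orient_flipTwo (z : M.Flag 2) : z.flipTwo.orient = -z.orient :=
  neg_of_flip_two z.flipTwo_ne z.flipTwo_eq.1 z.flipTwo_eq.2

/-! ## The coefficients of the dual cells -/

theorem dualCoeff_vertex {t : M.Cell 0} {z : M.Flag 2} (h : 0 + 2 = 2) (ht : z.1 0 = t.1) :
    dualCoeff h t z = ((z.orient * z.eps 0 (by norm_num) : ℤˣ) : ℤ) := by
  rw [dualCoeff_of_isTail (z := z) (fun j => by simp) ht]
  simp

theorem dualCoeff_edge {t : M.Cell 1} {z : M.Flag 2} (h : 1 + 1 = 2) (ht : z.1 1 = t.1) :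
    dualCoeff h t (z.facet 0) = -((z.orient * z.eps 1 (by norm_num) : ℤˣ) : ℤ) := by
  rw [dualCoeff_of_isTail (z := z) (fun j => by fin_cases j <;> rfl) ht]
  simp

theorem dualCoeff_tri {t : M.Cell 2} {z : M.Flag 2} {v : M.Flag 0} (h : 2 + 0 = 2)
    (ht : z.1 2 = t.1) (hv : v.1 0 = t.1) :
    dualCoeff h t v = ((z.orient * z.eps 2 (by norm_num) : ℤˣ) : ℤ) := by
  rw [dualCoeff_of_isTail (z := z) (fun j => by fin_cases j; exact hv.trans ht.symm) hv]
  simp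

/-- The sign of the edge occurs in both factors and squares to one. This is the boundary formula for
`⋆t` at a single outer small edge. -/
theorem dualCoeff_vertex_eq {t : M.Cell 0} {z : M.Flag 2} (h : 0 + 2 = 2) (h' : 1 + 1 = 2)
    (ht : z.1 0 = t.1) :
    dualCoeff h t z = incidence t z.edgeCell * dualCoeff h' z.edgeCell (z.facet 0) := by
  rw [dualCoeff_vertex h ht, incidence_zero_one ht rfl, dualCoeff_edge h' rfl, neg_mul_neg]
  rcases Int.units_eq_one_or (z.eps 1 (by norm_num)) with e | e <;> simp [e, mul_comm]

/-- Here the sign of the triangle squares to one; the result is the boundary formula for a dual edge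
at one end. -/
theorem dualCoeff_edge_eq {t : M.Cell 1} {z : M.Flag 2} {v : M.Flag 0} (h : 1 + 1 = 2)
    (h' : 2 + 0 = 2) (ht : z.1 1 = t.1) (hv : v.1 0 = z.1 2) :
    dualCoeff h t (z.facet 0) = -(incidence t z.triCell * dualCoeff h' z.triCell v) := by
  rw [dualCoeff_edge h ht, incidence_one_two ht rfl, dualCoeff_tri (z := z) h' rfl hv]
  rcases Int.units_eq_one_or (z.eps 2 (by norm_num)) with e | e <;> simp [e, mul_comm]

/-- Neighbours in the star of a vertex have opposite flag orders, so their common small edge cancels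
in the boundary of the dual face. -/
theorem dualCoeff_vertex_flipOne {t : M.Cell 0} (z : M.Flag 2) (h : 0 + 2 = 2) :
    dualCoeff h t z.flipOne = -dualCoeff h t z := by
  by_cases ht : z.1 0 = t.1
  · rw [dualCoeff_vertex h ht, dualCoeff_vertex h (z.flipOne_eq.1.trans ht), z.orient_flipOne,
      eps_zero_eq z.flipOne_eq.1, neg_mul, Units.val_neg]
  · rw [dualCoeff_eq_zero h ht, dualCoeff_eq_zero h (z.flipOne_eq.1 ▸ ht), neg_zero]

theorem dualCoeff_vertex_flipTwo {t : M.Cell 0} (z : M.Flag 2) (h : 0 + 2 = 2) :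
    dualCoeff h t z.flipTwo = -dualCoeff h t z := by
  by_cases ht : z.1 0 = t.1
  · rw [dualCoeff_vertex h ht, dualCoeff_vertex h (z.flipTwo_eq.1.trans ht), z.orient_flipTwo,
      eps_zero_eq z.flipTwo_eq.1, neg_mul, Units.val_neg]
  · rw [dualCoeff_eq_zero h ht, dualCoeff_eq_zero h (z.flipTwo_eq.1 ▸ ht), neg_zero]

theorem dualCoeff_edge_flipTwo {t : M.Cell 1} (z : M.Flag 2) (h : 1 + 1 = 2) (ht : z.1 1 = t.1) :
    dualCoeff h t (z.flipTwo.facet 0) = -dualCoeff h t (z.facet 0) := by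
  rw [dualCoeff_edge h ht, dualCoeff_edge h (z.flipTwo_eq.2.trans ht), z.orient_flipTwo,
    (eps_eq_of_edge_eq z.flipTwo_eq.1 z.flipTwo_eq.2).2, neg_mul, Units.val_neg]

/-- A small edge on a dual edge is the outer side of one small triangle for each endpoint of the
primal edge. -/
theorem Flag.exists_facet_zero_eq {w : M.Flag 1} {s : M.Cell 0} (hw : (w.1 0).card = 2)
    (hs : s.1 ⊆ w.1 0) : ∃ z : M.Flag 2, z.1 0 = s.1 ∧ z.facet 0 = w := by
  obtain ⟨z, h0, h1, h2⟩ := exists_flag_two s.2.1 (w.2.1 0) (w.2.1 1)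
    (ssubset_of_card hs (by rw [s.2.2, hw]; norm_num)) (w.2.2 (show (0 : Fin 2) < 1 by decide))
  exact ⟨z, h0, Flag.ext_one h1 h2⟩

theorem Cell.exists_vertex {r : ℕ} (t : M.Cell r) : ∃ s : M.Cell 0, s.1 ⊆ t.1 := by
  obtain ⟨p, hp⟩ := M.K.nonempty_of_mem_faces t.2.1
  exact ⟨⟨{p}, M.K.down_closed t.2.1 (Finset.singleton_subset_iff.2 hp)
    (Finset.singleton_nonempty p), Finset.card_singleton p⟩, Finset.singleton_subset_iff.2 hp⟩

theorem Flag.exists_facet_zero_eq_of_cell {w : M.Flag 1} {t : M.Cell 1} (hw : w.1 0 = t.1) :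
    ∃ z : M.Flag 2, z.1 1 = t.1 ∧ z.facet 0 = w := by
  obtain ⟨s, hs⟩ := t.exists_vertex
  obtain ⟨z, -, hz⟩ := Flag.exists_facet_zero_eq (w := w) (hw ▸ t.2.2) (hw ▸ hs)
  exact ⟨z, by rw [← hw, ← hz]; rfl, hz⟩

theorem Flag.edge_subset_of_facet {z z' : M.Flag 2} : z'.facet 0 = z.facet 0 ↔
    z'.1 1 = z.1 1 ∧ z'.1 2 = z.1 2 :=
  ⟨fun h => ⟨congrArg (fun w : M.Flag 1 => w.1 0) h, congrArg (fun w : M.Flag 1 => w.1 1) h⟩,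
    fun h => Flag.ext_one h.1 h.2⟩

/-- The dual cell of an edge consists of two cells. -/
theorem starEdge_iff (z : M.Flag 2) (w : M.Flag 1) :
    w.1 0 = z.1 1 ↔ w = z.facet 0 ∨ w = z.flipTwo.facet 0 := by
  constructor
  · intro h
    obtain ⟨z', h0, h1⟩ := Flag.exists_facet_zero_eq (w := w) (s := z.vertexCell)
      (h ▸ z.card_one) (h ▸ (z.2.2 (show (0 : Fin 3) < 1 by decide)).le)
    have h1' : z'.1 1 = z.1 1 := by rw [← h, ← h1]; rfl
    rcases (z.flipTwo_spec z').1 ⟨h0, h1'⟩ with rfl | rfl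
    exacts [Or.inl h1.symm, Or.inr h1.symm]
  · rintro (rfl | rfl)
    exacts [rfl, z.flipTwo_eq.2]

theorem Flag.facet_zero_flipTwo_ne (z : M.Flag 2) : z.flipTwo.facet 0 ≠ z.facet 0 := fun h =>
  z.flipTwo_ne (Flag.ext_two z.flipTwo_eq.1 z.flipTwo_eq.2 (Flag.edge_subset_of_facet.1 h).2)

theorem sum_starEdge {A : Type*} [AddCommMonoid A] (z : M.Flag 2) (f : M.Flag 1 → A)
    (hf : ∀ w, w.1 0 ≠ z.1 1 → f w = 0) : ∑ w, f w = f (z.facet 0) + f (z.flipTwo.facet 0) := by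
  classical
  rw [← Finset.sum_pair z.facet_zero_flipTwo_ne.symm]
  refine (Finset.sum_subset (Finset.subset_univ _) fun w _ hw => hf w fun h => hw ?_).symm
  simpa using (starEdge_iff z w).1 h

theorem dualCount_edge (h : 1 + 1 = 2) (t : M.Cell 1) : dualCount h t = 2 := by
  obtain ⟨w, hw⟩ := t.exists_flag h
  obtain ⟨z, hz, -⟩ := Flag.exists_facet_zero_eq_of_cell hw
  rw [dualCount, sum_starEdge z, abs_dualCoeff h hz, abs_dualCoeff h (z.flipTwo_eq.2.trans hz)]
  · norm_num
  · intro w hw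
    rw [dualCoeff_eq_zero h (hz ▸ hw), abs_zero]

theorem dualCount_tri (h : 2 + 0 = 2) (t : M.Cell 2) : dualCount h t = 1 := by
  obtain ⟨w, hw⟩ := t.exists_flag h
  rw [dualCount, Finset.sum_eq_single_of_mem w (Finset.mem_univ _), abs_dualCoeff h hw]
  intro w' _ hne
  rw [dualCoeff_eq_zero h fun e => hne (Flag.ext_zero (e.trans hw.symm)), abs_zero]

/-! ## The boundary of a dual cell -/

/-- The boundary of the dual face of a vertex, tested with a cochain. -/
theorem sum_dualCoeff_vertex (h : 0 + 2 = 2) (h' : 1 + 1 = 2) (s : M.Cell 0) (B : M.Flag 1 → ℝ) :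
    ∑ z : M.Flag 2, (dualCoeff h s z : ℝ) * ∑ i : Fin 3, (-1) ^ (i : ℕ) * B (z.facet i) =
      ∑ t : M.Cell 1, (incidence s t : ℝ) * ∑ w, (dualCoeff h' t w : ℝ) * B w := by
  classical
  -- Facets 1 and 2 contain the central vertex. They are interior to the dual face and cancel in
  -- pairs under the flips.
  have e1 : ∑ z : M.Flag 2, (dualCoeff h s z : ℝ) * B (z.facet 1) = 0 := by
    refine Finset.sum_involution (fun z _ => z.flipOne) (fun z _ => ?_)
      (fun z _ _ => z.flipOne_ne) (fun _ _ => Finset.mem_univ _) (fun z _ => z.flipOne_flipOne)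
    have : z.flipOne.facet 1 = z.facet 1 := Flag.ext_one z.flipOne_eq.1 z.flipOne_eq.2
    rw [this, dualCoeff_vertex_flipOne]
    push_cast
    ring
  have e2 : ∑ z : M.Flag 2, (dualCoeff h s z : ℝ) * B (z.facet 2) = 0 := by
    refine Finset.sum_involution (fun z _ => z.flipTwo) (fun z _ => ?_)
      (fun z _ _ => z.flipTwo_ne) (fun _ _ => Finset.mem_univ _) (fun z _ => z.flipTwo_flipTwo)
    have : z.flipTwo.facet 2 = z.facet 2 := Flag.ext_one z.flipTwo_eq.1 z.flipTwo_eq.2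
    rw [this, dualCoeff_vertex_flipTwo]
    push_cast
    ring
  -- Compare the coefficients of one outer small edge `w`. At most one triangle of `⋆s` and at most
  -- one primal edge contribute, and `dualCoeff_vertex_eq` matches them.
  have e3 : ∀ w : M.Flag 1, ∑ z : M.Flag 2 with z.facet 0 = w, (dualCoeff h s z : ℝ) =
      ∑ t : M.Cell 1, (incidence s t : ℝ) * dualCoeff h' t w := by
    intro w
    by_cases hw : ∃ z : M.Flag 2, z.1 0 = s.1 ∧ z.facet 0 = w
    · obtain ⟨z, hz, rfl⟩ := hw
      rw [Finset.sum_eq_single_of_mem z (by simp), Finset.sum_eq_single_of_mem z.edgeCell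
        (Finset.mem_univ _), dualCoeff_vertex_eq h h' hz]
      · push_cast; rfl
      · intro t _ hne
        rw [dualCoeff_eq_zero h' fun e => hne (Subtype.ext e.symm)]
        simp
      · intro z' hz' hne
        rw [dualCoeff_eq_zero h, Int.cast_zero]
        intro e
        obtain ⟨a, b⟩ := Flag.edge_subset_of_facet.1 (Finset.mem_filter.1 hz').2
        exact hne (Flag.ext_two (e.trans hz.symm) a b)
    · push Not at hw
      rw [Finset.sum_eq_zero, Finset.sum_eq_zero]
      · intro t _
        by_cases ht : w.1 0 = t.1
        · rw [incidence_eq_zero, Int.cast_zero, zero_mul]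
          intro hst
          obtain ⟨z, h0, h1⟩ := Flag.exists_facet_zero_eq (w := w) (s := s) (ht ▸ t.2.2) (ht ▸ hst)
          exact hw z h0 h1
        · rw [dualCoeff_eq_zero h' ht, Int.cast_zero, mul_zero]
      · intro z hz
        rw [dualCoeff_eq_zero h fun e => hw z e (Finset.mem_filter.1 hz).2, Int.cast_zero]
  have e0 : ∑ z : M.Flag 2, (dualCoeff h s z : ℝ) * B (z.facet 0) =
      ∑ t : M.Cell 1, (incidence s t : ℝ) * ∑ w, (dualCoeff h' t w : ℝ) * B w := by
    rw [← Finset.sum_fiberwise (s := Finset.univ) (g := fun z : M.Flag 2 => z.facet 0)]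
    simp only [Finset.mul_sum]
    rw [Finset.sum_comm]
    refine Finset.sum_congr rfl fun w _ => ?_
    simp only [← mul_assoc]
    rw [← Finset.sum_mul, ← e3, Finset.sum_mul]
    refine Finset.sum_congr rfl fun z hz => ?_
    rw [(Finset.mem_filter.1 hz).2]
  rw [← e0, ← add_zero (∑ z : M.Flag 2, (dualCoeff h s z : ℝ) * B (z.facet 0)), ← e2,
    ← sub_zero (∑ z : M.Flag 2, (dualCoeff h s z : ℝ) * B (z.facet 0)), ← e1,
    ← Finset.sum_sub_distrib, ← Finset.sum_add_distrib]
  refine Finset.sum_congr rfl fun z _ => ?_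
  rw [Fin.sum_univ_three]
  simp only [Fin.val_zero, Fin.val_one, Fin.val_two]
  ring

/-- The boundary of the dual edge of an edge, tested with a cochain. -/
theorem sum_dualCoeff_edge (h : 1 + 1 = 2) (h' : 2 + 0 = 2) (s : M.Cell 1) (B : M.Flag 0 → ℝ) :
    ∑ w : M.Flag 1, (dualCoeff h s w : ℝ) * ∑ i : Fin 2, (-1) ^ (i : ℕ) * B (w.facet i) =
      -∑ t : M.Cell 2, (incidence s t : ℝ) * ∑ v, (dualCoeff h' t v : ℝ) * B v := by
  classical
  -- The midpoint of the primal edge is the common end of the two halves of the dual edge and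
  -- cancels.
  have e1 : ∑ w : M.Flag 1, (dualCoeff h s w : ℝ) * B (w.facet 1) = 0 := by
    obtain ⟨w, hw⟩ := s.exists_flag h
    obtain ⟨z, hz, -⟩ := Flag.exists_facet_zero_eq_of_cell hw
    rw [sum_starEdge z, dualCoeff_edge_flipTwo z h hz]
    · have : (z.flipTwo.facet 0).facet 1 = (z.facet 0).facet 1 := Flag.ext_zero z.flipTwo_eq.2
      rw [this]
      push_cast
      ring
    · intro w hw
      rw [dualCoeff_eq_zero h (hz ▸ hw), Int.cast_zero, zero_mul]
  have e3 : ∀ v : M.Flag 0, ∑ w : M.Flag 1 with w.facet 0 = v, (dualCoeff h s w : ℝ) =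
      -∑ t : M.Cell 2, (incidence s t : ℝ) * dualCoeff h' t v := by
    intro v
    by_cases hw : ∃ w : M.Flag 1, w.1 0 = s.1 ∧ w.facet 0 = v
    · obtain ⟨w, hw, rfl⟩ := hw
      obtain ⟨z, hz, rfl⟩ := Flag.exists_facet_zero_eq_of_cell hw
      rw [Finset.sum_eq_single_of_mem (z.facet 0) (by simp),
        Finset.sum_eq_single_of_mem z.triCell (Finset.mem_univ _),
        dualCoeff_edge_eq (v := (z.facet 0).facet 0) h h' hz rfl]
      · push_cast; rfl
      · intro t _ hne
        rw [dualCoeff_eq_zero h' fun e => hne (Subtype.ext e.symm)]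
        simp
      · intro w' hw' hne
        rw [dualCoeff_eq_zero h, Int.cast_zero]
        intro e
        have := (Finset.mem_filter.1 hw').2
        exact hne (Flag.ext_one (e.trans hz.symm) (congrArg (fun v : M.Flag 0 => v.1 0) this))
    · push Not at hw
      rw [Finset.sum_eq_zero, Finset.sum_eq_zero, neg_zero]
      · intro t _
        by_cases ht : v.1 0 = t.1
        · rw [incidence_eq_zero, Int.cast_zero, zero_mul]
          intro hst
          have hlt : s.1 ⊂ t.1 := ssubset_of_card hst (by rw [s.2.2, t.2.2]; norm_num)
          refine hw ⟨![s.1, t.1], fun i => ?_, Fin.strictMono_iff_lt_succ.2 fun i => ?_⟩ rfl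
            (Flag.ext_zero ht.symm)
          · fin_cases i
            exacts [s.2.1, t.2.1]
          · fin_cases i
            exact hlt
        · rw [dualCoeff_eq_zero h' ht, Int.cast_zero, mul_zero]
      · intro w hw'
        rw [dualCoeff_eq_zero h fun e => hw w e (Finset.mem_filter.1 hw').2, Int.cast_zero]
  have e0 : ∑ w : M.Flag 1, (dualCoeff h s w : ℝ) * B (w.facet 0) =
      -∑ t : M.Cell 2, (incidence s t : ℝ) * ∑ v, (dualCoeff h' t v : ℝ) * B v := by
    rw [← Finset.sum_fiberwise (s := Finset.univ) (g := fun w : M.Flag 1 => w.facet 0)]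
    simp only [Finset.mul_sum]
    rw [Finset.sum_comm, ← Finset.sum_neg_distrib]
    refine Finset.sum_congr rfl fun v _ => ?_
    simp only [← mul_assoc]
    rw [← Finset.sum_mul, ← neg_mul, ← e3, Finset.sum_mul]
    refine Finset.sum_congr rfl fun z hz => ?_
    rw [(Finset.mem_filter.1 hz).2]
  rw [← e0, ← sub_zero (∑ w : M.Flag 1, (dualCoeff h s w : ℝ) * B (w.facet 0)), ← e1,
    ← Finset.sum_sub_distrib]
  refine Finset.sum_congr rfl fun z _ => ?_
  rw [Fin.sum_univ_two]
  simp only [Fin.val_zero, Fin.val_one]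
  ring

/-! ## Regions and stars -/

/-- The recursion over facets descends to the vertices of `t`, so the support is the union of the
dual faces of these vertices. -/
theorem mem_bcSupport : ∀ {r : ℕ} {t : M.Cell r} {z : M.Flag 2},
    z ∈ bcSupport r t ↔ z.1 0 ⊆ t.1
  | 0, t, z => ⟨fun h => (show z.1 0 = t.1 from h).le, fun h =>
      (Finset.eq_of_subset_of_card_le h (by rw [t.2.2, z.card_zero]) : z.1 0 = t.1)⟩
  | r + 1, t, z => by
    simp only [bcSupport, Set.mem_iUnion, Set.mem_ofPred_eq, mem_bcSupport, exists_prop]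
    refine ⟨fun ⟨s, hs, hz⟩ => hz.trans hs, fun h => ?_⟩
    obtain ⟨s, h1, h2, h3⟩ := Finset.exists_subsuperset_card_eq (n := r + 1) h
      (by rw [z.card_zero]; omega) (by rw [t.2.2]; omega)
    exact ⟨⟨s, M.K.down_closed t.2.1 h2 (Finset.card_pos.1 (by omega)), h3⟩, h2, h1⟩

/-- Purity provides the triangle. Only the middle edge is to be chosen: it must be `A` or `B` if one
of them is an edge, and if both are, they coincide. -/
theorem exists_flag_through {p : Space3} {A B : Finset Space3} (hA : A ∈ M.K.faces)
    (hB : B ∈ M.K.faces) (hp : p ∈ A) (hAB : A ⊆ B) :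
    ∃ z : M.Flag 2, z.1 0 = {p} ∧ A ∈ Set.range z.1 ∧ B ∈ Set.range z.1 := by
  obtain ⟨T, hT, hBT, hTc⟩ := M.pure _ hB
  have hpA : {p} ⊆ A := Finset.singleton_subset_iff.2 hp
  have key : ∃ e : Finset Space3, e.card = 2 ∧ {p} ⊆ e ∧ e ⊆ T ∧ (A.card = 2 → A = e) ∧
      (B.card = 2 → B = e) := by
    by_cases hA2 : A.card = 2
    · exact ⟨A, hA2, hpA, hAB.trans hBT, fun _ => rfl, fun h =>
        (Finset.eq_of_subset_of_card_le hAB (by rw [h, hA2])).symm⟩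
    · by_cases hB2 : B.card = 2
      · exact ⟨B, hB2, hpA.trans hAB, hBT, fun h => absurd h hA2, fun _ => rfl⟩
      · obtain ⟨e, h1, h2, h3⟩ := Finset.exists_subsuperset_card_eq (n := 2)
          (hpA.trans (hAB.trans hBT)) (by rw [Finset.card_singleton]; norm_num) (by omega)
        exact ⟨e, h3, h1, h2, fun h => absurd h hA2, fun h => absurd h hB2⟩
  obtain ⟨e, he, hpe, heT, hAe, hBe⟩ := key
  obtain ⟨z, h0, h1, h2⟩ := exists_flag_two (M.K.down_closed hA hpA (Finset.singleton_nonempty p))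
    (M.K.down_closed hT heT (Finset.card_pos.1 (by omega))) hT
    (ssubset_of_card hpe (by rw [Finset.card_singleton]; omega)) (ssubset_of_card heT (by omega))
  have key : ∀ C : Finset Space3, C ∈ M.K.faces → p ∈ C → C ⊆ T → (C.card = 2 → C = e) →
      C ∈ Set.range z.1 := by
    intro C hC hpC hCT hCe
    have c1 := M.card_le _ hC
    have c2 := Finset.card_pos.2 ⟨p, hpC⟩
    obtain h | h | h : C.card = 1 ∨ C.card = 2 ∨ C.card = 3 := by omega
    · refine ⟨0, h0.trans (Finset.eq_of_subset_of_card_le (Finset.singleton_subset_iff.2 hpC) ?_)⟩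
      rw [h, Finset.card_singleton]
    · exact ⟨1, h1.trans (hCe h).symm⟩
    · exact ⟨2, h2.trans (Finset.eq_of_subset_of_card_le hCT (by rw [h, hTc])).symm⟩
  exact ⟨z, h0, key A hA hp (hAB.trans hBT) hAe, key B hB (hAB hp) hBT hBe⟩

theorem Flag.exists_isFace {q : ℕ} (hq : q ≤ 2) (w : M.Flag q) {p : Space3} (hp : p ∈ w.1 0) :
    ∃ z : M.Flag 2, w.IsFace z ∧ z.1 0 = {p} := by
  obtain rfl | rfl | rfl : q = 0 ∨ q = 1 ∨ q = 2 := by omega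
  · obtain ⟨z, h0, hA, -⟩ := exists_flag_through (w.2.1 0) (w.2.1 0) hp subset_rfl
    refine ⟨z, ?_, h0⟩
    rintro _ ⟨i, rfl⟩
    fin_cases i
    exact hA
  · obtain ⟨z, h0, hA, hB⟩ := exists_flag_through (w.2.1 0) (w.2.1 1) hp
      (w.2.2 (show (0 : Fin 2) < 1 by decide)).le
    refine ⟨z, ?_, h0⟩
    rintro _ ⟨i, rfl⟩
    fin_cases i
    exacts [hA, hB]
  · exact ⟨w, subset_rfl, (Finset.eq_of_subset_of_card_le (Finset.singleton_subset_iff.2 hp)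
      (by rw [w.card_zero, Finset.card_singleton])).symm⟩

theorem Flag.IsFace.zero_subset {q : ℕ} {w : M.Flag q} {z : M.Flag 2} (h : w.IsFace z) :
    z.1 0 ⊆ w.1 0 := by
  obtain ⟨j, hj⟩ := h ⟨0, rfl⟩
  rw [← hj]
  exact z.2.2.monotone (Fin.zero_le j)

/-- The small triangles containing `w` have their primal vertex in `w₀`, and every vertex of `w₀`
occurs. So `w` meets the complement of the support exactly when some vertex of `w₀` is not in `t`.
-/
theorem Flag.inRegion_compl_iff {r q : ℕ} (h : r + q = 2) {t : M.Cell r} {w : M.Flag q} :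
    w.InRegion (bcSupport r t)ᶜ ↔ ¬ w.1 0 ⊆ t.1 := by
  constructor
  · rintro ⟨z, hz, hw⟩ hs
    exact hz (mem_bcSupport.2 (hw.zero_subset.trans hs))
  · intro hs
    obtain ⟨p, hp, hpt⟩ := Finset.not_subset.1 hs
    obtain ⟨z, hz, h0⟩ := w.exists_isFace (by omega) hp
    refine ⟨z, fun hc => hpt ?_, hz⟩
    rw [mem_bcSupport, h0, Finset.singleton_subset_iff] at hc
    exact hc

theorem Flag.not_subset_of_not_inRegion {r q : ℕ} (h : r + q = 2) {t : M.Cell r} {w : M.Flag q}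
    (hw : ¬ w.InRegion (bcSupport r t)) : ¬ w.1 0 ⊆ t.1 := by
  obtain ⟨p, hp⟩ := M.K.nonempty_of_mem_faces (w.2.1 0)
  obtain ⟨z, hz, h0⟩ := w.exists_isFace (by omega) hp
  refine (Flag.inRegion_compl_iff h).1 ⟨z, fun hc => hw ⟨z, hc, hz⟩, hz⟩

/-- A function of the small triangles at a vertex is constant if it does not change across the
small edges at the vertex. -/
theorem eq_of_star {α : Type*} {F : M.Flag 2 → α} {A : Finset Space3}
    (h1 : ∀ z z' : M.Flag 2, z.1 0 = A → z'.1 0 = A → z.1 1 = z'.1 1 → F z = F z')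
    (h2 : ∀ z z' : M.Flag 2, z.1 0 = A → z'.1 0 = A → z.1 2 = z'.1 2 → F z = F z')
    {z z' : M.Flag 2} (hz : z.1 0 = A) (hz' : z'.1 0 = A) : F z = F z' := by
  obtain ⟨p, hp⟩ := Finset.card_eq_one.1 (hz ▸ z.card_zero)
  have hA : A ∈ M.K.faces := hz ▸ z.2.1 0
  have hmem : ∀ z : M.Flag 2, z.1 0 = A → p ∈ z.1 2 := fun z hz =>
    z.2.2.monotone (show (0 : Fin 3) ≤ 2 by decide) (by rw [hz, hp]; exact Finset.mem_singleton_self p)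
  have hc := M.star_connected p (z.1 2) (z'.1 2) (z.2.1 2) z.card_two (hmem z hz) (z'.2.1 2)
    z'.card_two (hmem z' hz')
  -- Induction along the chain of triangles at `p`: `h1` crosses the shared edge and `h2` moves
  -- between the two flags at `p` in one triangle.
  have key : ∀ u, Relation.ReflTransGen (fun u u' : Finset Space3 => u' ∈ M.K.faces ∧ u'.card = 3 ∧
      ∃ e ∈ M.K.faces, e.card = 2 ∧ p ∈ e ∧ e ⊆ u ∧ e ⊆ u') (z.1 2) u →
      u ∈ M.K.faces ∧ u.card = 3 ∧ ∀ z' : M.Flag 2, z'.1 0 = A → z'.1 2 = u → F z = F z' := by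
    intro u hu
    induction hu with
    | refl => exact ⟨z.2.1 2, z.card_two, fun z' h0 h2' => h2 _ _ hz h0 h2'.symm⟩
    | tail _ hstep ih =>
      obtain ⟨hb, hbc, ih⟩ := ih
      obtain ⟨hc, hcc, e, he, hec, hpe, heb, hecc⟩ := hstep
      refine ⟨hc, hcc, fun z' h0 hz' => ?_⟩
      have hAe : A ⊂ e := ssubset_of_card (by rw [hp]; exact Finset.singleton_subset_iff.2 hpe)
        (by rw [hp, Finset.card_singleton, hec]; norm_num)
      obtain ⟨x, x0, x1, x2⟩ := exists_flag_two hA he hb hAe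
        (ssubset_of_card heb (by rw [hec, hbc]; norm_num))
      obtain ⟨x', x0', x1', x2'⟩ := exists_flag_two hA he hc hAe
        (ssubset_of_card hecc (by rw [hec, hcc]; norm_num))
      exact ((ih x x0 x2).trans (h1 x x' x0 x0' (x1.trans x1'.symm))).trans
        (h2 x' z' x0' h0 (x2'.trans hz'.symm))
  exact (key _ hc).2.2 z' hz' rfl

/-! ## The Buffa-Christiansen coefficients as cochains -/

theorem subset_iff_eq_of_card {A B : Finset Space3} (h : A.card = B.card) : A ⊆ B ↔ A = B :=
  ⟨fun hs => Finset.eq_of_subset_of_card_le hs h.ge, fun e => e.le⟩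

theorem exists_flag_vertex_edge {A : Finset Space3} {t : M.Cell 1} (hA : A ∈ M.K.faces)
    (hAc : A.card = 1) (hAt : A ⊆ t.1) : ∃ z : M.Flag 2, z.1 0 = A ∧ z.1 1 = t.1 := by
  obtain ⟨w, hw⟩ := t.exists_flag (q := 1) rfl
  obtain ⟨z, h0, h1⟩ := Flag.exists_facet_zero_eq (w := w) (s := ⟨A, hA, hAc⟩) (hw ▸ t.2.2)
    (hw ▸ hAt)
  exact ⟨z, h0, by rw [← hw, ← h1]; rfl⟩

theorem exists_flag_vertex_tri {A T : Finset Space3} (hA : A ∈ M.K.faces) (hT : T ∈ M.K.faces)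
    (hAc : A.card = 1) (hTc : T.card = 3) (hAt : A ⊆ T) :
    ∃ z : M.Flag 2, z.1 0 = A ∧ z.1 2 = T := by
  obtain ⟨e, h1, h2, h3⟩ := Finset.exists_subsuperset_card_eq (n := 2) hAt (by omega) (by omega)
  obtain ⟨z, h0, -, h2⟩ := exists_flag_two hA
    (M.K.down_closed hT h2 (Finset.card_pos.1 (by omega))) hT (ssubset_of_card h1 (by omega))
    (ssubset_of_card h2 (by omega))
  exact ⟨z, h0, h2⟩

/-- A small edge at a vertex is a facet of a small triangle. -/
theorem Flag.exists_facet_eq_of_card_one {w : M.Flag 1} (hw : (w.1 0).card = 1) :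
    ∃ z : M.Flag 2, z.1 0 = w.1 0 ∧ (z.facet 1 = w ∨ z.facet 2 = w) := by
  have hlt := w.2.2 (show (0 : Fin 2) < 1 by decide)
  have c1 := Finset.card_lt_card hlt
  have c2 := M.card_le _ (w.2.1 1)
  obtain h | h : (w.1 1).card = 2 ∨ (w.1 1).card = 3 := by omega
  · obtain ⟨z, h0, h1⟩ := exists_flag_vertex_edge (t := ⟨w.1 1, w.2.1 1, h⟩) (w.2.1 0) hw hlt.le
    exact ⟨z, h0, Or.inr (Flag.ext_one h0 h1)⟩
  · obtain ⟨z, h0, h1⟩ := exists_flag_vertex_tri (w.2.1 0) (w.2.1 1) hw h hlt.le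
    exact ⟨z, h0, Or.inl (Flag.ext_one h0 h1)⟩

/-- The coboundary of the coboundary vanishes. -/
theorem sum_incidence_mul_incidence (a : M.Cell 0) (t : M.Cell 2) :
    ∑ s : M.Cell 1, incidence a s * incidence s t = 0 := by
  classical
  by_cases hat : a.1 ⊆ t.1
  · obtain ⟨z, h0, h2⟩ := exists_flag_vertex_tri a.2.1 t.2.1 a.2.2 t.2.2 hat
    have h0' := z.flipOne_eq.1.trans h0
    have h2' := z.flipOne_eq.2.trans h2
    -- Exactly two edges lie between `a` and `t`. In each term the sign of the edge squares away,
    -- and the sign of `t` differs between the two flags, so the terms cancel.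
    have hne : z.edgeCell ≠ z.flipOne.edgeCell := fun e => z.flipOne_ne
      (Flag.ext_two z.flipOne_eq.1 (congrArg Subtype.val e.symm) z.flipOne_eq.2)
    rw [← Finset.sum_subset (Finset.subset_univ {z.edgeCell, z.flipOne.edgeCell}),
      Finset.sum_pair hne, incidence_zero_one h0 rfl, incidence_one_two rfl h2,
      incidence_zero_one h0' rfl, incidence_one_two rfl h2']
    · obtain ⟨-, e0, e2⟩ := neg_of_flip_one z.flipOne_ne z.flipOne_eq.1 z.flipOne_eq.2
      rw [e0, e2]
      rcases Int.units_eq_one_or (z.eps 1 (by norm_num)) with e | e <;>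
      rcases Int.units_eq_one_or (z.flipOne.eps 1 (by norm_num)) with e' | e' <;> simp [e, e']
    · intro s _ hs
      by_cases has : a.1 ⊆ s.1
      · by_cases hst : s.1 ⊆ t.1
        · exfalso
          obtain ⟨z', h0'', h1'', h2''⟩ := exists_flag_two a.2.1 s.2.1 t.2.1
            (ssubset_of_card has (by rw [a.2.2, s.2.2]; norm_num))
            (ssubset_of_card hst (by rw [s.2.2, t.2.2]; norm_num))
          apply hs
          have e : s = z'.edgeCell := Subtype.ext h1''.symm
          rcases (z.flipOne_spec z').1 ⟨h0''.trans h0.symm, h2''.trans h2.symm⟩ with e' | e'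
          · rw [e, e']; simp
          · rw [e, e']; simp
        · rw [incidence_eq_zero hst, mul_zero]
      · rw [incidence_eq_zero has, zero_mul]
  · refine Finset.sum_eq_zero fun s _ => ?_
    by_cases has : a.1 ⊆ s.1
    · rw [incidence_eq_zero fun hst => hat (has.trans hst), mul_zero]
    · rw [incidence_eq_zero has, zero_mul]

/-- If the coboundary of each `ρ s` is given by the `ω a`, then `∑ D_{st} ρ s` is closed. -/
theorem coboundary_sum_incidence {ρ : M.Cell 1 → M.Flag 1 → ℝ} {ω : M.Cell 0 → M.Flag 2 → ℝ}
    {z : M.Flag 2} (h : ∀ s, ∑ i : Fin 3, (-1) ^ (i : ℕ) * ρ s (z.facet i) =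
      ∑ a : M.Cell 0, incidence a s * ω a z) (t : M.Cell 2) :
    ∑ i : Fin 3, (-1) ^ (i : ℕ) * ∑ s : M.Cell 1, (incidence s t : ℝ) * ρ s (z.facet i) = 0 := by
  have e : ∑ i : Fin 3, (-1) ^ (i : ℕ) * ∑ s : M.Cell 1, (incidence s t : ℝ) * ρ s (z.facet i) =
      ∑ s : M.Cell 1, (incidence s t : ℝ) * ∑ i : Fin 3, (-1) ^ (i : ℕ) * ρ s (z.facet i) := by
    simp only [Finset.mul_sum]
    rw [Finset.sum_comm]
    exact Finset.sum_congr rfl fun _ _ => Finset.sum_congr rfl fun _ _ => by ring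
  rw [e]
  simp only [h, Finset.mul_sum]
  rw [Finset.sum_comm]
  refine Finset.sum_eq_zero fun a _ => ?_
  have := sum_incidence_mul_incidence a t
  have h' : ∑ s : M.Cell 1, (incidence a s : ℝ) * incidence s t = 0 := by exact_mod_cast this
  rw [← zero_mul (ω a z), ← h', Finset.sum_mul]
  exact Finset.sum_congr rfl fun _ _ => by ring

namespace IsBuffaChristiansen

variable {R : M.BCCoeff}

/-- This is all that is used of `support` and `trace`: a cell with `w₀` not in `t` is either outside
the support or on its boundary. -/
theorem eq_zero (hR : IsBuffaChristiansen R) {r q : ℕ} (h : r + q = 2) {t : M.Cell r}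
    {w : M.Flag q} (hw : ¬ w.1 0 ⊆ t.1) : R r q h t w = 0 := by
  by_cases hU : w.InRegion (bcSupport r t)
  · exact hR.trace r q h t w ⟨hU, (Flag.inRegion_compl_iff h).2 hw⟩
  · exact hR.support r q h t w hU

theorem of_star (hR : IsBuffaChristiansen R) {r q : ℕ} (h : r + q = 2) {t : M.Cell r}
    {w : M.Flag q} (hw : w.1 0 = t.1) : R r q h t w = dualCoeff h t w / dualCount h t :=
  hR.weight r q h t w ((dualCoeff_ne_zero h).2 hw)

theorem of_card_eq (hR : IsBuffaChristiansen R) {r q : ℕ} (h : r + q = 2) {t : M.Cell r}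
    {w : M.Flag q} (hw : (w.1 0).card = r + 1) :
    R r q h t w = dualCoeff h t w / dualCount h t := by
  by_cases ht : w.1 0 = t.1
  · exact hR.of_star h ht
  · rw [hR.eq_zero h fun hs => ht ((subset_iff_eq_of_card (hw.trans t.2.2.symm)).1 hs),
      dualCoeff_eq_zero h ht, Int.cast_zero, zero_div]

/-- The coboundary of the `1`-cochains, on the whole surface. -/
theorem coboundary_one (hR : IsBuffaChristiansen R) (t : M.Cell 1) (z : M.Flag 2) :
    ∑ i : Fin 3, (-1) ^ (i : ℕ) * R 1 1 rfl t (z.facet i) =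
      ∑ s : M.Cell 0, incidence s t * R 0 2 rfl s z := by
  by_cases hz : z ∈ bcSupport 1 t
  · exact hR.oneForms t z hz
  rw [mem_bcSupport] at hz
  have hz1 : ¬ z.1 1 ⊆ t.1 := fun h => hz ((z.2.2 (show (0 : Fin 3) < 1 by decide)).le.trans h)
  rw [Finset.sum_eq_zero, Finset.sum_eq_zero]
  · intro s _
    by_cases hs : z.1 0 ⊆ s.1
    · rw [incidence_eq_zero fun h => hz (hs.trans h), Int.cast_zero, zero_mul]
    · rw [hR.eq_zero _ hs, mul_zero]
  · intro i _
    rw [hR.eq_zero, mul_zero]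
    fin_cases i
    exacts [hz1, hz, hz]

/-- If `w₀` is the edge `s`, every other edge gives zero by `eq_zero`, and the dual edge of `s` has
two halves. -/
theorem sum_incidence_edge (hR : IsBuffaChristiansen R) (t : M.Cell 2) {w : M.Flag 1}
    (s : M.Cell 1) (hw : w.1 0 = s.1) :
    ∑ s : M.Cell 1, (incidence s t : ℝ) * R 1 1 rfl s w =
      incidence s t * (dualCoeff (q := 1) rfl s w / 2) := by
  rw [Finset.sum_eq_single_of_mem s (Finset.mem_univ _), hR.of_star _ hw, dualCount_edge]
  · norm_num
  · intro s' _ hne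
    rw [hR.eq_zero, mul_zero]
    rw [hw, subset_iff_eq_of_card (s.2.2.trans s'.2.2.symm)]
    exact fun e => hne (Subtype.ext e.symm)

/-- The coboundary of the `0`-cochains at a small edge in a dual edge. -/
theorem coboundary_zero_edge (hR : IsBuffaChristiansen R) (t : M.Cell 2) {w : M.Flag 1}
    (hw : (w.1 0).card = 2) (hwt : w.1 0 ⊆ t.1) :
    ∑ i : Fin 2, (-1) ^ (i : ℕ) * R 2 0 rfl t (w.facet i) =
      -∑ s : M.Cell 1, incidence s t * R 1 1 rfl s w := by
  by_cases hin : w.InCell t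
  · exact hR.zeroForms t w hin
  let s : M.Cell 1 := ⟨w.1 0, w.2.1 0, hw⟩
  obtain ⟨a, ha⟩ := s.exists_vertex
  obtain ⟨z, h0, h1, h2⟩ := exists_flag_two a.2.1 s.2.1 t.2.1
    (ssubset_of_card ha (by rw [a.2.2, s.2.2]; norm_num))
    (ssubset_of_card hwt (by rw [hw, t.2.2]; norm_num))
  -- `w` is the half of the dual edge outside `t`; the condition is available on the half inside.
  have hwz : w = z.flipTwo.facet 0 := by
    refine ((starEdge_iff z w).1 h1.symm).resolve_left fun e => hin ?_
    rw [e]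
    exact h2.le
  have e1 := hR.zeroForms t (z.facet 0) h2.le
  rw [hR.sum_incidence_edge t s h1, Fin.sum_univ_two, hR.of_star (w := (z.facet 0).facet 0) _ h2,
    dualCount_tri] at e1
  have e2 := dualCoeff_edge_eq (t := s) (v := (z.facet 0).facet 0) rfl rfl h1 rfl
  have e3 : z.triCell = t := Subtype.ext h2
  have e4 : (incidence s t : ℝ) * incidence s t = 1 := by
    rw [incidence_one_two h1 h2]
    rcases Int.units_eq_one_or (z.eps 1 (by norm_num)) with e | e <;>
    rcases Int.units_eq_one_or (z.eps 2 (by norm_num)) with e' | e' <;> simp [e, e']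
  rw [e3] at e2
  have e5 : w.facet 1 = (z.facet 0).facet 1 := Flag.ext_zero h1.symm
  rw [hR.sum_incidence_edge t s rfl, Fin.sum_univ_two, hR.eq_zero (w := w.facet 0) _ hin, e5, hwz,
    dualCoeff_edge_flipTwo z rfl h1]
  have e6 := congrArg (Int.cast : ℤ → ℝ) e2
  push_cast at e1 e6 ⊢
  simp only [Fin.val_zero, Fin.val_one, pow_zero, pow_one, one_mul, mul_zero, zero_add] at e1 ⊢
  -- The inner half forces the midpoint to carry half of the value at the center. The outer half,
  -- with zero at its far end, then takes the other half.
  linear_combination e1 - (incidence s t : ℝ) * e6 + e4 * (dualCoeff rfl t ((z.facet 0).facet 0) : ℝ)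

/-- The coboundary of the `0`-cochains, on the whole surface. -/
theorem coboundary_zero (hR : IsBuffaChristiansen R) (t : M.Cell 2) (w : M.Flag 1) :
    ∑ i : Fin 2, (-1) ^ (i : ℕ) * R 2 0 rfl t (w.facet i) =
      -∑ s : M.Cell 1, incidence s t * R 1 1 rfl s w := by
  have hlt := w.2.2 (show (0 : Fin 2) < 1 by decide)
  by_cases hwt : w.1 0 ⊆ t.1
  swap
  · have hwt' : ¬ w.1 1 ⊆ t.1 := fun h => hwt (hlt.le.trans h)
    rw [Fin.sum_univ_two, hR.eq_zero (w := w.facet 0) _ hwt',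
      hR.eq_zero (w := w.facet 1) _ hwt, mul_zero, mul_zero, add_zero, Finset.sum_eq_zero, neg_zero]
    intro s _
    by_cases hs : w.1 0 ⊆ s.1
    · rw [incidence_eq_zero fun h => hwt (hs.trans h), Int.cast_zero, zero_mul]
    · rw [hR.eq_zero _ hs, mul_zero]
  have c0 := w.card_apply_pos 0
  have c1 := Finset.card_lt_card hlt
  have c2 := M.card_le _ (w.2.1 1)
  obtain hw | hw : (w.1 0).card = 2 ∨ (w.1 0).card = 1 := by omega
  · exact hR.coboundary_zero_edge t hw hwt
  -- `δ` is the defect of the claimed identity. It has zero coboundary on small triangles and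
  -- vanishes on small edges in dual edges, so it takes equal values on the two sides of each small
  -- triangle at the vertex.
  let δ : M.Flag 1 → ℝ := fun w => R 2 0 rfl t (w.facet 0) - R 2 0 rfl t (w.facet 1) +
    ∑ s : M.Cell 1, incidence s t * R 1 1 rfl s w
  have hδ : ∀ w, ∑ i : Fin 2, (-1) ^ (i : ℕ) * R 2 0 rfl t (w.facet i) =
      -(∑ s : M.Cell 1, incidence s t * R 1 1 rfl s w) + δ w := fun w => by
    rw [Fin.sum_univ_two]
    simp only [Fin.val_zero, Fin.val_one, pow_zero, pow_one, one_mul, δ]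
    ring
  have hz : ∀ z : M.Flag 2, z.1 0 = w.1 0 → δ (z.facet 1) = δ (z.facet 2) := by
    intro z hz
    have f0 : δ (z.facet 0) = 0 := by
      by_cases hzt : z.1 1 ⊆ t.1
      · have := hR.coboundary_zero_edge t (w := z.facet 0) z.card_one hzt
        rw [hδ] at this
        linarith
      · have hzt' : ¬ z.1 2 ⊆ t.1 :=
          fun h => hzt ((z.2.2 (show (1 : Fin 3) < 2 by decide)).le.trans h)
        simp only [δ]
        rw [hR.eq_zero (w := (z.facet 0).facet 0) _ hzt',
          hR.eq_zero (w := (z.facet 0).facet 1) _ hzt, Finset.sum_eq_zero, sub_zero, add_zero]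
        intro s _
        by_cases hs : z.1 1 ⊆ s.1
        · rw [incidence_eq_zero fun h => hzt (hs.trans h), Int.cast_zero, zero_mul]
        · rw [hR.eq_zero (w := z.facet 0) _ hs, mul_zero]
    have e := coboundary_sum_incidence (ρ := R 1 1 rfl) (ω := R 0 2 rfl) (z := z)
      (fun s => hR.coboundary_one s z) t
    rw [Fin.sum_univ_three] at e
    have a1 : (z.facet 1).facet 0 = (z.facet 0).facet 0 := Flag.ext_zero rfl
    have a2 : (z.facet 2).facet 0 = (z.facet 0).facet 1 := Flag.ext_zero rfl
    have a3 : (z.facet 2).facet 1 = (z.facet 1).facet 1 := Flag.ext_zero rfl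
    simp only [δ, a1, a2, a3, Fin.val_zero, Fin.val_one, Fin.val_two, pow_zero, pow_one, one_mul]
      at f0 e ⊢
    linarith
  obtain ⟨z, hz0, hzw⟩ := Flag.exists_facet_eq_of_card_one hw
  -- The small edge from this vertex to the center of `t` lies in `t`, where `zeroForms` makes the
  -- constant defect zero.
  obtain ⟨z', hz0', hz2'⟩ := exists_flag_vertex_tri (w.2.1 0) t.2.1 hw t.2.2 hwt
  have hc : δ (z.facet 1) = δ (z'.facet 1) := by
    refine eq_of_star (F := fun z : M.Flag 2 => δ (z.facet 1)) (A := w.1 0) ?_ ?_ hz0 hz0'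
    · intro z z' h h' e
      rw [hz z h, hz z' h']
      exact congrArg δ (Flag.ext_one (h.trans h'.symm) e)
    · intro z z' h h' e
      exact congrArg δ (Flag.ext_one (h.trans h'.symm) e)
  have h0 : δ (z'.facet 1) = 0 := by
    have := hR.zeroForms t (z'.facet 1) hz2'.le
    rw [hδ] at this
    linarith
  rw [hδ]
  have : δ w = 0 := by
    rcases hzw with e | e
    · rw [← e, hc, h0]
    · rw [← e, ← hz z hz0, hc, h0]
  rw [this, add_zero]

/-! ## Uniqueness -/

/-- The `2`-cochains are fixed by weights and support. The difference of two `1`-cochains is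
constant around each vertex of `t` and zero on `t` itself. The `0`-cochains are found from the
center of `t` along the small edges ending there. -/
theorem unique {R' : M.BCCoeff} (hR : IsBuffaChristiansen R) (hR' : IsBuffaChristiansen R') :
    R = R' := by
  have h02 : ∀ h, R 0 2 h = R' 0 2 h := fun h => by
    funext t z
    rw [hR.of_card_eq h z.card_zero, hR'.of_card_eq h z.card_zero]
  have h11 : ∀ t w, R 1 1 rfl t w = R' 1 1 rfl t w := fun t w => by
    have h2 : ∀ w : M.Flag 1, (w.1 0).card = 2 → R 1 1 rfl t w = R' 1 1 rfl t w := fun w hw => by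
      rw [hR.of_card_eq rfl hw, hR'.of_card_eq rfl hw]
    by_cases hwt : w.1 0 ⊆ t.1
    swap
    · rw [hR.eq_zero _ hwt, hR'.eq_zero _ hwt]
    have c0 := w.card_apply_pos 0
    have c1 := Finset.card_lt_card (w.2.2 (show (0 : Fin 2) < 1 by decide))
    have c2 := M.card_le _ (w.2.1 1)
    obtain hw | hw : (w.1 0).card = 2 ∨ (w.1 0).card = 1 := by omega
    · exact h2 w hw
    let δ : M.Flag 1 → ℝ := fun w => R 1 1 rfl t w - R' 1 1 rfl t w
    have hz : ∀ z : M.Flag 2, δ (z.facet 1) = δ (z.facet 2) := by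
      intro z
      have e := hR.coboundary_one t z
      rw [h02, ← hR'.coboundary_one t z, Fin.sum_univ_three, Fin.sum_univ_three,
        h2 (z.facet 0) z.card_one] at e
      simp only [δ, Fin.val_zero, Fin.val_one, Fin.val_two, pow_zero, pow_one, one_mul] at e ⊢
      linarith
    obtain ⟨z, hz0, hzw⟩ := Flag.exists_facet_eq_of_card_one hw
    obtain ⟨z', hz0', hz1'⟩ := exists_flag_vertex_edge (w.2.1 0) hw hwt
    have hc : δ (z.facet 1) = δ (z'.facet 1) := by
      refine eq_of_star (F := fun z : M.Flag 2 => δ (z.facet 1)) (A := w.1 0) ?_ ?_ hz0 hz0'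
      · intro z z' h h' e
        rw [hz z, hz z']
        exact congrArg δ (Flag.ext_one (h.trans h'.symm) e)
      · intro z z' h h' e
        exact congrArg δ (Flag.ext_one (h.trans h'.symm) e)
    -- The small edge `z'.facet 2` lies in the primal edge `t`, so `stability` fixes the constant.
    have h0 : δ (z'.facet 1) = 0 := by
      rw [hz]
      simp only [δ]
      rw [hR.stability t (z'.facet 2) hz1'.le, hR'.stability t (z'.facet 2) hz1'.le, sub_zero]
    have : δ w = 0 := by
      rcases hzw with e | e
      · rw [← e, hc, h0]
      · rw [← e, ← hz z, hc, h0]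
    exact sub_eq_zero.1 this
  funext r q h t w
  obtain ⟨rfl, rfl⟩ | ⟨rfl, rfl⟩ | ⟨rfl, rfl⟩ : (r = 0 ∧ q = 2) ∨ (r = 1 ∧ q = 1) ∨
      (r = 2 ∧ q = 0) := by omega
  · rw [h02]
  · exact h11 t w
  · by_cases hwt : w.1 0 ⊆ t.1
    swap
    · rw [hR.eq_zero _ hwt, hR'.eq_zero _ hwt]
    by_cases hw : w.1 0 = t.1
    · rw [hR.of_star h hw, hR'.of_star h hw]
    have hlt : w.1 0 ⊂ t.1 := Finset.ssubset_iff_subset_ne.2 ⟨hwt, hw⟩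
    obtain ⟨x, hx0, hx1⟩ : ∃ x : M.Flag 1, x.1 0 = w.1 0 ∧ x.1 1 = t.1 := by
      refine ⟨⟨![w.1 0, t.1], fun i => ?_, Fin.strictMono_iff_lt_succ.2 fun i => ?_⟩, rfl, rfl⟩
      · fin_cases i
        exacts [w.2.1 0, t.2.1]
      · fin_cases i
        exact hlt
    have e := hR.zeroForms t x hx1.le
    have e' := hR'.zeroForms t x hx1.le
    simp only [h11] at e
    rw [← e', Fin.sum_univ_two, Fin.sum_univ_two, hR.of_star (w := x.facet 0) _ hx1,
      hR'.of_star (w := x.facet 0) _ hx1] at e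
    have hxw : x.facet 1 = w := Flag.ext_zero hx0
    rw [hxw] at e
    simpa using e

end IsBuffaChristiansen

/-! ## Existence of the Buffa-Christiansen coefficients -/

open Classical in
/-- The small edges at a vertex form a cycle: a function on the small triangles at the vertex has a
potential if its integral along the cycle vanishes. -/
theorem exists_potential (A : Finset Space3) (g : M.Flag 2 → ℝ)
    (hg : ∑ z : M.Flag 2, (if z.1 0 = A then ((z.orient : ℤ) : ℝ) * g z else 0) = 0) :
    ∃ f : M.Flag 1 → ℝ, ∀ z : M.Flag 2, z.1 0 = A → f (z.facet 2) - f (z.facet 1) = g z := by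
  let L : (M.Flag 1 → ℝ) →ₗ[ℝ] (M.Flag 2 → ℝ) :=
    { toFun := fun f z => if z.1 0 = A then f (z.facet 2) - f (z.facet 1) else 0
      map_add' := fun f f' => by
        funext z
        simp only [Pi.add_apply]
        split_ifs <;> ring
      map_smul' := fun c f => by
        funext z
        simp only [Pi.smul_apply, smul_eq_mul, RingHom.id_apply]
        split_ifs <;> ring }
  let g' : M.Flag 2 → ℝ := fun z => if z.1 0 = A then g z else 0
  suffices h : g' ∈ LinearMap.range L by
    obtain ⟨f, hf⟩ := h
    refine ⟨f, fun z hz => ?_⟩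
    have := congrFun hf z
    simpa [L, g', hz] using this
  by_contra hn
  -- Solvability by duality: a functional that kills the range of the coboundary is, on the
  -- triangles at `A`, a multiple of the orientation sign. By `hg` it then kills `g'`, contrary to
  -- `hφ`.
  obtain ⟨φ, hφ, hφL⟩ := Submodule.exists_le_ker_of_notMem hn
  have hL : ∀ f, φ (L f) = 0 := fun f => hφL ⟨f, rfl⟩
  let c : M.Flag 2 → ℝ := fun z => φ (Pi.single z 1)
  have hφc : ∀ u : M.Flag 2 → ℝ, φ u = ∑ z, u z * c z := fun u => by
    conv_lhs => rw [LinearMap.pi_apply_eq_sum_univ φ u]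
    refine Finset.sum_congr rfl fun z _ => ?_
    rw [smul_eq_mul]
    congr 2
    funext z'
    simp [Pi.single_apply, eq_comm]
  have h2 : ∀ z : M.Flag 2, z.1 0 = A → c z.flipTwo = -c z := by
    intro z hz
    -- The indicator of a small edge at `A` sees exactly the two small triangles on its sides. Since
    -- `φ` kills its image, the coefficients of these two are opposite.
    have e : L (Pi.single (z.facet 2) 1) = Pi.single z 1 + Pi.single z.flipTwo 1 := by
      funext x
      have hx : x.facet 1 ≠ z.facet 2 := fun e => by
        have := congrArg (fun w : M.Flag 1 => (w.1 1).card) e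
        simp [x.card_two, z.card_one] at this
      by_cases hxz : x.facet 2 = z.facet 2
      · have h0 : x.1 0 = z.1 0 := congrArg (fun w : M.Flag 1 => w.1 0) hxz
        have h1 : x.1 1 = z.1 1 := congrArg (fun w : M.Flag 1 => w.1 1) hxz
        have hne := z.flipTwo_ne
        rcases (z.flipTwo_spec x).1 ⟨h0, h1⟩ with rfl | rfl
        · simp [L, hz, hx, hne.symm]
        · simp [L, h0.trans hz, hx, hxz, hne]
      · have n1 : x ≠ z := fun e => hxz (by rw [e])
        have n2 : x ≠ z.flipTwo := fun e => hxz (by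
          rw [e]; exact Flag.ext_one z.flipTwo_eq.1 z.flipTwo_eq.2)
        simp [L, hx, hxz, n1, n2]
    have := hL (Pi.single (z.facet 2) 1)
    rw [e, map_add] at this
    exact eq_neg_of_add_eq_zero_right this
  have h1 : ∀ z : M.Flag 2, z.1 0 = A → c z.flipOne = -c z := by
    intro z hz
    have e : L (Pi.single (z.facet 1) 1) = -(Pi.single z 1 + Pi.single z.flipOne 1) := by
      funext x
      have hx : x.facet 2 ≠ z.facet 1 := fun e => by
        have := congrArg (fun w : M.Flag 1 => (w.1 1).card) e
        simp [z.card_two, x.card_one] at this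
      by_cases hxz : x.facet 1 = z.facet 1
      · have h0 : x.1 0 = z.1 0 := congrArg (fun w : M.Flag 1 => w.1 0) hxz
        have h1 : x.1 2 = z.1 2 := congrArg (fun w : M.Flag 1 => w.1 1) hxz
        have hne := z.flipOne_ne
        rcases (z.flipOne_spec x).1 ⟨h0, h1⟩ with rfl | rfl
        · simp [L, hz, hx, hne.symm]
        · simp [L, h0.trans hz, hx, hxz, hne]
      · have n1 : x ≠ z := fun e => hxz (by rw [e])
        have n2 : x ≠ z.flipOne := fun e => hxz (by
          rw [e]; exact Flag.ext_one z.flipOne_eq.1 z.flipOne_eq.2)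
        simp [L, hx, hxz, n1, n2]
    have := hL (Pi.single (z.facet 1) 1)
    rw [e, map_neg, map_add, neg_eq_zero] at this
    exact eq_neg_of_add_eq_zero_right this
  have hF : ∀ z z' : M.Flag 2, z.1 0 = A → z'.1 0 = A →
      ((z.orient : ℤ) : ℝ) * c z = ((z'.orient : ℤ) : ℝ) * c z' := by
    intro z z' hz hz'
    refine eq_of_star (F := fun z : M.Flag 2 => ((z.orient : ℤ) : ℝ) * c z) (A := A) ?_ ?_ hz hz'
    · intro z z' h h' e
      rcases (z.flipTwo_spec z').1 ⟨h'.trans h.symm, e.symm⟩ with rfl | rfl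
      · rfl
      · rw [h2 z h, z.orient_flipTwo]
        push_cast
        ring
    · intro z z' h h' e
      rcases (z.flipOne_spec z').1 ⟨h'.trans h.symm, e.symm⟩ with rfl | rfl
      · rfl
      · rw [h1 z h, z.orient_flipOne]
        push_cast
        ring
  apply hφ
  rw [hφc]
  by_cases hA : ∃ z : M.Flag 2, z.1 0 = A
  · obtain ⟨z₀, hz₀⟩ := hA
    rw [← mul_zero (((z₀.orient : ℤ) : ℝ) * c z₀), ← hg, Finset.mul_sum]
    refine Finset.sum_congr rfl fun z _ => ?_
    by_cases hz : z.1 0 = A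
    · simp only [g', hz, if_true]
      rw [hF z₀ z hz₀ hz]
      rcases Int.units_eq_one_or z.orient with e | e <;> simp [e] <;> ring
    · simp [g', hz]
  · push Not at hA
    refine Finset.sum_eq_zero fun z _ => ?_
    simp [g', hA z]

open Classical in
/-- The coefficients of the `1`-forms at the vertex `A` of the edge `t`. -/
theorem exists_potential_edge (t : M.Cell 1) {A : Finset Space3} (hAt : A ⊆ t.1)
    (hAc : A.card = 1) :
    ∃ f : M.Flag 1 → ℝ, (∀ z : M.Flag 2, z.1 0 = A →
      (dualCoeff (q := 1) rfl t (z.facet 0) : ℝ) / 2 - f (z.facet 1) + f (z.facet 2) =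
        ∑ s : M.Cell 0, incidence s t * ((dualCoeff (q := 2) rfl s z : ℝ) /
          dualCount (q := 2) rfl s)) ∧
      ∀ w : M.Flag 1, w.1 0 = A → w.1 1 = t.1 → f w = 0 := by
  have hA : A ∈ M.K.faces := M.K.down_closed t.2.1 hAt (Finset.card_pos.1 (by omega))
  let a : M.Cell 0 := ⟨A, hA, hAc⟩
  obtain ⟨z₀, h0, h1⟩ := exists_flag_vertex_edge hA hAc hAt
  let g : M.Flag 2 → ℝ := fun z =>
    ∑ s : M.Cell 0, incidence s t * ((dualCoeff (q := 2) rfl s z : ℝ) / dualCount (q := 2) rfl s) -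
      (dualCoeff (q := 1) rfl t (z.facet 0) : ℝ) / 2
  have hsum : ∀ z : M.Flag 2, z.1 0 = A →
      ∑ s : M.Cell 0, incidence s t * ((dualCoeff (q := 2) rfl s z : ℝ) / dualCount (q := 2) rfl s) =
        incidence a t * ((dualCoeff (q := 2) rfl a z : ℝ) / dualCount (q := 2) rfl a) := by
    intro z hz
    refine Finset.sum_eq_single_of_mem a (Finset.mem_univ _) fun s _ hne => ?_
    rw [dualCoeff_eq_zero _ fun e => hne (Subtype.ext (e.symm.trans hz))]
    simp
  have hg : ∑ z : M.Flag 2, (if z.1 0 = A then ((z.orient : ℤ) : ℝ) * g z else 0) = 0 := by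
    -- After multiplication by the orientation, each triangle of the dual face contributes the same
    -- amount; the sum over the face then cancels `dualCount`.
    have e1 : ∀ z : M.Flag 2, (if z.1 0 = A then ((z.orient : ℤ) : ℝ) * g z else 0) =
        incidence a t * ((z₀.eps 0 (by norm_num) : ℤ) : ℝ) / dualCount (q := 2) rfl a *
          |dualCoeff (q := 2) rfl a z| -
        (if z.1 0 = A then ((z.orient : ℤ) : ℝ) * (dualCoeff (q := 1) rfl t (z.facet 0) : ℝ) / 2
          else 0) := by
      intro z
      by_cases hz : z.1 0 = A
      · rw [if_pos hz, if_pos hz, abs_dualCoeff _ (show z.1 0 = a.1 from hz)]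
        simp only [g]
        rw [hsum z hz, dualCoeff_vertex (z := z) rfl (show z.1 0 = a.1 from hz),
          eps_zero_eq (hz.trans h0.symm)]
        rcases Int.units_eq_one_or z.orient with e | e <;> simp [e] <;> ring
      · rw [if_neg hz, if_neg hz, dualCoeff_eq_zero _ (show z.1 0 ≠ a.1 from hz)]
        simp
    -- Only the two small triangles at `A` along the edge `t` contribute, each with half of the same
    -- sign.
    have e2 : ∑ z : M.Flag 2, (if z.1 0 = A then
        ((z.orient : ℤ) : ℝ) * (dualCoeff (q := 1) rfl t (z.facet 0) : ℝ) / 2 else 0) =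
        -((z₀.eps 1 (by norm_num) : ℤ) : ℝ) := by
      rw [← Finset.sum_subset (Finset.subset_univ {z₀, z₀.flipTwo}),
        Finset.sum_pair z₀.flipTwo_ne.symm, if_pos h0, if_pos (z₀.flipTwo_eq.1.trans h0),
        dualCoeff_edge rfl h1, dualCoeff_edge rfl (z₀.flipTwo_eq.2.trans h1), z₀.orient_flipTwo,
        (eps_eq_of_edge_eq z₀.flipTwo_eq.1 z₀.flipTwo_eq.2).2]
      · rcases Int.units_eq_one_or z₀.orient with e | e <;> simp [e]
      · intro z _ hz
        split_ifs with hzA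
        · rw [dualCoeff_eq_zero]
          · simp
          · intro e
            apply hz
            simpa using (z₀.flipTwo_spec z).1 ⟨hzA.trans h0.symm, e.trans h1.symm⟩
        · rfl
    have e3 : (∑ z : M.Flag 2, (|dualCoeff (q := 2) rfl a z| : ℝ)) = dualCount (q := 2) rfl a := by
      rw [dualCount]
      push_cast
      rfl
    have hn : (dualCount (q := 2) rfl a : ℝ) ≠ 0 := by
      exact_mod_cast (dualCount_pos (q := 2) rfl a).ne'
    simp only [e1, Finset.sum_sub_distrib, e2]
    push_cast
    rw [← Finset.mul_sum, e3, div_mul_cancel₀ _ hn, incidence_zero_one (s := a) h0 h1]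
    rcases Int.units_eq_one_or (z₀.eps 0 (by norm_num)) with e | e <;> simp [e]
  obtain ⟨f, hf⟩ := exists_potential A g hg
  -- A potential is determined only up to a constant; subtracting its value on the small edge inside
  -- `t` gives `stability`.
  refine ⟨fun w => f w - f (z₀.facet 2), fun z hz => ?_, fun w hw0 hw1 => ?_⟩
  · have := hf z hz
    simp only [g] at this
    linarith
  · rw [sub_eq_zero]
    exact congrArg f (Flag.ext_one (hw0.trans h0.symm) (hw1.trans h1.symm))

/-- The dual cell of a triangle. -/
def Cell.center (t : M.Cell 2) : M.Flag 0 := ⟨fun _ => t.1, fun _ => t.2.1, fun _ _ h => by omega⟩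

/-- The small edge from the node `A` to the center of a triangle. -/
def edgeToCenter (t : M.Cell 2) (A : Finset Space3) (hA : A ∈ M.K.faces) (h : A ⊂ t.1) :
    M.Flag 1 :=
  ⟨![A, t.1], fun i => by
    fin_cases i
    exacts [hA, t.2.1], Fin.strictMono_iff_lt_succ.2 fun i => by
    fin_cases i
    exact h⟩

open Classical in
/-- The Buffa-Christiansen coefficients of the `0`-forms, from those of the `1`-forms. -/
def zeroCoeff (ρ : M.Cell 1 → M.Flag 1 → ℝ) (t : M.Cell 2) (w : M.Flag 0) : ℝ :=
  if h : w.1 0 ⊂ t.1 then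
    dualCoeff rfl t t.center +
      ∑ s : M.Cell 1, (incidence s t : ℝ) * ρ s (edgeToCenter t (w.1 0) (w.2.1 0) h)
  -- This branch gives the prescribed sign at the center of `t` and zero at nodes not contained in
  -- `t`.
  else dualCoeff rfl t w

/-- The potentials at the two endpoints of an edge involve disjoint sets of small edges, so they are
chosen independently; the `0`-cochains are then read off along the small edges to the centers. -/
theorem exists_isBuffaChristiansen : ∃ R : M.BCCoeff, IsBuffaChristiansen R := by
  classical
  have hex : ∀ (t : M.Cell 1) (A : Finset Space3), ∃ f : M.Flag 1 → ℝ, A ⊆ t.1 → A.card = 1 →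
      (∀ z : M.Flag 2, z.1 0 = A →
      (dualCoeff (q := 1) rfl t (z.facet 0) : ℝ) / 2 - f (z.facet 1) + f (z.facet 2) =
        ∑ s : M.Cell 0, incidence s t * ((dualCoeff (q := 2) rfl s z : ℝ) /
          dualCount (q := 2) rfl s)) ∧
      ∀ w : M.Flag 1, w.1 0 = A → w.1 1 = t.1 → f w = 0 := by
    intro t A
    by_cases h : A ⊆ t.1 ∧ A.card = 1
    · obtain ⟨f, hf⟩ := exists_potential_edge t h.1 h.2
      exact ⟨f, fun _ _ => hf⟩
    · exact ⟨0, fun h1 h2 => absurd ⟨h1, h2⟩ h⟩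
  choose f hf using hex
  let ω : M.Cell 0 → M.Flag 2 → ℝ := fun t z =>
    (dualCoeff (q := 2) rfl t z : ℝ) / dualCount (q := 2) rfl t
  let ρ : M.Cell 1 → M.Flag 1 → ℝ := fun t w =>
    if w.1 0 ⊆ t.1 ∧ (w.1 0).card = 1 then f t (w.1 0) w else (dualCoeff rfl t w : ℝ) / 2
  have hρ0 : ∀ t w, ¬ w.1 0 ⊆ t.1 → ρ t w = 0 := fun t w hw => by
    simp only [ρ]
    rw [if_neg fun h => hw h.1, dualCoeff_eq_zero _ fun h => hw h.le, Int.cast_zero, zero_div]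
  have hρ2 : ∀ t w, (w.1 0).card = 2 → ρ t w = (dualCoeff rfl t w : ℝ) / 2 := fun t w hw =>
    if_neg fun h => by omega
  have hω0 : ∀ t z, ¬ z.1 0 ⊆ t.1 → ω t z = 0 := fun t w hw => by
    simp only [ω]
    rw [dualCoeff_eq_zero _ fun h => hw h.le, Int.cast_zero, zero_div]
  have hone : ∀ t z, ∑ i : Fin 3, (-1) ^ (i : ℕ) * ρ t (z.facet i) =
      ∑ s : M.Cell 0, incidence s t * ω s z := by
    intro t z
    by_cases hz : z.1 0 ⊆ t.1
    · rw [Fin.sum_univ_three, hρ2 t (z.facet 0) z.card_one,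
        ← (hf t (z.1 0) hz z.card_zero).1 z rfl]
      have e1 : ρ t (z.facet 1) = f t (z.1 0) (z.facet 1) := if_pos ⟨hz, z.card_zero⟩
      have e2 : ρ t (z.facet 2) = f t (z.1 0) (z.facet 2) := if_pos ⟨hz, z.card_zero⟩
      rw [e1, e2]
      simp only [Fin.val_zero, Fin.val_one, Fin.val_two, pow_zero, pow_one, one_mul]
      ring
    · have hz1 : ¬ z.1 1 ⊆ t.1 := fun h => hz ((z.2.2 (show (0 : Fin 3) < 1 by decide)).le.trans h)
      rw [Finset.sum_eq_zero, Finset.sum_eq_zero]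
      · intro s _
        by_cases hs : z.1 0 ⊆ s.1
        · rw [incidence_eq_zero fun h => hz (hs.trans h), Int.cast_zero, zero_mul]
        · rw [hω0 _ _ hs, mul_zero]
      · intro i _
        rw [hρ0, mul_zero]
        fin_cases i
        exacts [hz1, hz, hz]
  have hζ0 : ∀ t w, ¬ w.1 0 ⊆ t.1 → zeroCoeff ρ t w = 0 := fun t w hw => by
    rw [zeroCoeff, dif_neg fun h => hw h.le, dualCoeff_eq_zero _ fun h => hw h.le, Int.cast_zero]
  let R : M.BCCoeff := fun r q h => match r, q, h with
    | 0, 2, _ => ω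
    | 1, 1, _ => ρ
    | 2, 0, _ => zeroCoeff ρ
    -- Unreachable degrees, since `r + q = 2`.
    | _, _, _ => 0
  have hR0 : ∀ r q (h : r + q = 2) (t : M.Cell r) (w : M.Flag q), ¬ w.1 0 ⊆ t.1 →
      R r q h t w = 0 := by
    intro r q h t w hw
    obtain ⟨rfl, rfl⟩ | ⟨rfl, rfl⟩ | ⟨rfl, rfl⟩ : (r = 0 ∧ q = 2) ∨ (r = 1 ∧ q = 1) ∨
      (r = 2 ∧ q = 0) := by omega
    exacts [hω0 t w hw, hρ0 t w hw, hζ0 t w hw]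
  refine ⟨R, ?_, ?_, ?_, ?_, fun t z _ => hone t z, ?_⟩
  · exact fun r q h t w hw => hR0 r q h t w (Flag.not_subset_of_not_inRegion h hw)
  · exact fun r q h t w hw => hR0 r q h t w ((Flag.inRegion_compl_iff h).1 hw.2)
  · intro r q h t w hw
    rw [dualCoeff_ne_zero] at hw
    obtain ⟨rfl, rfl⟩ | ⟨rfl, rfl⟩ | ⟨rfl, rfl⟩ : (r = 0 ∧ q = 2) ∨ (r = 1 ∧ q = 1) ∨
      (r = 2 ∧ q = 0) := by omega
    · rfl
    · rw [dualCount_edge]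
      exact (hρ2 t w (hw ▸ t.2.2)).trans (by norm_num)
    · rw [dualCount_tri]
      change zeroCoeff ρ t w = _
      rw [zeroCoeff, dif_neg fun hlt => hlt.ne hw]
      norm_num
  · intro t w hw
    have hlt := w.2.2 (show (0 : Fin 2) < 1 by decide)
    have c0 := w.card_apply_pos 0
    have c1 := Finset.card_lt_card hlt
    have c2 := Finset.card_le_card hw
    have c3 : t.1.card = 2 := t.2.2
    have c4 : (w.1 (Fin.last 1)).card = (w.1 1).card := rfl
    have h0t : w.1 0 ⊆ t.1 := hlt.le.trans hw
    have hc : (w.1 0).card = 1 := by omega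
    have h1t : w.1 1 = t.1 := (subset_iff_eq_of_card (by omega)).1 hw
    exact (if_pos ⟨h0t, hc⟩).trans ((hf t (w.1 0) h0t hc).2 w rfl h1t)
  · intro t z hz
    have hlt := z.2.2 (show (0 : Fin 2) < 1 by decide)
    have hAt : z.1 0 ⊂ t.1 := hlt.trans_le hz
    have hA : zeroCoeff ρ t (z.facet 1) = dualCoeff rfl t t.center +
        ∑ s : M.Cell 1, (incidence s t : ℝ) * ρ s (edgeToCenter t (z.1 0) (z.2.1 0) hAt) :=
      dif_pos hAt
    rw [Fin.sum_univ_two]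
    change (-1) ^ 0 * zeroCoeff ρ t (z.facet 0) + (-1) ^ 1 * zeroCoeff ρ t (z.facet 1) =
      -∑ s : M.Cell 1, incidence s t * ρ s z
    rw [hA]
    by_cases hBt : z.1 1 = t.1
    · have e1 : edgeToCenter t (z.1 0) (z.2.1 0) hAt = z := Flag.ext_one rfl hBt.symm
      have e2 : z.facet 0 = t.center := Flag.ext_zero hBt
      rw [e1, e2, zeroCoeff, dif_neg fun h => h.ne rfl]
      ring
    · have hBt' : z.1 1 ⊂ t.1 := Finset.ssubset_iff_subset_ne.2 ⟨hz, hBt⟩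
      obtain ⟨x, x0, x1, x2⟩ := exists_flag_two (z.2.1 0) (z.2.1 1) t.2.1 hlt hBt'
      -- If `z` does not end at the center of `t`, it spans with the center a small triangle `x`.
      -- Closedness on `x` derives the condition on `z` from the two sides that end at the center.
      have e := coboundary_sum_incidence (ρ := ρ) (ω := ω) (z := x) (fun s => hone s x) t
      rw [Fin.sum_univ_three] at e
      have f0 : x.facet 0 = edgeToCenter t (z.1 1) (z.2.1 1) hBt' := Flag.ext_one x1 x2
      have f1 : x.facet 1 = edgeToCenter t (z.1 0) (z.2.1 0) hAt := Flag.ext_one x0 x2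
      have f2 : x.facet 2 = z := Flag.ext_one x0 x1
      have hB : zeroCoeff ρ t (z.facet 0) = dualCoeff rfl t t.center +
          ∑ s : M.Cell 1, (incidence s t : ℝ) * ρ s (edgeToCenter t (z.1 1) (z.2.1 1) hBt') :=
        dif_pos hBt'
      rw [f0, f1, f2] at e
      simp only [Fin.val_zero, Fin.val_one, Fin.val_two, pow_zero, pow_one, one_mul] at e
      rw [hB]
      linarith

end ClosedSurfaceMesh

/-! ## The reference simplex -/

theorem convex_refSimplex (m : ℕ) : Convex ℝ (refSimplex m) := by
  intro x hx y hy a b ha hb hab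
  refine ⟨fun i => ?_, ?_⟩
  · exact add_nonneg (mul_nonneg ha (hx.1 i)) (mul_nonneg hb (hy.1 i))
  · have : ∑ i, (a • x + b • y) i = a * ∑ i, x i + b * ∑ i, y i := by
      simp [Finset.sum_add_distrib, Finset.mul_sum]
    rw [this]
    nlinarith [hx.2, hy.2]

theorem isClosed_refSimplex (m : ℕ) : IsClosed (refSimplex m) := by
  have : refSimplex m = (⋂ i, {x | 0 ≤ x i}) ∩ {x | ∑ i, x i ≤ 1} := by
    ext x
    simp [refSimplex]
  rw [this]
  exact (isClosed_iInter fun i => isClosed_le continuous_const (continuous_apply i)).inter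
    (isClosed_le (by fun_prop) continuous_const)

theorem isCompact_refSimplex (m : ℕ) : IsCompact (refSimplex m) := by
  refine (isCompact_Icc (a := (0 : Fin m → ℝ)) (b := 1)).of_isClosed_subset
    (isClosed_refSimplex m) fun x hx => ⟨hx.1, fun i => ?_⟩
  exact (Finset.single_le_sum (fun j _ => hx.1 j) (Finset.mem_univ i)).trans hx.2

theorem subset_interior_refSimplex (m : ℕ) :
    {x : Fin m → ℝ | (∀ i, 0 < x i) ∧ ∑ i, x i < 1} ⊆ interior (refSimplex m) := by
  refine interior_maximal (fun x hx => ⟨fun i => (hx.1 i).le, hx.2.le⟩) ?_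
  have : {x : Fin m → ℝ | (∀ i, 0 < x i) ∧ ∑ i, x i < 1} =
      (⋂ i, {x | 0 < x i}) ∩ {x | ∑ i, x i < 1} := by
    ext x
    simp
  rw [this]
  exact (isOpen_iInter_of_finite fun i => isOpen_lt continuous_const (continuous_apply i)).inter
    (isOpen_lt (by fun_prop) continuous_const)

theorem interior_refSimplex_nonempty (m : ℕ) : (interior (refSimplex m)).Nonempty := by
  refine ⟨fun _ => 1 / (m + 1), subset_interior_refSimplex m ⟨fun _ => by positivity, ?_⟩⟩
  rw [Finset.sum_const, Finset.card_univ, Fintype.card_fin, nsmul_eq_mul, mul_one_div,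
    div_lt_one (by positivity)]
  exact lt_add_one _

theorem uniqueDiffOn_refSimplex (m : ℕ) : UniqueDiffOn ℝ (refSimplex m) :=
  uniqueDiffOn_convex (convex_refSimplex m) (interior_refSimplex_nonempty m)

theorem hasFDerivAt_refBary {m : ℕ} (j : Fin (m + 1)) (x : Fin m → ℝ) :
    HasFDerivAt (refBary j) (refBaryDeriv j) x := by
  induction j using Fin.cases with
  | zero =>
    have h : HasFDerivAt (fun x : Fin m → ℝ => ∑ i, x i)
        (∑ i, ContinuousLinearMap.proj (R := ℝ) (φ := fun _ => ℝ) i) x :=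
      HasFDerivAt.fun_sum fun i _ => hasFDerivAt_apply i x
    exact h.const_sub 1
  | succ i => exact hasFDerivAt_apply i x

theorem contDiff_refBary {m : ℕ} {n : WithTop ℕ∞} (j : Fin (m + 1)) :
    ContDiff ℝ n (refBary (m := m) j) := by
  induction j using Fin.cases with
  | zero =>
    have h : ContDiff ℝ n (fun x : Fin m → ℝ => ∑ i, x i) :=
      ContDiff.sum fun i _ => contDiff_apply ℝ ℝ i
    exact contDiff_const.sub h
  | succ i => exact contDiff_apply ℝ ℝ i

theorem hasFDerivAt_refFaceMap {l m : ℕ} (ι : Fin (l + 1) → Fin (m + 1)) (x : Fin l → ℝ) :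
    HasFDerivAt (refFaceMap ι) (refFaceDeriv ι) x :=
  HasFDerivAt.fun_sum fun i _ => (hasFDerivAt_refBary i x).smul_const _

theorem wedgeCovectors_apply {m k : ℕ} (ℓ : Fin k → ((Fin m → ℝ) →L[ℝ] ℝ))
    (v : Fin k → Fin m → ℝ) : wedgeCovectors ℓ v = Matrix.det (Matrix.of fun i j => ℓ j (v i)) := rfl

/-- More than `m` vectors in dimension `m` are linearly dependent. This disposes of the traces on
cells of too small dimension. -/
theorem ContinuousAlternatingMap.eq_zero_of_lt {m k : ℕ} (h : m < k)
    (φ : (Fin m → ℝ) [⋀^Fin k]→L[ℝ] ℝ) : φ = 0 := by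
  ext v
  refine φ.toAlternatingMap.map_linearDependent v fun hv => ?_
  have := hv.fintype_card_le_finrank
  simp only [Fintype.card_fin, Module.finrank_fintype_fun_eq_card] at this
  omega

namespace ClosedSurfaceMesh

variable {M : ClosedSurfaceMesh}

/-! ## Smooth conforming forms are regular -/

theorem nodeBary_sub {l m : ℕ} (u : M.Flag m) (ι : Fin (l + 1) ↪o Fin (m + 1))
    (σ : Finset Space3) (x : Fin l → ℝ) :
    nodeBary (u.sub ι) σ x = nodeBary u σ (refFaceMap ι x) := by
  classical
  have h : ∀ j, (if u.1 j = σ then refBary j (refFaceMap ι x) else 0) =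
      ∑ i, if ι i = j then (if u.1 j = σ then refBary i x else 0) else 0 := fun j => by
    rw [refBary_refFaceMap]
    split_ifs <;> simp
  simp only [nodeBary, h]
  rw [Finset.sum_comm]
  refine Finset.sum_congr rfl fun i _ => ?_
  rw [Finset.sum_ite_eq, if_pos (Finset.mem_univ _)]
  rfl

theorem hasFDerivAt_nodeBary {m : ℕ} (u : M.Flag m) (σ : Finset Space3) (x : Fin m → ℝ) :
    HasFDerivAt (nodeBary u σ) (nodeBaryDeriv u σ) x := by
  refine HasFDerivAt.fun_sum fun j _ => ?_
  split_ifs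
  · exact hasFDerivAt_refBary j x
  · exact hasFDerivAt_const 0 x

theorem contDiff_nodeBary {m : ℕ} {n : WithTop ℕ∞} (u : M.Flag m) (σ : Finset Space3) :
    ContDiff ℝ n (nodeBary u σ) := by
  refine ContDiff.sum fun j _ => ?_
  split_ifs
  · exact contDiff_refBary j
  · exact contDiff_const

/-- Differentiate `nodeBary_sub` by the chain rule and use uniqueness of the derivative. -/
theorem nodeBaryDeriv_sub {l m : ℕ} (u : M.Flag m) (ι : Fin (l + 1) ↪o Fin (m + 1))
    (σ : Finset Space3) :
    nodeBaryDeriv (u.sub ι) σ = (nodeBaryDeriv u σ).comp (refFaceDeriv ι) := by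
  have h1 := hasFDerivAt_nodeBary (u.sub ι) σ 0
  have h2 := (hasFDerivAt_nodeBary u σ (refFaceMap ι 0)).comp 0 (hasFDerivAt_refFaceMap ι 0)
  have e : nodeBary u σ ∘ refFaceMap ι = nodeBary (u.sub ι) σ :=
    funext fun x => (nodeBary_sub u ι σ x).symm
  rw [e] at h2
  exact h1.unique h2

theorem whitney_isConforming {q : ℕ} (w : M.Flag q) : (whitney w).IsConforming := by
  intro l m u ι x _
  simp only [whitney, nodeBary_sub, nodeBaryDeriv_sub]
  ext v
  simp [wedgeCovectors_apply]

theorem contDiff_whitney {q m : ℕ} {n : WithTop ℕ∞} (w : M.Flag q) (u : M.Flag m) :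
    ContDiff ℝ n (whitney w m u) := by
  refine ContDiff.const_smul _ (ContDiff.sum fun i _ => ?_)
  exact (contDiff_const.mul (contDiff_nodeBary u _)).smul contDiff_const

variable (M) in
/-- The conforming forms which are smooth on each cell of the refinement. -/
def smoothForms (k : ℕ) : Submodule ℝ (M.Form k) where
  carrier := {β | β.IsConforming ∧ ∀ m (u : M.Flag m), ContDiff ℝ 2 (β m u)}
  add_mem' := fun ha hb => ⟨fun l m w ι x hx => by
    simp only [Pi.add_apply]
    rw [ha.1 l m w ι x hx, hb.1 l m w ι x hx]
    rfl, fun m u => (ha.2 m u).add (hb.2 m u)⟩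
  zero_mem' := ⟨fun _ _ _ _ _ _ => rfl, fun _ _ => contDiff_const⟩
  smul_mem' := fun c _ ha => ⟨fun l m w ι x hx => by
    simp only [Pi.smul_apply]
    rw [ha.1 l m w ι x hx]
    rfl, fun m u => ContDiff.const_smul c (ha.2 m u)⟩

theorem mem_smoothForms {k : ℕ} {β : M.Form k} : β ∈ M.smoothForms k ↔
    β.IsConforming ∧ ∀ m (u : M.Flag m), ContDiff ℝ 2 (β m u) := Iff.rfl

theorem whitney_mem_smoothForms {q : ℕ} (w : M.Flag q) : whitney w ∈ M.smoothForms q :=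
  mem_smoothForms.2 ⟨whitney_isConforming w, fun _ u => contDiff_whitney w u⟩

theorem isRegular_of_mem_smoothForms {k : ℕ} {β : M.Form k} (hβ : β ∈ M.smoothForms k) :
    β.IsRegular where
  conforming := (mem_smoothForms.1 hβ).1
  continuousOn := fun m w => ((mem_smoothForms.1 hβ).2 m w).continuous.continuousOn
  differentiableOn := fun m w => (((mem_smoothForms.1 hβ).2 m w).differentiable (by norm_num)).differentiableOn
  integrable_d := fun w => by
    refine ContinuousOn.integrableOn_compact (isCompact_refSimplex _) ?_
    have hc : Continuous fun x => extDeriv (β (k + 1) w) x (fun i => Pi.single i 1) := by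
      have h1 : Continuous (fderiv ℝ (β (k + 1) w)) := ((mem_smoothForms.1 hβ).2 _ w).continuous_fderiv (by norm_num)
      have h2 := (ContinuousAlternatingMap.alternatizeUncurryFinCLM ℝ (Fin (k + 1) → ℝ)
        ℝ).continuous.comp h1
      exact (ContinuousAlternatingMap.apply ℝ (Fin (k + 1) → ℝ) ℝ
        (fun i : Fin (k + 1) => (Pi.single i 1 : Fin (k + 1) → ℝ))).continuous.comp h2
    refine hc.continuousOn.congr fun x hx => ?_
    simp only [Form.density, Form.d, extDerivWithin, extDeriv]
    rw [fderivWithin_eq_fderiv (uniqueDiffOn_refSimplex _ x hx)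
      (((mem_smoothForms.1 hβ).2 _ w).differentiable (by norm_num) x)]

/-! ## Whitney forms on a cell -/

theorem nodeBary_apply {m : ℕ} (u : M.Flag m) (j : Fin (m + 1)) :
    nodeBary u (u.1 j) = refBary j := by
  funext x
  simp [nodeBary, u.2.2.injective.eq_iff]

theorem nodeBaryDeriv_apply {m : ℕ} (u : M.Flag m) (j : Fin (m + 1)) :
    nodeBaryDeriv u (u.1 j) = refBaryDeriv j := by
  simp [nodeBaryDeriv, u.2.2.injective.eq_iff]

/-- Each term contains, for every node of `w`, its barycentric coordinate or its differential; both
vanish on `u` for a node that is not in `u`. -/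
theorem whitney_eq_zero {q m : ℕ} {w : M.Flag q} {u : M.Flag m}
    (h : ¬ Set.range w.1 ⊆ Set.range u.1) : whitney w m u = 0 := by
  obtain ⟨_, ⟨k, rfl⟩, hk⟩ := Set.not_subset.1 h
  have hk' : ∀ j, u.1 j ≠ w.1 k := fun j e => hk ⟨j, e⟩
  have h1 : ∀ x, nodeBary u (w.1 k) x = 0 := fun x => by simp [nodeBary, hk']
  have h2 : nodeBaryDeriv u (w.1 k) = 0 := by simp [nodeBaryDeriv, hk']
  funext x
  simp only [whitney]
  rw [Finset.sum_eq_zero, smul_zero]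
  · rfl
  intro i _
  by_cases hi : i = k
  · rw [hi, h1, mul_zero, zero_smul]
  · obtain ⟨j, hj⟩ := Fin.exists_succAbove_eq (Ne.symm hi)
    have : wedgeCovectors (fun j : Fin q => nodeBaryDeriv u (w.1 (i.succAbove j))) = 0 := by
      ext v
      rw [wedgeCovectors_apply]
      refine Matrix.det_eq_zero_of_column_eq_zero j fun i' => ?_
      change nodeBaryDeriv u (w.1 (i.succAbove j)) (v i') = 0
      rw [hj, h2]
      rfl
    rw [this, smul_zero]

theorem whitney_apply_eq_zero {q m : ℕ} {w : M.Flag q} {u : M.Flag m}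
    (h : ¬ Set.range w.1 ⊆ Set.range u.1) (x : Fin m → ℝ) (v : Fin q → Fin m → ℝ) :
    whitney w m u x v = 0 := by
  rw [whitney_eq_zero h]
  rfl

theorem Flag.eq_of_range_subset {q : ℕ} {w w' : M.Flag q} (h : Set.range w.1 ⊆ Set.range w'.1) :
    w = w' := by
  refine Subtype.ext ((w.2.2.range_inj w'.2.2).1 ?_)
  refine Set.eq_of_subset_of_ncard_le h ?_ (Set.finite_range _)
  rw [← Set.image_univ, ← Set.image_univ, Set.ncard_image_of_injective _ w.2.2.injective,
    Set.ncard_image_of_injective _ w'.2.2.injective]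

theorem whitney_zero_apply {m : ℕ} (w : M.Flag 0) (u : M.Flag m) (x : Fin m → ℝ)
    (v : Fin 0 → Fin m → ℝ) : whitney w m u x v = nodeBary u (w.1 0) x := by
  simp [whitney, wedgeCovectors_apply]

theorem whitney_one_apply {m : ℕ} (w : M.Flag 1) (u : M.Flag m) (x : Fin m → ℝ)
    (v : Fin 1 → Fin m → ℝ) : whitney w m u x v =
      nodeBary u (w.1 0) x * nodeBaryDeriv u (w.1 1) (v 0) -
        nodeBary u (w.1 1) x * nodeBaryDeriv u (w.1 0) (v 0) := by
  simp [whitney, wedgeCovectors_apply, Fin.sum_univ_two]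
  ring

theorem whitney_two_apply {m : ℕ} (w : M.Flag 2) (u : M.Flag m) (x : Fin m → ℝ)
    (v : Fin 2 → Fin m → ℝ) : whitney w m u x v = 2 *
      (nodeBary u (w.1 0) x * (nodeBaryDeriv u (w.1 1) (v 0) * nodeBaryDeriv u (w.1 2) (v 1) -
          nodeBaryDeriv u (w.1 2) (v 0) * nodeBaryDeriv u (w.1 1) (v 1)) -
        nodeBary u (w.1 1) x * (nodeBaryDeriv u (w.1 0) (v 0) * nodeBaryDeriv u (w.1 2) (v 1) -
          nodeBaryDeriv u (w.1 2) (v 0) * nodeBaryDeriv u (w.1 0) (v 1)) +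
        nodeBary u (w.1 2) x * (nodeBaryDeriv u (w.1 0) (v 0) * nodeBaryDeriv u (w.1 1) (v 1) -
          nodeBaryDeriv u (w.1 1) (v 0) * nodeBaryDeriv u (w.1 0) (v 1))) := by
  have h1 : (1 : Fin 3).succAbove (0 : Fin 2) = 0 := rfl
  have h2 : (1 : Fin 3).succAbove (1 : Fin 2) = 2 := rfl
  have h3 : (2 : Fin 3).succAbove (0 : Fin 2) = 0 := rfl
  have h4 : (2 : Fin 3).succAbove (1 : Fin 2) = 1 := rfl
  simp [whitney, wedgeCovectors_apply, Fin.sum_univ_three, Matrix.det_fin_two, h1, h2, h3, h4]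
  ring

/-! ## The exterior derivative of a Whitney form -/

/-- The Whitney form with given coefficients. -/
def whitneyForm {q : ℕ} (c : M.Flag q → ℝ) : M.Form q := ∑ w, c w • whitney w

theorem whitneyForm_mem_smoothForms {q : ℕ} (c : M.Flag q → ℝ) :
    whitneyForm c ∈ M.smoothForms q :=
  Submodule.sum_mem _ fun w _ => Submodule.smul_mem _ _ (whitney_mem_smoothForms w)

theorem whitneyForm_apply {q m : ℕ} (c : M.Flag q → ℝ) (u : M.Flag m) (x : Fin m → ℝ)
    (v : Fin q → Fin m → ℝ) : whitneyForm c m u x v = ∑ w, c w * whitney w m u x v := by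
  simp only [whitneyForm, Finset.sum_apply, ContinuousAlternatingMap.sum_apply]
  rfl

/-- On a cell of the degree's own dimension, only the Whitney form of that cell survives: a face of
the same dimension is the cell itself. -/
theorem whitneyForm_apply_self {q : ℕ} (c : M.Flag q → ℝ) (u : M.Flag q) (x : Fin q → ℝ)
    (v : Fin q → Fin q → ℝ) : whitneyForm c q u x v = c u * whitney u q u x v := by
  rw [whitneyForm_apply]
  refine Finset.sum_eq_single_of_mem u (Finset.mem_univ _) fun w _ hne => ?_
  rw [whitney_apply_eq_zero fun h => hne (Flag.eq_of_range_subset h), mul_zero]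

/-- A node of a cell of the refinement. -/
def Flag.node {m : ℕ} (u : M.Flag m) (j : Fin (m + 1)) : M.Flag 0 :=
  ⟨fun _ => u.1 j, fun _ => u.2.1 j, fun _ _ h => by omega⟩

theorem whitneyForm_zero_apply {m : ℕ} (c : M.Flag 0 → ℝ) (u : M.Flag m) (x : Fin m → ℝ)
    (v : Fin 0 → Fin m → ℝ) : whitneyForm c m u x v = ∑ j, c (u.node j) * refBary j x := by
  rw [whitneyForm_apply]
  symm
  refine Finset.sum_of_injOn u.node ?_ (fun _ _ => Finset.mem_coe.2 (Finset.mem_univ _)) ?_ ?_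
  · exact fun i _ j _ h => u.2.2.injective (congrArg (fun w : M.Flag 0 => w.1 0) h)
  · intro w _ hw
    rw [whitney_apply_eq_zero, mul_zero]
    intro h
    obtain ⟨j, hj⟩ := h ⟨0, rfl⟩
    exact hw ⟨j, Finset.mem_coe.2 (Finset.mem_univ _), Flag.ext_zero hj⟩
  · intro j _
    rw [whitney_zero_apply, ← nodeBary_apply u]
    rfl

theorem whitneyForm_one_apply (c : M.Flag 1 → ℝ) (u : M.Flag 2) (x : Fin 2 → ℝ)
    (v : Fin 1 → Fin 2 → ℝ) : whitneyForm c 2 u x v =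
      ∑ i : Fin 3, c (u.facet i) * (refBary (i.succAbove 0) x * refBaryDeriv (i.succAbove 1) (v 0) -
        refBary (i.succAbove 1) x * refBaryDeriv (i.succAbove 0) (v 0)) := by
  rw [whitneyForm_apply]
  symm
  have hinj : Function.Injective u.facet := by
    intro i j h
    have h0 := congrArg (fun w : M.Flag 1 => w.1 0) h
    have h1 := congrArg (fun w : M.Flag 1 => w.1 1) h
    have h0' : i.succAbove 0 = j.succAbove 0 := u.2.2.injective h0
    have h1' : i.succAbove 1 = j.succAbove 1 := u.2.2.injective h1
    revert h0' h1'
    clear h h0 h1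
    revert i j
    decide
  refine Finset.sum_of_injOn u.facet hinj.injOn
    (fun _ _ => Finset.mem_coe.2 (Finset.mem_univ _)) ?_ ?_
  · intro w _ hw
    rw [whitney_apply_eq_zero, mul_zero]
    intro h
    obtain ⟨a, ha⟩ := h ⟨0, rfl⟩
    obtain ⟨b, hb⟩ := h ⟨1, rfl⟩
    have hlt : a < b := u.2.2.lt_iff_lt.1 (by
      rw [ha, hb]; exact w.2.2 (show (0 : Fin 2) < 1 by decide))
    -- In a triangle, an increasing pair of nodes is the facet opposite to the third one.
    obtain ⟨i, hi0, hi1⟩ : ∃ i : Fin 3, i.succAbove (0 : Fin 2) = a ∧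
        i.succAbove (1 : Fin 2) = b := by
      revert hlt
      clear ha hb
      revert a b
      decide
    refine hw ⟨i, Finset.mem_coe.2 (Finset.mem_univ _), Flag.ext_one ?_ ?_⟩
    · rw [← ha, ← hi0]; rfl
    · rw [← hb, ← hi1]; rfl
  · intro i _
    rw [whitney_one_apply, ← nodeBary_apply u, ← nodeBary_apply u, ← nodeBaryDeriv_apply u,
      ← nodeBaryDeriv_apply u]
    rfl

theorem Flag.le_two {m : ℕ} (u : M.Flag m) : m ≤ 2 := by
  have key : ∀ i : ℕ, ∀ hi : i < m + 1, i + 1 ≤ (u.1 ⟨i, hi⟩).card := by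
    intro i
    induction i with
    | zero => exact fun hi => u.card_apply_pos _
    | succ i ih => exact fun hi => (ih (by omega)).trans_lt (u.card_lt (Fin.mk_lt_mk.2 (by omega)))
  have := key m (by omega)
  have := M.card_le _ (u.2.1 ⟨m, by omega⟩)
  omega

theorem refBary_two (x : Fin 2 → ℝ) : refBary 0 x = 1 - x 0 - x 1 ∧ refBary 1 x = x 0 ∧
    refBary 2 x = x 1 := by
  refine ⟨?_, rfl, rfl⟩
  change 1 - ∑ i, x i = _
  rw [Fin.sum_univ_two]
  ring

theorem refBaryDeriv_two (x : Fin 2 → ℝ) : refBaryDeriv 0 x = - x 0 - x 1 ∧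
    refBaryDeriv 1 x = x 0 ∧ refBaryDeriv 2 x = x 1 := by
  refine ⟨?_, rfl, rfl⟩
  change (-∑ i : Fin 2, ContinuousLinearMap.proj (R := ℝ) (φ := fun _ => ℝ) i) x = _
  simp [Fin.sum_univ_two]
  ring

theorem refBary_one (x : Fin 1 → ℝ) : refBary 0 x = 1 - x 0 ∧ refBary 1 x = x 0 := by
  refine ⟨?_, rfl⟩
  change 1 - ∑ i, x i = _
  rw [Fin.sum_univ_one]

theorem refBaryDeriv_one (x : Fin 1 → ℝ) : refBaryDeriv 0 x = - x 0 ∧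
    refBaryDeriv 1 x = x 0 := by
  refine ⟨?_, rfl⟩
  change (-∑ i : Fin 1, ContinuousLinearMap.proj (R := ℝ) (φ := fun _ => ℝ) i) x = _
  simp

/-- The coefficients extend smoothly to all of the parameter space, so the one-sided derivative on
the closed simplex is the ordinary one, boundary included. -/
theorem whitneyForm_d_eq {q m : ℕ} (c : M.Flag q → ℝ) (u : M.Flag m)
    {x : Fin m → ℝ} (hx : x ∈ refSimplex m) :
    (whitneyForm c).d m u x = extDeriv (whitneyForm c m u) x := by
  have hd : Differentiable ℝ (whitneyForm c m u) :=
    ((mem_smoothForms.1 (whitneyForm_mem_smoothForms c)).2 m u).differentiable (by norm_num)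
  simp only [Form.d, extDerivWithin, extDeriv]
  rw [fderivWithin_eq_fderiv (uniqueDiffOn_refSimplex _ x hx) (hd x)]

theorem whitneyForm_d_zero_apply {m : ℕ} (c : M.Flag 0 → ℝ) (u : M.Flag m)
    {x : Fin m → ℝ} (hx : x ∈ refSimplex m) (v : Fin 1 → Fin m → ℝ) :
    (whitneyForm c).d m u x v = ∑ j, c (u.node j) * refBaryDeriv j (v 0) := by
  have hd : Differentiable ℝ (whitneyForm c m u) :=
    ((mem_smoothForms.1 (whitneyForm_mem_smoothForms c)).2 m u).differentiable (by norm_num)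
  rw [whitneyForm_d_eq c u hx, extDeriv_apply (hd x), Fin.sum_univ_one]
  simp only [whitneyForm_zero_apply]
  have hD := (HasFDerivAt.fun_sum (u := Finset.univ)
    fun j _ => (hasFDerivAt_refBary j x).const_mul (c (u.node j))).fderiv
  rw [hD]
  simp

theorem whitneyForm_d_one_apply (c : M.Flag 1 → ℝ) (u : M.Flag 2)
    {x : Fin 2 → ℝ} (hx : x ∈ refSimplex 2) (v : Fin 2 → Fin 2 → ℝ) :
    (whitneyForm c).d 2 u x v = 2 * ∑ i : Fin 3, c (u.facet i) *
      (refBaryDeriv (i.succAbove 0) (v 0) * refBaryDeriv (i.succAbove 1) (v 1) -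
        refBaryDeriv (i.succAbove 1) (v 0) * refBaryDeriv (i.succAbove 0) (v 1)) := by
  have hd : Differentiable ℝ (whitneyForm c 2 u) :=
    ((mem_smoothForms.1 (whitneyForm_mem_smoothForms c)).2 2 u).differentiable (by norm_num)
  rw [whitneyForm_d_eq c u hx, extDeriv_apply (hd x), Fin.sum_univ_two]
  simp only [whitneyForm_one_apply]
  have hD : ∀ y : Fin 2 → ℝ, _ := fun y => (HasFDerivAt.fun_sum (u := Finset.univ)
    fun (i : Fin 3) _ => (((hasFDerivAt_refBary (i.succAbove (0 : Fin 2)) x).mul_const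
      (refBaryDeriv (i.succAbove (1 : Fin 2)) y)).fun_sub
      ((hasFDerivAt_refBary (i.succAbove (1 : Fin 2)) x).mul_const
      (refBaryDeriv (i.succAbove (0 : Fin 2)) y))).const_mul (c (u.facet i))).fderiv
  have r0 : Fin.removeNth (0 : Fin 2) v (0 : Fin 1) = v 1 := rfl
  have r1 : Fin.removeNth (1 : Fin 2) v (0 : Fin 1) = v 0 := rfl
  rw [r0, r1, hD, hD]
  simp only [Fin.sum_univ_three]
  simp
  ring

/-- The exterior derivative of a Whitney `0`-form. -/
theorem whitneyForm_d_zero (c : M.Flag 0 → ℝ) :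
    (whitneyForm c).d.Agree (whitneyForm fun w : M.Flag 1 =>
      ∑ i : Fin 2, (-1) ^ (i : ℕ) * c (w.facet i)) := by
  intro m u x hx
  have hm := u.le_two
  obtain rfl | rfl | rfl : m = 0 ∨ m = 1 ∨ m = 2 := by omega
  · rw [ContinuousAlternatingMap.eq_zero_of_lt Nat.zero_lt_one (Form.d _ _ _ _),
      ContinuousAlternatingMap.eq_zero_of_lt Nat.zero_lt_one (whitneyForm _ _ _ _)]
  · refine ContinuousAlternatingMap.ext fun v : Fin 1 → Fin 1 → ℝ => ?_
    rw [whitneyForm_d_zero_apply _ _ hx, whitneyForm_apply_self, whitney_one_apply]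
    have e0 : u.facet 0 = u.node 1 := Flag.ext_zero rfl
    have e1 : u.facet 1 = u.node 0 := Flag.ext_zero rfl
    rw [nodeBary_apply, nodeBary_apply, nodeBaryDeriv_apply, nodeBaryDeriv_apply,
      Fin.sum_univ_two, Fin.sum_univ_two, (refBary_one x).1, (refBary_one x).2,
      (refBaryDeriv_one (v 0)).1, (refBaryDeriv_one (v 0)).2, e0, e1]
    simp
    ring
  · refine ContinuousAlternatingMap.ext fun v : Fin 1 → Fin 2 → ℝ => ?_
    rw [whitneyForm_d_zero_apply _ _ hx, whitneyForm_one_apply]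
    have h1 : (1 : Fin 3).succAbove (0 : Fin 2) = 0 := rfl
    have h2 : (1 : Fin 3).succAbove (1 : Fin 2) = 2 := rfl
    have h3 : (2 : Fin 3).succAbove (0 : Fin 2) = 0 := rfl
    have h4 : (2 : Fin 3).succAbove (1 : Fin 2) = 1 := rfl
    have h5 : (0 : Fin 3).succAbove (0 : Fin 2) = 1 := rfl
    have h6 : (0 : Fin 3).succAbove (1 : Fin 2) = 2 := rfl
    have e0 : (u.facet 0).facet 0 = u.node 2 := Flag.ext_zero rfl
    have e1 : (u.facet 0).facet 1 = u.node 1 := Flag.ext_zero rfl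
    have e2 : (u.facet 1).facet 0 = u.node 2 := Flag.ext_zero rfl
    have e3 : (u.facet 1).facet 1 = u.node 0 := Flag.ext_zero rfl
    have e4 : (u.facet 2).facet 0 = u.node 1 := Flag.ext_zero rfl
    have e5 : (u.facet 2).facet 1 = u.node 0 := Flag.ext_zero rfl
    obtain ⟨b0, b1, b2⟩ := refBary_two x
    obtain ⟨d0, d1, d2⟩ := refBaryDeriv_two (v 0)
    rw [Fin.sum_univ_three, Fin.sum_univ_three]
    rw [Fin.sum_univ_two, Fin.sum_univ_two, Fin.sum_univ_two, h1, h2, h3, h4, h5, h6, e0, e1, e2,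
      e3, e4, e5, b0, b1, b2, d0, d1, d2]
    simp
    ring

/-- The exterior derivative of a Whitney `1`-form. -/
theorem whitneyForm_d_one (c : M.Flag 1 → ℝ) :
    (whitneyForm c).d.Agree (whitneyForm fun w : M.Flag 2 =>
      ∑ i : Fin 3, (-1) ^ (i : ℕ) * c (w.facet i)) := by
  intro m u x hx
  have hm := u.le_two
  obtain hm | rfl : m < 2 ∨ m = 2 := by omega
  · rw [ContinuousAlternatingMap.eq_zero_of_lt hm (Form.d _ _ _ _),
      ContinuousAlternatingMap.eq_zero_of_lt hm (whitneyForm _ _ _ _)]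
  refine ContinuousAlternatingMap.ext fun v : Fin 2 → Fin 2 → ℝ => ?_
  rw [whitneyForm_d_one_apply _ _ hx, whitneyForm_apply_self, whitney_two_apply]
  have h1 : (1 : Fin 3).succAbove (0 : Fin 2) = 0 := rfl
  have h2 : (1 : Fin 3).succAbove (1 : Fin 2) = 2 := rfl
  have h3 : (2 : Fin 3).succAbove (0 : Fin 2) = 0 := rfl
  have h4 : (2 : Fin 3).succAbove (1 : Fin 2) = 1 := rfl
  have h5 : (0 : Fin 3).succAbove (0 : Fin 2) = 1 := rfl
  have h6 : (0 : Fin 3).succAbove (1 : Fin 2) = 2 := rfl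
  obtain ⟨b0, b1, b2⟩ := refBary_two x
  obtain ⟨d0, d1, d2⟩ := refBaryDeriv_two (v 0)
  obtain ⟨d0', d1', d2'⟩ := refBaryDeriv_two (v 1)
  rw [Fin.sum_univ_three, Fin.sum_univ_three, h1, h2, h3, h4, h5, h6]
  rw [nodeBary_apply, nodeBary_apply, nodeBary_apply, nodeBaryDeriv_apply, nodeBaryDeriv_apply,
    nodeBaryDeriv_apply, b0, b1, b2, d0, d1, d2, d0', d1', d2']
  simp
  ring

end ClosedSurfaceMesh

/-! ## Integration over the reference simplices -/

theorem interior_refSimplex_ae_eq (m : ℕ) :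
    interior (refSimplex m) =ᵐ[volume] refSimplex m :=
  interior_ae_eq_of_null_frontier ((convex_refSimplex m).addHaar_frontier volume)

theorem integral_refSimplex_zero (h : (Fin 0 → ℝ) → ℝ) : ∫ x in refSimplex 0, h x = h default := by
  have : refSimplex 0 = Set.univ := Set.eq_univ_of_forall fun x => ⟨fun i => i.elim0, by simp⟩
  rw [this, Measure.restrict_univ, volume_pi, Measure.pi_of_empty (x := default)]
  exact integral_dirac _ _

theorem preimage_refSimplex_one :
    (MeasurableEquiv.funUnique (Fin 1) ℝ).symm ⁻¹' refSimplex 1 = Set.Icc 0 1 := by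
  ext x
  change ((∀ i : Fin 1, 0 ≤ x) ∧ ∑ i : Fin 1, x ≤ 1) ↔ _
  simp

theorem integral_refSimplex_one (h : (Fin 1 → ℝ) → ℝ) :
    ∫ x in refSimplex 1, h x = ∫ x in (0 : ℝ)..1, h fun _ => x := by
  rw [intervalIntegral.integral_of_le zero_le_one, ← integral_Icc_eq_integral_Ioc,
    ← preimage_refSimplex_one]
  exact ((volume_preserving_funUnique (Fin 1) ℝ).symm.setIntegral_preimage_emb
    (MeasurableEquiv.measurableEmbedding _) h (refSimplex 1)).symm

theorem integrableOn_refSimplex_one {h : (Fin 1 → ℝ) → ℝ} (hi : IntegrableOn h (refSimplex 1)) :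
    IntervalIntegrable (fun x => h fun _ => x) volume 0 1 := by
  rw [intervalIntegrable_iff_integrableOn_Icc_of_le zero_le_one, ← preimage_refSimplex_one]
  exact ((volume_preserving_funUnique (Fin 1) ℝ).symm.integrableOn_comp_preimage
    (MeasurableEquiv.measurableEmbedding _)).2 hi

/-- The parametrization of the reference triangle by the unit square. -/
def duffy (p : ℝ × ℝ) : ℝ × ℝ := (p.1, p.2 * (1 - p.1))

/-- The derivative of `duffy`. -/
def duffyDeriv (p : ℝ × ℝ) : ℝ × ℝ →L[ℝ] ℝ × ℝ :=
  (Matrix.toLin (.finTwoProd ℝ) (.finTwoProd ℝ) !![1, 0; -p.2, 1 - p.1]).toContinuousLinearMap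

theorem hasFDerivAt_duffy (p : ℝ × ℝ) : HasFDerivAt duffy (duffyDeriv p) p := by
  unfold duffyDeriv
  rw [Matrix.toLin_finTwoProd_toContinuousLinearMap]
  have h := HasFDerivAt.prodMk (𝕜 := ℝ) (hasFDerivAt_fst (p := p))
    (hasFDerivAt_snd.mul (hasFDerivAt_fst.const_sub (1 : ℝ)))
  convert! h using 2
  · simp
  · ext <;> simp

theorem det_duffyDeriv (p : ℝ × ℝ) : (duffyDeriv p).det = 1 - p.1 := by
  unfold duffyDeriv
  simp only [LinearMap.det_toContinuousLinearMap, LinearMap.det_toLin, Matrix.det_fin_two_of]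
  ring

/-- The side of the square with first coordinate `1` collapses to the vertex `(1, 0)`. Removing both
makes the map a bijection and changes only null sets. -/
theorem duffy_image : duffy '' (Set.Ico 0 1 ×ˢ Set.Icc 0 1) =
    (MeasurableEquiv.finTwoArrow (α := ℝ)).symm ⁻¹' refSimplex 2 \ {(1, 0)} := by
  ext ⟨a, b⟩
  have hT : (a, b) ∈ (MeasurableEquiv.finTwoArrow (α := ℝ)).symm ⁻¹' refSimplex 2 ↔
      (0 ≤ a ∧ 0 ≤ b) ∧ a + b ≤ 1 := by
    change ((∀ i : Fin 2, 0 ≤ (![a, b] : Fin 2 → ℝ) i) ∧ ∑ i, (![a, b] : Fin 2 → ℝ) i ≤ 1) ↔ _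
    simp [Fin.forall_fin_two]
  rw [Set.mem_sdiff, hT, Set.mem_singleton_iff]
  constructor
  · rintro ⟨⟨s, t⟩, ⟨⟨hs0, hs1⟩, ht0, ht1⟩, h⟩
    simp only [duffy, Prod.mk.injEq] at h hs0 hs1 ht0 ht1 ⊢
    obtain ⟨rfl, rfl⟩ := h
    have : 0 < 1 - s := by linarith
    refine ⟨⟨⟨hs0, by positivity⟩, by nlinarith⟩, fun h => hs1.ne h.1⟩
  · rintro ⟨⟨⟨ha, hb⟩, hab⟩, hne⟩
    have ha1 : a < 1 := by
      refine lt_of_le_of_ne (by linarith) fun h => hne ?_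
      rw [Prod.mk.injEq]
      exact ⟨h, by linarith⟩
    have h1 : 0 < 1 - a := by linarith
    refine ⟨(a, b / (1 - a)), ⟨⟨ha, ha1⟩, by positivity, ?_⟩, ?_⟩
    · rw [div_le_one h1]
      linarith
    · simp only [duffy, Prod.mk.injEq, true_and]
      field_simp

theorem duffy_injOn : Set.InjOn duffy (Set.Ico 0 1 ×ˢ Set.Icc 0 1) := by
  rintro ⟨s, t⟩ ⟨⟨hs0, hs1⟩, -⟩ ⟨s', t'⟩ - h
  simp only [duffy, Prod.mk.injEq] at h hs1 ⊢
  obtain ⟨rfl, h⟩ := h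
  exact ⟨rfl, mul_right_cancel₀ (by linarith) h⟩

theorem square_ae_eq : (Set.Ico 0 1 ×ˢ Set.Icc 0 1 : Set (ℝ × ℝ)) =ᵐ[volume] Set.Icc 0 1 := by
  have : (Set.Icc 0 1 : Set (ℝ × ℝ)) = Set.Icc 0 1 ×ˢ Set.Icc 0 1 := Set.Icc_prod_eq _ _
  rw [this]
  exact Measure.set_prod_ae_eq Ico_ae_eq_Icc Filter.EventuallyEq.rfl

theorem open_square_ae_eq :
    (Set.Ioo 0 1 ×ˢ Set.Ioo 0 1 : Set (ℝ × ℝ)) =ᵐ[volume] Set.Icc 0 1 := by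
  have : (Set.Icc 0 1 : Set (ℝ × ℝ)) = Set.Icc 0 1 ×ˢ Set.Icc 0 1 := Set.Icc_prod_eq _ _
  rw [this]
  exact Measure.set_prod_ae_eq Ioo_ae_eq_Icc Ioo_ae_eq_Icc

theorem triangle_ae_eq : ((MeasurableEquiv.finTwoArrow (α := ℝ)).symm ⁻¹' refSimplex 2 \ {(1, 0)} :
    Set (ℝ × ℝ)) =ᵐ[volume] (MeasurableEquiv.finTwoArrow (α := ℝ)).symm ⁻¹' refSimplex 2 :=
  sdiff_null_ae_eq_self (measure_singleton _)

/-- `duffy` with values in the reference triangle. -/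
def duffyMap (p : ℝ × ℝ) : Fin 2 → ℝ := ![p.1, p.2 * (1 - p.1)]

theorem integral_refSimplex_two (h : (Fin 2 → ℝ) → ℝ) :
    ∫ x in refSimplex 2, h x = ∫ p in Set.Icc (0 : ℝ × ℝ) 1, (1 - p.1) * h (duffyMap p) := by
  rw [← (volume_preserving_finTwoArrow ℝ).symm.setIntegral_preimage_emb
    (MeasurableEquiv.measurableEmbedding _) h (refSimplex 2), ← setIntegral_congr_set triangle_ae_eq,
    ← duffy_image, integral_image_eq_integral_abs_det_fderiv_smul volume
      (measurableSet_Ico.prod measurableSet_Icc)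
      (fun p _ => (hasFDerivAt_duffy p).hasFDerivWithinAt) duffy_injOn,
    ← setIntegral_congr_set square_ae_eq]
  refine setIntegral_congr_fun (measurableSet_Ico.prod measurableSet_Icc) fun p hp => ?_
  simp only [det_duffyDeriv, smul_eq_mul]
  rw [abs_of_nonneg (by linarith [hp.1.2])]
  rfl

theorem integrableOn_refSimplex_two {h : (Fin 2 → ℝ) → ℝ} (hi : IntegrableOn h (refSimplex 2)) :
    IntegrableOn (fun p => (1 - p.1) * h (duffyMap p)) (Set.Icc (0 : ℝ × ℝ) 1) := by
  rw [← (volume_preserving_finTwoArrow ℝ).symm.integrableOn_comp_preimage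
    (MeasurableEquiv.measurableEmbedding _), ← integrableOn_congr_set_ae triangle_ae_eq,
    ← duffy_image, integrableOn_image_iff_integrableOn_abs_det_fderiv_smul volume
      (measurableSet_Ico.prod measurableSet_Icc)
      (fun p _ => (hasFDerivAt_duffy p).hasFDerivWithinAt) duffy_injOn] at hi
  rw [← integrableOn_congr_set_ae square_ae_eq]
  refine hi.congr_fun (fun p hp => ?_) (measurableSet_Ico.prod measurableSet_Icc)
  simp only [det_duffyDeriv, smul_eq_mul]
  rw [abs_of_nonneg (by linarith [hp.1.2])]
  rfl

theorem duffyMap_mem {p : ℝ × ℝ} (hp : p ∈ Set.Icc (0 : ℝ × ℝ) 1) : duffyMap p ∈ refSimplex 2 := by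
  obtain ⟨⟨h1, h2⟩, h3, h4⟩ := hp
  simp only [Prod.fst_zero, Prod.snd_zero, Prod.fst_one, Prod.snd_one] at h1 h2 h3 h4
  refine ⟨fun i => ?_, ?_⟩
  · fin_cases i
    · exact h1
    · exact mul_nonneg h2 (by linarith)
  · simp only [duffyMap, Fin.sum_univ_two, Matrix.cons_val_zero, Matrix.cons_val_one]
    nlinarith

theorem duffyMap_mem_interior {p : ℝ × ℝ} (hp : p ∈ Set.Ioo (0 : ℝ) 1 ×ˢ Set.Ioo (0 : ℝ) 1) :
    duffyMap p ∈ interior (refSimplex 2) := by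
  obtain ⟨⟨h1, h2⟩, h3, h4⟩ := hp
  refine subset_interior_refSimplex 2 ⟨fun i => ?_, ?_⟩
  · fin_cases i
    · exact h1
    · exact mul_pos h3 (by linarith)
  · simp only [duffyMap, Fin.sum_univ_two, Matrix.cons_val_zero, Matrix.cons_val_one]
    nlinarith

theorem hasFDerivAt_duffyMap (p : ℝ × ℝ) : HasFDerivAt duffyMap
    (ContinuousLinearMap.pi ![ContinuousLinearMap.fst ℝ ℝ ℝ,
      p.2 • -ContinuousLinearMap.fst ℝ ℝ ℝ + (1 - p.1) • ContinuousLinearMap.snd ℝ ℝ ℝ]) p := by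
  rw [hasFDerivAt_pi']
  intro i
  fin_cases i
  · exact hasFDerivAt_fst
  · exact hasFDerivAt_snd.mul (hasFDerivAt_fst.const_sub (1 : ℝ))

theorem continuous_duffyMap : Continuous duffyMap :=
  continuous_iff_continuousAt.2 fun p => (hasFDerivAt_duffyMap p).continuousAt

/-- Green's theorem on the reference triangle. -/
theorem integral_curl_refSimplex {b₀ b₁ : (Fin 2 → ℝ) → ℝ} (hc₀ : ContinuousOn b₀ (refSimplex 2))
    (hc₁ : ContinuousOn b₁ (refSimplex 2))
    (hd₀ : DifferentiableOn ℝ b₀ (interior (refSimplex 2)))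
    (hd₁ : DifferentiableOn ℝ b₁ (interior (refSimplex 2)))
    (hi : IntegrableOn (fun x => fderiv ℝ b₁ x (Pi.single 0 1) - fderiv ℝ b₀ x (Pi.single 1 1))
      (refSimplex 2)) :
    ∫ x in refSimplex 2, (fderiv ℝ b₁ x (Pi.single 0 1) - fderiv ℝ b₀ x (Pi.single 1 1)) =
      (∫ y in (0 : ℝ)..1, (b₁ ![1 - y, y] - b₀ ![1 - y, y])) - (∫ y in (0 : ℝ)..1, b₁ ![0, y]) +
        ∫ x in (0 : ℝ)..1, b₀ ![x, 0] := by
  -- The pullback of `b₀ dx + b₁ dy` by `duffyMap` is `f dt - g ds` for `p = (s, t)`. Its curl is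
  -- the divergence of `(f, g)`, so Green's theorem becomes the divergence theorem on the square.
  let f : ℝ × ℝ → ℝ := fun p => (1 - p.1) * b₁ (duffyMap p)
  let g : ℝ × ℝ → ℝ := fun p => p.2 * b₁ (duffyMap p) - b₀ (duffyMap p)
  have hcomp : ∀ {b : (Fin 2 → ℝ) → ℝ}, ContinuousOn b (refSimplex 2) →
      ContinuousOn (fun p => b (duffyMap p)) (Set.Icc (0 : ℝ × ℝ) 1) := fun hb =>
    hb.comp continuous_duffyMap.continuousOn fun p hp => duffyMap_mem hp
  have hder : ∀ {b : (Fin 2 → ℝ) → ℝ}, DifferentiableOn ℝ b (interior (refSimplex 2)) →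
      ∀ p ∈ Set.Ioo (0 : ℝ) 1 ×ˢ Set.Ioo (0 : ℝ) 1, HasFDerivAt (fun p => b (duffyMap p))
        ((fderiv ℝ b (duffyMap p)).comp (ContinuousLinearMap.pi ![ContinuousLinearMap.fst ℝ ℝ ℝ,
          p.2 • -ContinuousLinearMap.fst ℝ ℝ ℝ + (1 - p.1) • ContinuousLinearMap.snd ℝ ℝ ℝ])) p :=
    fun hb p hp => ((hb.differentiableAt (isOpen_interior.mem_nhds
      (duffyMap_mem_interior hp))).hasFDerivAt).comp p (hasFDerivAt_duffyMap p)
  have hf : ∀ p ∈ Set.Ioo (0 : ℝ) 1 ×ˢ Set.Ioo (0 : ℝ) 1, HasFDerivAt f _ p := fun p hp =>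
    (hasFDerivAt_fst.const_sub (1 : ℝ)).mul (hder hd₁ p hp)
  have hg : ∀ p ∈ Set.Ioo (0 : ℝ) 1 ×ˢ Set.Ioo (0 : ℝ) 1, HasFDerivAt g _ p := fun p hp =>
    (hasFDerivAt_snd.mul (hder hd₁ p hp)).sub (hder hd₀ p hp)
  have key : ∀ p ∈ Set.Ioo (0 : ℝ) 1 ×ˢ Set.Ioo (0 : ℝ) 1,
      fderiv ℝ f p (1, 0) + fderiv ℝ g p (0, 1) = (1 - p.1) *
        (fderiv ℝ b₁ (duffyMap p) (Pi.single 0 1) - fderiv ℝ b₀ (duffyMap p) (Pi.single 1 1)) := by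
    intro p hp
    have e1 : ContinuousLinearMap.pi ![ContinuousLinearMap.fst ℝ ℝ ℝ,
        p.2 • -ContinuousLinearMap.fst ℝ ℝ ℝ + (1 - p.1) • ContinuousLinearMap.snd ℝ ℝ ℝ]
        ((1, 0) : ℝ × ℝ) = (Pi.single 0 1 : Fin 2 → ℝ) - p.2 • Pi.single 1 1 := by
      funext i
      fin_cases i <;> simp
    have e2 : ContinuousLinearMap.pi ![ContinuousLinearMap.fst ℝ ℝ ℝ,
        p.2 • -ContinuousLinearMap.fst ℝ ℝ ℝ + (1 - p.1) • ContinuousLinearMap.snd ℝ ℝ ℝ]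
        ((0, 1) : ℝ × ℝ) = (1 - p.1) • (Pi.single 1 1 : Fin 2 → ℝ) := by
      funext i
      fin_cases i <;> simp
    rw [(hf p hp).fderiv, (hg p hp).fderiv]
    simp only [add_apply, sub_apply, smul_apply, ContinuousLinearMap.comp_apply, e1, e2,
      map_sub, map_smul, smul_eq_mul, neg_apply]
    simp
    ring
  have hiq := integrableOn_refSimplex_two hi
  -- This form of the theorem asks only for continuity up to the boundary, differentiability inside
  -- and an integrable divergence, which is what regularity supplies.
  have hG := integral_divergence_prod_Icc_of_hasFDerivAt_of_le f g (fderiv ℝ f) (fderiv ℝ g) 0 1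
    zero_le_one ?_ ?_ (fun p hp => (hf p hp).differentiableAt.hasFDerivAt)
    (fun p hp => (hg p hp).differentiableAt.hasFDerivAt) ?_
  · rw [integral_refSimplex_two, ← setIntegral_congr_set open_square_ae_eq]
    rw [← setIntegral_congr_set open_square_ae_eq, setIntegral_congr_fun
      (measurableSet_Ioo.prod measurableSet_Ioo) key] at hG
    rw [hG]
    have i1 : (∫ x in (0 : ℝ)..1, g (x, 1)) =
        ∫ y in (0 : ℝ)..1, (b₁ ![1 - y, y] - b₀ ![1 - y, y]) := by
      have := intervalIntegral.integral_comp_sub_left (a := 0) (b := 1)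
        (fun y : ℝ => b₁ ![1 - y, y] - b₀ ![1 - y, y]) 1
      rw [sub_self, sub_zero] at this
      rw [← this]
      refine intervalIntegral.integral_congr fun x _ => ?_
      simp [g, duffyMap]
    have i2 : (∫ x in (0 : ℝ)..1, g (x, 0)) = -∫ x in (0 : ℝ)..1, b₀ ![x, 0] := by
      rw [← intervalIntegral.integral_neg]
      refine intervalIntegral.integral_congr fun x _ => ?_
      simp [g, duffyMap]
    -- The collapsed side contributes nothing.
    have i3 : (∫ y in (0 : ℝ)..1, f (1, y)) = 0 := by simp [f]
    have i4 : (∫ y in (0 : ℝ)..1, f (0, y)) = ∫ y in (0 : ℝ)..1, b₁ ![0, y] := by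
      simp [f, duffyMap]
    simp only [Prod.fst_zero, Prod.snd_zero, Prod.fst_one, Prod.snd_one]
    rw [i1, i2, i3, i4]
    ring
  · exact (by fun_prop : Continuous fun p : ℝ × ℝ => 1 - p.1).continuousOn.mul (hcomp hc₁)
  · exact (continuous_snd.continuousOn.mul (hcomp hc₁)).sub (hcomp hc₀)
  · rw [← integrableOn_congr_set_ae open_square_ae_eq] at hiq ⊢
    exact hiq.congr_fun (fun p hp => (key p hp).symm) (measurableSet_Ioo.prod measurableSet_Ioo)

theorem integral_refSimplex_two_one : ∫ _ in refSimplex 2, (1 : ℝ) = 1 / 2 := by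
  have h1 : Continuous fun p : ℝ × ℝ => (1 - p.1) * 1 := by fun_prop
  rw [integral_refSimplex_two]
  have : (Set.Icc 0 1 : Set (ℝ × ℝ)) = Set.Icc 0 1 ×ˢ Set.Icc 0 1 := Set.Icc_prod_eq _ _
  rw [this, Measure.volume_eq_prod, setIntegral_prod _ (h1.continuousOn.integrableOn_compact
    (isCompact_Icc.prod isCompact_Icc))]
  simp only [mul_one, setIntegral_const, Real.volume_real_Icc, integral_Icc_eq_integral_Ioc,
    ← intervalIntegral.integral_of_le (zero_le_one (α := ℝ))]
  simp
  rw [intervalIntegral.integral_sub intervalIntegrable_const intervalIntegral.intervalIntegrable_id,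
    intervalIntegral.integral_const, integral_id]
  norm_num

namespace ClosedSurfaceMesh

variable {M : ClosedSurfaceMesh}

/-! ## Integrals of Whitney forms -/

theorem integral_refSimplex_const {q : ℕ} (hq : q ≤ 2) (a : ℝ) :
    ∫ _ in refSimplex q, (q.factorial : ℝ) * a = a := by
  obtain rfl | rfl | rfl : q = 0 ∨ q = 1 ∨ q = 2 := by omega
  · rw [integral_refSimplex_zero]
    simp
  · rw [integral_refSimplex_one]
    simp
  · have h : ∀ x : Fin 2 → ℝ, ((2 : ℕ).factorial : ℝ) * a = 2 * a * 1 := fun _ => by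
      simp [Nat.factorial]
    rw [integral_congr_ae (Filter.Eventually.of_forall h), integral_const_mul,
      integral_refSimplex_two_one]
    ring

/-- The barycentric coordinates sum to one, so the density is constant; it is the inverse of the
volume `1 / q!` of the reference simplex. -/
theorem whitney_density_self {q : ℕ} (hq : q ≤ 2) (u : M.Flag q) (x : Fin q → ℝ) :
    (whitney u).density u x = q.factorial := by
  obtain rfl | rfl | rfl : q = 0 ∨ q = 1 ∨ q = 2 := by omega
  · rw [Form.density, whitney_zero_apply, nodeBary_apply]
    simp [refBary]
  · rw [Form.density, whitney_one_apply, nodeBary_apply, nodeBary_apply, nodeBaryDeriv_apply,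
      nodeBaryDeriv_apply, (refBary_one x).1, (refBary_one x).2, (refBaryDeriv_one _).1,
      (refBaryDeriv_one _).2]
    simp
  · rw [Form.density, whitney_two_apply, nodeBary_apply, nodeBary_apply, nodeBary_apply,
      nodeBaryDeriv_apply, nodeBaryDeriv_apply, nodeBaryDeriv_apply, (refBary_two x).1,
      (refBary_two x).2.1, (refBary_two x).2.2, (refBaryDeriv_two _).1, (refBaryDeriv_two _).2.1,
      (refBaryDeriv_two _).2.2, (refBaryDeriv_two _).1, (refBaryDeriv_two _).2.1,
      (refBaryDeriv_two _).2.2]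
    simp [Nat.factorial]
    ring

theorem cellIntegral_whitneyForm {q : ℕ} (c : M.Flag q → ℝ) (u : M.Flag q) :
    (whitneyForm c).cellIntegral u = c u := by
  have hq := u.le_two
  have h : ∀ x, (whitneyForm c).density u x = q.factorial * c u := fun x => by
    rw [Form.density, whitneyForm_apply_self, mul_comm]
    exact congrArg (· * c u) (whitney_density_self hq u x)
  rw [Form.cellIntegral, integral_congr_ae (Filter.Eventually.of_forall h),
    integral_refSimplex_const hq]

/-! ## Stokes' theorem on the cells of the refinement -/

theorem Form.IsConforming.density_facet {q : ℕ} {β : M.Form q} (hβ : β.IsConforming)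
    (z : M.Flag (q + 1)) (i : Fin (q + 2)) {x : Fin q → ℝ} (hx : x ∈ refSimplex q) :
    β.density (z.facet i) x = β (q + 1) z (refFaceMap i.succAbove x)
      (fun j => refFaceDeriv i.succAbove (Pi.single j 1)) := by
  rw [Form.density, Flag.facet, hβ q (q + 1) z (Fin.succAboveOrderEmb i) x hx]
  rfl

theorem Form.IsRegular.differentiableAt {k m : ℕ} {β : M.Form k} (hβ : β.IsRegular) (w : M.Flag m)
    {x : Fin m → ℝ} (hx : x ∈ interior (refSimplex m)) : DifferentiableAt ℝ (β m w) x :=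
  (hβ.differentiableOn m w).differentiableAt (isOpen_interior.mem_nhds hx)

/-- In the interior the derivative within the simplex is the ordinary one. Nothing is claimed on the
boundary, which is a null set for the integrals. -/
theorem Form.IsRegular.density_d {k : ℕ} {β : M.Form k} (hβ : β.IsRegular) (w : M.Flag (k + 1))
    {x : Fin (k + 1) → ℝ} (hx : x ∈ interior (refSimplex (k + 1))) :
    β.d.density w x = ∑ i : Fin (k + 1), (-1) ^ i.val * fderiv ℝ (fun y => β (k + 1) w y
      (Fin.removeNth (α := fun _ => Fin (k + 1) → ℝ) i fun j => Pi.single j 1)) x (Pi.single i 1) := by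
  have h : β.d (k + 1) w x = extDeriv (β (k + 1) w) x := by
    simp only [Form.d, extDerivWithin, extDeriv]
    rw [fderivWithin_of_mem_nhds (mem_interior_iff_mem_nhds.1 hx)]
  rw [Form.density, h, extDeriv_apply (hβ.differentiableAt w hx)]
  simp

/-- The fundamental theorem of calculus in the chart; conformity identifies the end values with
those at the nodes. -/
theorem Form.IsRegular.cellIntegral_d_zero {β : M.Form 0} (hβ : β.IsRegular) (w : M.Flag 1) :
    β.d.cellIntegral w = ∑ i : Fin 2, (-1) ^ (i : ℕ) * β.cellIntegral (w.facet i) := by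
  let b : (Fin 1 → ℝ) → ℝ := fun x => β 1 w x Fin.elim0
  have hint : ∀ x : ℝ, x ∈ Set.Ioo (0 : ℝ) 1 → (fun _ => x : Fin 1 → ℝ) ∈ interior (refSimplex 1) :=
    fun x hx => subset_interior_refSimplex 1 ⟨fun _ => hx.1, by simpa using hx.2⟩
  have hmem : ∀ x : ℝ, x ∈ Set.Icc (0 : ℝ) 1 → (fun _ => x : Fin 1 → ℝ) ∈ refSimplex 1 :=
    fun x hx => ⟨fun _ => hx.1, by simpa using hx.2⟩
  have hF : ∀ i : Fin 2, β.cellIntegral (w.facet i) = b (refVertex (i.succAbove 0)) := by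
    intro i
    rw [Form.cellIntegral, integral_refSimplex_zero, hβ.conforming.density_facet w i
      ⟨fun j => j.elim0, by simp⟩]
    simp only [b]
    congr 1
    · congr 1
      simp [refFaceMap, refBary]
    · exact Subsingleton.elim _ _
  have hd : ∀ x : ℝ, x ∈ Set.Ioo (0 : ℝ) 1 → HasDerivAt (fun x : ℝ => b fun _ => x)
      (β.d.density w fun _ => x) x := by
    intro x hx
    have h1 : HasFDerivAt b (fderiv ℝ b fun _ => x) (fun _ => x) :=
      ((hβ.differentiableAt w (hint x hx)).continuousAlternatingMap_apply_const _).hasFDerivAt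
    have h2 : HasDerivAt (fun x : ℝ => (fun _ => x : Fin 1 → ℝ)) (fun _ => 1) x :=
      hasDerivAt_pi.2 fun _ => hasDerivAt_id x
    have h3 := h1.comp_hasDerivAt x h2
    rw [hβ.density_d w (hint x hx), Fin.sum_univ_one]
    convert! h3 using 1
    have e : (Pi.single 0 1 : Fin 1 → ℝ) = fun _ => 1 := by
      funext i
      fin_cases i
      simp
    simp only [Fin.val_zero, pow_zero, one_mul, e, b]
    congr 3
    funext y
    congr 1
    exact Subsingleton.elim _ _
  have hc : ContinuousOn (fun x : ℝ => b fun _ => x) (Set.Icc 0 1) := by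
    have h1 : ContinuousOn b (refSimplex 1) :=
      ((ContinuousAlternatingMap.apply ℝ (Fin 1 → ℝ) ℝ (Fin.elim0 : Fin 0 → Fin 1 → ℝ)).continuous).comp_continuousOn
        (hβ.continuousOn 1 w)
    exact h1.comp (by fun_prop) hmem
  rw [Form.cellIntegral, integral_refSimplex_one,
    intervalIntegral.integral_eq_sub_of_hasDerivAt_of_le zero_le_one hc hd
      (integrableOn_refSimplex_one (hβ.integrable_d w)), Fin.sum_univ_two, hF, hF]
  have e0 : (refVertex ((0 : Fin 2).succAbove (0 : Fin 1)) : Fin 1 → ℝ) = fun _ => 1 := by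
    funext i
    fin_cases i
    change (Pi.single 0 1 : Fin 1 → ℝ) 0 = 1
    simp
  have e1 : (refVertex ((1 : Fin 2).succAbove (0 : Fin 1)) : Fin 1 → ℝ) = fun _ => 0 := rfl
  rw [e0, e1]
  simp
  ring

theorem ContinuousAlternatingMap.apply_const_sub {E : Type*} [AddCommGroup E] [Module ℝ E]
    [TopologicalSpace E] (φ : E [⋀^Fin 1]→L[ℝ] ℝ) (a b : E) :
    φ (fun _ => a - b) = φ (fun _ => a) - φ fun _ => b := by
  have h : ∀ x y : E, Function.update (fun _ : Fin 1 => x) 0 y = fun _ => y := fun x y => by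
    funext i
    fin_cases i
    simp
  have := φ.toAlternatingMap.map_update_sub (fun _ => a) 0 a b
  rw [h, h, h] at this
  exact this

theorem refFaceMap_one {m : ℕ} (ι : Fin 2 → Fin (m + 1)) (y : ℝ) :
    refFaceMap ι (fun _ : Fin 1 => y) = (1 - y) • refVertex (ι 0) + y • refVertex (ι 1) := by
  rw [refFaceMap, Fin.sum_univ_two, (refBary_one _).1, (refBary_one _).2]

theorem refFaceDeriv_one {m : ℕ} (ι : Fin 2 → Fin (m + 1)) :
    refFaceDeriv ι (Pi.single (0 : Fin 1) 1) = refVertex (ι 1) - refVertex (ι 0) := by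
  rw [refFaceDeriv, _root_.sum_apply, Fin.sum_univ_two]
  simp only [ContinuousLinearMap.smulRight_apply]
  rw [(refBaryDeriv_one _).1, (refBaryDeriv_one _).2]
  simp
  abel

/-- Green's theorem in the chart gives three integrals over the sides; conformity of the traces
turns them into the cell integrals over the facets. -/
theorem Form.IsRegular.cellIntegral_d_one {β : M.Form 1} (hβ : β.IsRegular) (z : M.Flag 2) :
    β.d.cellIntegral z = ∑ i : Fin 3, (-1) ^ (i : ℕ) * β.cellIntegral (z.facet i) := by
  let b : Fin 2 → (Fin 2 → ℝ) → ℝ := fun j x => β 2 z x fun _ => Pi.single j 1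
  have hc : ∀ j, ContinuousOn (b j) (refSimplex 2) := fun j =>
    (ContinuousAlternatingMap.apply ℝ (Fin 2 → ℝ) ℝ
      (fun _ : Fin 1 => (Pi.single j 1 : Fin 2 → ℝ))).continuous.comp_continuousOn
        (hβ.continuousOn 2 z)
  have hd : ∀ j, DifferentiableOn ℝ (b j) (interior (refSimplex 2)) := fun j x hx =>
    ((hβ.differentiableAt z hx).continuousAlternatingMap_apply_const _).differentiableWithinAt
  have hcurl : ∀ x ∈ interior (refSimplex 2), β.d.density z x =
      fderiv ℝ (b 1) x (Pi.single 0 1) - fderiv ℝ (b 0) x (Pi.single 1 1) := by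
    intro x hx
    rw [hβ.density_d z hx, Fin.sum_univ_two]
    have r0 : (Fin.removeNth (0 : Fin 2) fun j : Fin 2 => (Pi.single j 1 : Fin 2 → ℝ)) =
        fun _ => Pi.single 1 1 := by
      funext i
      fin_cases i
      rfl
    have r1 : (Fin.removeNth (1 : Fin 2) fun j : Fin 2 => (Pi.single j 1 : Fin 2 → ℝ)) =
        fun _ => Pi.single 0 1 := by
      funext i
      fin_cases i
      rfl
    rw [r0, r1]
    simp only [b, Fin.val_zero, Fin.val_one, pow_zero, pow_one]
    ring
  have hae := interior_refSimplex_ae_eq 2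
  have hi : IntegrableOn (fun x => fderiv ℝ (b 1) x (Pi.single 0 1) -
      fderiv ℝ (b 0) x (Pi.single 1 1)) (refSimplex 2) := by
    have := hβ.integrable_d z
    rw [← integrableOn_congr_set_ae hae] at this ⊢
    exact this.congr_fun hcurl isOpen_interior.measurableSet
  have hG := integral_curl_refSimplex (hc 0) (hc 1) (hd 0) (hd 1) hi
  rw [Form.cellIntegral, ← setIntegral_congr_set hae,
    setIntegral_congr_fun isOpen_interior.measurableSet hcurl, setIntegral_congr_set hae, hG]
  have hF : ∀ i : Fin 3, β.cellIntegral (z.facet i) = ∫ y in (0 : ℝ)..1, β 2 z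
      ((1 - y) • refVertex (i.succAbove 0) + y • refVertex (i.succAbove 1))
      (fun _ => refVertex (i.succAbove 1) - refVertex (i.succAbove 0)) := by
    intro i
    rw [Form.cellIntegral, integral_refSimplex_one]
    refine intervalIntegral.integral_congr fun y hy => ?_
    rw [Set.uIcc_of_le zero_le_one] at hy
    change β.density (z.facet i) (fun _ => y) = _
    rw [hβ.conforming.density_facet z i ⟨fun _ => hy.1, by simpa using hy.2⟩]
    have e : (fun j : Fin 1 => refFaceDeriv i.succAbove (Pi.single j 1)) =
        fun _ => (refVertex (i.succAbove 1) - refVertex (i.succAbove 0) : Fin 2 → ℝ) := by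
      funext j
      fin_cases j
      exact refFaceDeriv_one _
    rw [e, refFaceMap_one]
  have v0 : (refVertex (0 : Fin 3) : Fin 2 → ℝ) = 0 := rfl
  have v1 : (refVertex (1 : Fin 3) : Fin 2 → ℝ) = Pi.single 0 1 := rfl
  have v2 : (refVertex (2 : Fin 3) : Fin 2 → ℝ) = Pi.single 1 1 := rfl
  have f0 : β.cellIntegral (z.facet 0) =
      ∫ y in (0 : ℝ)..1, (b 1 ![1 - y, y] - b 0 ![1 - y, y]) := by
    rw [hF]
    refine intervalIntegral.integral_congr fun y _ => ?_
    change β 2 z ((1 - y) • refVertex (1 : Fin 3) + y • refVertex (2 : Fin 3))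
      (fun _ => refVertex (2 : Fin 3) - refVertex (1 : Fin 3)) = _
    have e : (1 - y) • (Pi.single 0 1 : Fin 2 → ℝ) + y • Pi.single 1 1 = ![1 - y, y] := by
      funext i
      fin_cases i <;> simp
    rw [v1, v2, ContinuousAlternatingMap.apply_const_sub, e]
  have f1 : β.cellIntegral (z.facet 1) = ∫ y in (0 : ℝ)..1, b 1 ![0, y] := by
    rw [hF]
    refine intervalIntegral.integral_congr fun y _ => ?_
    change β 2 z ((1 - y) • refVertex (0 : Fin 3) + y • refVertex (2 : Fin 3))
      (fun _ => refVertex (2 : Fin 3) - refVertex (0 : Fin 3)) = _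
    have e : (1 - y) • (0 : Fin 2 → ℝ) + y • Pi.single 1 1 = ![0, y] := by
      funext i
      fin_cases i <;> simp
    rw [v0, v2, e, sub_zero]
  have f2 : β.cellIntegral (z.facet 2) = ∫ x in (0 : ℝ)..1, b 0 ![x, 0] := by
    rw [hF]
    refine intervalIntegral.integral_congr fun y _ => ?_
    change β 2 z ((1 - y) • refVertex (0 : Fin 3) + y • refVertex (1 : Fin 3))
      (fun _ => refVertex (1 : Fin 3) - refVertex (0 : Fin 3)) = _
    have e : (1 - y) • (0 : Fin 2 → ℝ) + y • Pi.single 0 1 = ![y, 0] := by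
      funext i
      fin_cases i <;> simp
    rw [v0, v1, e, sub_zero]
  rw [Fin.sum_univ_three, f0, f1, f2]
  simp only [Fin.val_zero, Fin.val_one, Fin.val_two, pow_zero, pow_one, one_mul]
  ring

/-! ## The projectors -/

theorem sum_smul_whitneyForm {q : ℕ} {ι : Type*} (s : Finset ι) (a : ι → ℝ)
    (c : ι → M.Flag q → ℝ) :
    ∑ t ∈ s, a t • whitneyForm (c t) = whitneyForm fun w => ∑ t ∈ s, a t * c t w := by
  simp only [whitneyForm, Finset.smul_sum, Finset.sum_smul, smul_smul]
  rw [Finset.sum_comm]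

theorem bcProj_eq (R : M.BCCoeff) {r q : ℕ} (h : r + q = 2) (β : M.Form q) :
    bcProj R h β = whitneyForm fun w => ∑ t, β.dualIntegral h t * R r q h t w :=
  sum_smul_whitneyForm _ _ _

/-- On the cells of `⋆t` itself each product is `1 / n_{⋆t}`, and there are `n_{⋆t}` of them; on any
other dual cell of the same dimension the cochain vanishes. -/
theorem IsBuffaChristiansen.sum_dualCoeff_mul {R : M.BCCoeff} (hR : IsBuffaChristiansen R)
    {r q : ℕ} (h : r + q = 2) (s t : M.Cell r) :
    ∑ w : M.Flag q, (dualCoeff h s w : ℝ) * R r q h t w = if s.1 = t.1 then 1 else 0 := by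
  split_ifs with hst
  · obtain rfl : s = t := Subtype.ext hst
    have hn : (dualCount h s : ℝ) ≠ 0 := by exact_mod_cast (dualCount_pos h s).ne'
    have e : ∀ w : M.Flag q, (dualCoeff h s w : ℝ) * R r q h s w =
        (|dualCoeff h s w| : ℤ) / (dualCount h s : ℝ) := by
      intro w
      by_cases hw : w.1 0 = s.1
      · have ha := abs_dualCoeff h hw
        rw [hR.of_star h hw, ← mul_div_assoc]
        congr 1
        rw [ha]
        rcases (abs_eq zero_le_one).1 ha with e | e <;> simp [e]
      · rw [dualCoeff_eq_zero h hw]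
        simp
    simp only [e]
    rw [← Finset.sum_div, ← Int.cast_sum]
    exact div_self hn
  · refine Finset.sum_eq_zero fun w _ => ?_
    by_cases hw : w.1 0 = s.1
    · rw [hR.eq_zero h fun hs => hst ((subset_iff_eq_of_card (s.2.2.trans t.2.2.symm)).1 (hw ▸ hs)),
        mul_zero]
    · rw [dualCoeff_eq_zero h hw, Int.cast_zero, zero_mul]

theorem exists_eq_whitneyForm {R : M.BCCoeff} {r q : ℕ} {h : r + q = 2} {b : M.Form q}
    (hb : b ∈ bcSpace R h) : ∃ a : M.Cell r → ℝ,
      b = whitneyForm fun w => ∑ t, a t * R r q h t w := by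
  obtain ⟨a, rfl⟩ := (Submodule.mem_span_range_iff_exists_fun ℝ).1 hb
  exact ⟨a, sum_smul_whitneyForm _ _ _⟩

theorem IsBuffaChristiansen.bcProj_eq_self {R : M.BCCoeff} (hR : IsBuffaChristiansen R) {r q : ℕ}
    (h : r + q = 2) {b : M.Form q} (hb : b ∈ bcSpace R h) : bcProj R h b = b := by
  classical
  obtain ⟨a, rfl⟩ := exists_eq_whitneyForm hb
  rw [bcProj_eq]
  congr 1
  funext w
  refine Finset.sum_congr rfl fun s _ => ?_
  congr 1
  simp only [Form.dualIntegral, cellIntegral_whitneyForm, Finset.mul_sum]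
  rw [Finset.sum_comm, Finset.sum_eq_single_of_mem s (Finset.mem_univ _)]
  · have := hR.sum_dualCoeff_mul h s s
    rw [if_pos rfl] at this
    trans a s * ∑ w, (dualCoeff h s w : ℝ) * R r q h s w
    · rw [Finset.mul_sum]
      exact Finset.sum_congr rfl fun _ _ => by ring
    · rw [this, mul_one]
  · intro t _ hne
    have := hR.sum_dualCoeff_mul h s t
    rw [if_neg fun e => hne (Subtype.ext e.symm)] at this
    trans a t * ∑ w, (dualCoeff h s w : ℝ) * R r q h t w
    · rw [Finset.mul_sum]
      exact Finset.sum_congr rfl fun _ _ => by ring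
    · rw [this, mul_zero]

theorem IsBuffaChristiansen.isRegular {R : M.BCCoeff} {r q : ℕ} (h : r + q = 2) {b : M.Form q}
    (hb : b ∈ bcSpace R h) : b.IsRegular := by
  obtain ⟨a, rfl⟩ := exists_eq_whitneyForm hb
  exact isRegular_of_mem_smoothForms (whitneyForm_mem_smoothForms _)

theorem bcProj_mem (R : M.BCCoeff) {r q : ℕ} (h : r + q = 2) (β : M.Form q) :
    bcProj R h β ∈ bcSpace R h :=
  Submodule.sum_mem _ fun t _ => Submodule.smul_mem _ _ (Submodule.subset_span ⟨t, rfl⟩)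

/-- Stokes and the boundary of a dual edge express the integrals of `β.d` by those of `β`, with
`-D_{st}`. `coboundary_zero` produces the same `-D_{st}` from the coefficients, so both sides are
one double sum summed in two orders. -/
theorem IsBuffaChristiansen.bcProj_d_zero {R : M.BCCoeff} (hR : IsBuffaChristiansen R)
    {β : M.Form 0} (hβ : β.IsRegular) :
    (bcProj R (r := 1) (q := 1) rfl β.d).Agree (bcProj R (r := 2) (q := 0) rfl β).d := by
  intro m u x hx
  rw [bcProj_eq, bcProj_eq, whitneyForm_d_zero _ m u hx]
  congr 2
  funext w
  have h1 : ∀ s, β.d.dualIntegral (r := 1) rfl s =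
      -∑ t, (incidence s t : ℝ) * β.dualIntegral (r := 2) rfl t := fun s => by
    simp only [Form.dualIntegral, hβ.cellIntegral_d_zero]
    exact sum_dualCoeff_edge rfl rfl s β.cellIntegral
  have h2 : ∑ i : Fin 2, (-1) ^ (i : ℕ) * ∑ t, β.dualIntegral (r := 2) rfl t *
      R 2 0 rfl t (w.facet i) = ∑ t, β.dualIntegral (r := 2) rfl t *
        ∑ i : Fin 2, (-1) ^ (i : ℕ) * R 2 0 rfl t (w.facet i) := by
    simp only [Finset.mul_sum]
    rw [Finset.sum_comm]
    exact Finset.sum_congr rfl fun _ _ => Finset.sum_congr rfl fun _ _ => by ring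
  rw [h2]
  simp only [h1, hR.coboundary_zero, neg_mul, mul_neg, Finset.sum_neg_distrib, Finset.sum_mul,
    Finset.mul_sum]
  rw [Finset.sum_comm]
  exact congrArg _ (Finset.sum_congr rfl fun _ _ => Finset.sum_congr rfl fun _ _ => by ring)

/-- The same interchange of sums, now with `+D_{st}` both in the boundary of a dual face and in
`coboundary_one`. -/
theorem IsBuffaChristiansen.bcProj_d_one {R : M.BCCoeff} (hR : IsBuffaChristiansen R)
    {β : M.Form 1} (hβ : β.IsRegular) :
    (bcProj R (r := 0) (q := 2) rfl β.d).Agree (bcProj R (r := 1) (q := 1) rfl β).d := by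
  intro m u x hx
  rw [bcProj_eq, bcProj_eq, whitneyForm_d_one _ m u hx]
  congr 2
  funext z
  have h1 : ∀ s, β.d.dualIntegral (r := 0) rfl s =
      ∑ t, (incidence s t : ℝ) * β.dualIntegral (r := 1) rfl t := fun s => by
    simp only [Form.dualIntegral, hβ.cellIntegral_d_one]
    exact sum_dualCoeff_vertex rfl rfl s β.cellIntegral
  have h2 : ∑ i : Fin 3, (-1) ^ (i : ℕ) * ∑ t, β.dualIntegral (r := 1) rfl t *
      R 1 1 rfl t (z.facet i) = ∑ t, β.dualIntegral (r := 1) rfl t *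
        ∑ i : Fin 3, (-1) ^ (i : ℕ) * R 1 1 rfl t (z.facet i) := by
    simp only [Finset.mul_sum]
    rw [Finset.sum_comm]
    exact Finset.sum_congr rfl fun _ _ => Finset.sum_congr rfl fun _ _ => by ring
  rw [h2]
  simp only [h1, hR.coboundary_one, Finset.sum_mul, Finset.mul_sum]
  rw [Finset.sum_comm]
  exact Finset.sum_congr rfl fun _ _ => Finset.sum_congr rfl fun _ _ => by ring

end ClosedSurfaceMesh

end

theorem mainTheorem5 (M : ClosedSurfaceMesh) :
    (∃! R : M.BCCoeff, ClosedSurfaceMesh.IsBuffaChristiansen R) ∧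
    ∀ R : M.BCCoeff, ClosedSurfaceMesh.IsBuffaChristiansen R →
      (∀ (r q : ℕ) (h : r + q = 2),
        (∀ β : M.Form q, ClosedSurfaceMesh.bcProj R h β ∈ ClosedSurfaceMesh.bcSpace R h) ∧
        ∀ b ∈ ClosedSurfaceMesh.bcSpace R h,
          b.IsRegular ∧ ClosedSurfaceMesh.bcProj R h b = b) ∧
      ∀ (r p : ℕ) (h : r + (p + 1) = 2) (h' : (r + 1) + p = 2) (β : M.Form p), β.IsRegular →
        (ClosedSurfaceMesh.bcProj R h β.d).Agree (ClosedSurfaceMesh.bcProj R h' β).d := by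
  obtain ⟨R₀, hR₀⟩ := ClosedSurfaceMesh.exists_isBuffaChristiansen (M := M)
  refine ⟨⟨R₀, hR₀, fun R hR => hR.unique hR₀⟩, fun R hR => ⟨fun r q h =>
    ⟨ClosedSurfaceMesh.bcProj_mem R h, fun b hb =>
      ⟨ClosedSurfaceMesh.IsBuffaChristiansen.isRegular h hb, hR.bcProj_eq_self h hb⟩⟩, ?_⟩⟩
  intro r p h h' β hβ
  obtain ⟨rfl, rfl⟩ | ⟨rfl, rfl⟩ : (r = 1 ∧ p = 0) ∨ (r = 0 ∧ p = 1) := by omega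
  · exact hR.bcProj_d_zero hβ
  · exact hR.bcProj_d_one hβ
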